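/- For $T>0$ let $m_T(\xi)=\sqrt{(1+T\xi^2)\tanh(\xi)/\xi}$ for $\xi\neq0$ and $m_T(0)=1$. For $\kappa>0$ let $M_{T,\kappa}$ be the Fourier multiplier with symbol $\xi\mapsto m_T(\kappa\xi)$ acting on functions on $\mathbb T=\mathbb R/2\pi\mathbb Z$, and consider the scaled steady equation $$ (M_{T,\kappa}-c)u+u^2=0. \tag{1}$$ A function $u:\mathbb R\to\mathbb R$ is symmetric if $x\mapsto u(x+a)$ is even for some $a\in\mathbb R$, and asymmetric otherwise. For $s>1$ let $\mathcal C^s(\mathbb T)$ be the Zygmund space of real-valued functions on $\mathbb T$. A triple $(c_0,\kappa_0,T_0)\in\mathbb R_+^3$ is a double bifurcation point with wave number pair $(k_1,k_2)$, $k_1\ne k_2$, if $k_1,k_2$ are exactly the positive integers $k$ with $c_0=m_{T_0}(\kappa_0k)$. For $T\in(0,\frac13)$ and $1\le k_1<k_2$ there is a unique pair $(c_0,\kappa_0)=(c_0(T;k_1,k_2),\kappa_0(T;k_1,k_2))\in\mathbb R_+^2$ with $m_T(\kappa_0k_1)=c_0=m_T(\kappa_0k_2)$. Put $\ell(n)=(c_0-m_T(\kappa_0n))^{-1}$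 for $n\in\mathbb Z\setminus\{\pm k_1,\pm k_2\}$ and $\ell(\pm k_1)=\ell(\pm k_2)=0$. For multi-indices $\alpha,\beta\in\mathbb N_0^2$ define $\hat u_{0,0}=0$, $\hat u_{\alpha,\beta}=\frac12$ if $|\alpha|+|\beta|=1$, and for $|\alpha|+|\beta|\ge2$ $$\hat u_{\alpha,\beta}=\ell\big(k_1(\alpha_1-\beta_1)+k_2(\alpha_2-\beta_2)\big)\,\widehat{u^2}_{\alpha,\beta},\qquad \widehat{u^2}_{\alpha,\beta}=\sum_{\substack{\alpha'+\alpha''=\alpha\\ \beta'+\beta''=\beta\\ (\alpha',\beta')\ne 0\ne(\alpha'',\beta'')}}\hat u_{\alpha',\beta'}\hat u_{\alpha'',\beta''},$$ and set $\phi(T;k_1,k_2)=\widehat{u^2}_{(k_2-1,0),(0,k_1)}$. A double bifurcation point $(c_0,\kappa_0,T_0)$ is a symmetry breaking bifurcation point if $\phi(T_0;k_1,k_2)=0$ and $\phi(\cdot\,;k_1,k_2)$ is strictly monotone in a neighbourhood of $T_0$; it is nondegenerate if moreover $\partial_T\phi(T_0;k_1,k_2)\ne0$. The pair $(k_1,k_2)$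 admits symmetry breaking if such a point exists. **Theorem.** Let $s>1$, let $2\le k_1<k_2$ be coprime integers such that $(k_1,k_2)$ admits symmetry breaking, and let $(c_0,\kappa_0,T_0)$ be any symmetry breaking bifurcation point with wave number pair $(k_1,k_2)$. Let $\Theta=(\mathbb R/\frac{2\pi}{k_1}\mathbb Z)\times(\mathbb R/\frac{2\pi}{k_2}\mathbb Z)$ and $v(x;r,\theta)=r_1\cos(k_1(x+\theta_1))+r_2\cos(k_2(x+\theta_2))$. Then for every $\delta>0$ there are $\varepsilon>0$ and a map $$[0,\varepsilon)^2\times\Theta\to\mathcal C^s(\mathbb T)\times\mathbb R_+^2\times(0,\tfrac13),\qquad (r,\theta)\mapsto(u(r,\theta),c(r,\theta),\kappa(r,\theta),T(r,\theta)),$$ such that each $(u,c,\kappa,T)(r,\theta)$ solves (1) and satisfies $\|u\|_{\mathcal C^s}<\delta$, $|c-c_0|<\delta$, $|\kappa-\kappa_0|<\delta$, $|T-T_0|<\delta$; such that $u(r,\theta)-v(\cdot\,;r,\theta)$ is $L^2(\mathbb T)$-orthogonal to $\cos(k_1x),\cos(k_2x),\sin(k_1x),\sin(k_2x)$; and such that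 $x\mapsto u(x;r,\theta)$ is asymmetric if and only if $r_1r_2\neq0$ and $\theta_1-\theta_2\notin\frac{\pi}{k_1k_2}\mathbb Z$. Moreover, if $(c_0,\kappa_0,T_0)$ is nondegenerate, then $u,c,\kappa,T$ depend analytically on $(r,\theta)\in[0,\varepsilon)^2\times\Theta$ and, uniformly in $\theta$, $$u=r_1\cos(k_1(x+\theta_1))+r_2\cos(k_2(x+\theta_2))+\mathcal O(|r|^2),\quad c=c_0+\mathcal O(|r|^2),\quad \kappa=\kappa_0+\mathcal O(|r|^2),\quad T=T_0+\mathcal O(|r|^2),$$ where the first remainder is measured in $\mathcal C^s(\mathbb T)$. -/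

import Mathlib

open Set Filter Topology MeasureTheory

namespace Whitham

noncomputable section

instance factTwoPiPos : Fact ((0 : ℝ) < 2 * Real.pi) := ⟨Real.two_pi_pos⟩

/-! ## Zygmund spaces on the circle `𝕋 = ℝ / 2πℤ` -/

/-- The circle `𝕋 = ℝ / 2πℤ`. -/
abbrev Torus : Type := AddCircle (2 * Real.pi)

/-- The `k`-th Fourier coefficient of a real continuous function on the circle,
`(2π)⁻¹ ∫ u(x) e^{-ikx} dx`. -/
def coeff (u : C(Torus, ℝ)) (k : ℤ) : ℂ :=
  fourierCoeff (fun x : Torus => (u x : ℂ)) k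

/-- A fixed even smooth cutoff, equal to `1` on `[-1, 1]` and to `0` outside `(-2, 2)`. -/
def cutoff : ContDiffBump (0 : ℝ) := ⟨1, 2, one_pos, one_lt_two⟩

/-- The dyadic symbols: `χ(ξ)` for `j = 0` and `χ(2⁻ʲ ξ) - χ(2⁻⁽ʲ⁻¹⁾ ξ)` for `j ≥ 1`. -/
def lpSymbol : ℕ → ℝ → ℝ
  | 0, ξ => cutoff ξ
  | j + 1, ξ => cutoff (ξ / 2 ^ (j + 1)) - cutoff (ξ / 2 ^ j)

/-- The `j`-th Littlewood-Paley block of `u`, that is, the convolution of `u` with the inverse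
Fourier transform of `lpSymbol j`. It is a trigonometric polynomial, since `lpSymbol j` vanishes
outside `(-2ʲ⁺¹, 2ʲ⁺¹)`. -/
def lpBlock (j : ℕ) (u : C(Torus, ℝ)) : C(Torus, ℂ) :=
  ∑ k ∈ Finset.Icc (-(2 ^ (j + 1) : ℤ)) (2 ^ (j + 1)),
    ((lpSymbol j k : ℂ) * coeff u k) • fourier k

theorem integrable_ofReal (u : C(Torus, ℝ)) :
    Integrable (fun x : Torus => (u x : ℂ)) AddCircle.haarAddCircle :=
  (Complex.continuous_ofReal.comp u.continuous).integrable_of_hasCompactSupport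
    (HasCompactSupport.of_compactSpace _)

theorem coeff_add (u v : C(Torus, ℝ)) (k : ℤ) : coeff (u + v) k = coeff u k + coeff v k := by
  have h := congrFun (fourierCoeff.add (integrable_ofReal u) (integrable_ofReal v)) k
  simp only [Pi.add_apply] at h
  rw [coeff, coeff, coeff, ← h]
  congr 1
  ext x
  simp

theorem coeff_smul (a : ℝ) (u : C(Torus, ℝ)) (k : ℤ) : coeff (a • u) k = (a : ℂ) * coeff u k := by
  rw [coeff, coeff, ← fourierCoeff.const_mul]
  congr 1
  ext x
  simp

theorem lpBlock_add (j : ℕ) (u v : C(Torus, ℝ)) :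
    lpBlock j (u + v) = lpBlock j u + lpBlock j v := by
  simp only [lpBlock, coeff_add, mul_add, add_smul, Finset.sum_add_distrib]

theorem lpBlock_smul (j : ℕ) (a : ℝ) (u : C(Torus, ℝ)) :
    lpBlock j (a • u) = (a : ℂ) • lpBlock j u := by
  simp only [lpBlock, coeff_smul, Finset.smul_sum, smul_smul]
  refine Finset.sum_congr rfl fun k _ => ?_
  congr 1
  ring

/-- The weighted sizes `2^{js} ‖u * φ_j‖_∞` whose supremum is the Zygmund norm. -/
def zygmundSize (s : ℝ) (u : C(Torus, ℝ)) (j : ℕ) : ℝ := (2 : ℝ) ^ ((j : ℝ) * s) * ‖lpBlock j u‖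

theorem zygmundSize_nonneg (s : ℝ) (u : C(Torus, ℝ)) (j : ℕ) : 0 ≤ zygmundSize s u j := by
  unfold zygmundSize
  positivity

theorem zygmundSize_add (s : ℝ) (u v : C(Torus, ℝ)) (j : ℕ) :
    zygmundSize s (u + v) j ≤ zygmundSize s u j + zygmundSize s v j := by
  unfold zygmundSize
  rw [lpBlock_add, ← mul_add]
  gcongr
  exact norm_add_le _ _

theorem zygmundSize_smul (s a : ℝ) (u : C(Torus, ℝ)) (j : ℕ) :
    zygmundSize s (a • u) j = |a| * zygmundSize s u j := by
  unfold zygmundSize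
  rw [lpBlock_smul, norm_smul, Complex.norm_real, Real.norm_eq_abs]
  ring

theorem zygmundSize_zero (s : ℝ) (j : ℕ) : zygmundSize s 0 j = 0 := by
  have h := zygmundSize_smul s 0 0 j
  simpa using h

/-- The continuous real functions on the circle with finite Zygmund norm of order `s`. -/
def zygmundSubmodule (s : ℝ) : Submodule ℝ C(Torus, ℝ) where
  carrier := {u | BddAbove (range (zygmundSize s u))}
  zero_mem' := ⟨0, by
    rintro _ ⟨j, rfl⟩
    exact (zygmundSize_zero s j).le⟩
  add_mem' := by
    rintro u v ⟨A, hA⟩ ⟨B, hB⟩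
    refine ⟨A + B, ?_⟩
    rintro _ ⟨j, rfl⟩
    exact (zygmundSize_add s u v j).trans (add_le_add (hA ⟨j, rfl⟩) (hB ⟨j, rfl⟩))
  smul_mem' := by
    rintro a u ⟨A, hA⟩
    refine ⟨|a| * A, ?_⟩
    rintro _ ⟨j, rfl⟩
    rw [zygmundSize_smul]
    exact mul_le_mul_of_nonneg_left (hA ⟨j, rfl⟩) (abs_nonneg a)

/-- The Zygmund space `𝒞ˢ(𝕋)` of real-valued functions, for `s > 0` (where all its elements are
continuous functions), with norm `sup_j 2^{js} ‖u * φ_j‖_∞`. -/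
def Zygmund (s : ℝ) : Type := zygmundSubmodule s

namespace Zygmund

variable {s : ℝ}

instance : AddCommGroup (Zygmund s) := inferInstanceAs (AddCommGroup (zygmundSubmodule s))

instance : Module ℝ (Zygmund s) := inferInstanceAs (Module ℝ (zygmundSubmodule s))

/-- The continuous function on the circle underlying an element of the Zygmund space. -/
def toCont (u : Zygmund s) : C(Torus, ℝ) := Subtype.val (p := (· ∈ zygmundSubmodule s)) u

/-- An element of the Zygmund space as a `2π`-periodic function on the real line. -/
def eval (u : Zygmund s) (x : ℝ) : ℝ := u.toCont (x : Torus)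

instance : Norm (Zygmund s) := ⟨fun u => ⨆ j, zygmundSize s u.toCont j⟩

theorem norm_def (u : Zygmund s) : ‖u‖ = ⨆ j, zygmundSize s u.toCont j := rfl

theorem bddAbove (u : Zygmund s) : BddAbove (range (zygmundSize s u.toCont)) :=
  Subtype.property (p := (· ∈ zygmundSubmodule s)) u

theorem toCont_add (u v : Zygmund s) : (u + v).toCont = u.toCont + v.toCont := rfl

theorem toCont_smul (a : ℝ) (u : Zygmund s) : (a • u).toCont = a • u.toCont := rfl

theorem toCont_injective : Function.Injective (toCont : Zygmund s → C(Torus, ℝ)) :=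
  Subtype.val_injective

end Zygmund

theorem fourierCoeff_lpBlock (j : ℕ) (u : C(Torus, ℝ)) (k : ℤ)
    (hk : k ∈ Finset.Icc (-(2 ^ (j + 1) : ℤ)) (2 ^ (j + 1))) :
    fourierCoeff (lpBlock j u) k = (lpSymbol j k : ℂ) * coeff u k := by
  have h1 : (lpBlock j u : Torus → ℂ) =
      ∑ n ∈ Finset.Icc (-(2 ^ (j + 1) : ℤ)) (2 ^ (j + 1)),
        (fun x : Torus => ((lpSymbol j n : ℂ) * coeff u n) * (fourier n x : ℂ)) := by
    ext x
    simp [lpBlock, ContinuousMap.sum_apply, Finset.sum_apply]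
  rw [h1, fourierCoeff.sum, Finset.sum_apply, Finset.sum_eq_single k]
  · rw [fourierCoeff.const_mul, fourierCoeff_fourier]
    simp
  · intro n _ hn
    rw [fourierCoeff.const_mul, fourierCoeff_fourier]
    simp [hn.symm]
  · exact fun h => (h hk).elim
  · intro n _
    exact (continuous_const.mul (fourier n).continuous).integrable_of_hasCompactSupport
      (HasCompactSupport.of_compactSpace _)

theorem coeff_eq_zero_of_lpBlock (u : C(Torus, ℝ)) (h : ∀ j, lpBlock j u = 0) (k : ℤ) :
    coeff u k = 0 := by
  have hout : ∀ j : ℕ, k ∉ Finset.Icc (-(2 ^ (j + 1) : ℤ)) (2 ^ (j + 1)) →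
      cutoff ((k : ℝ) / 2 ^ j) = 0 := by
    intro j hk
    apply cutoff.zero_of_le_dist
    have h2 : (2 : ℝ) ^ (j + 1) ≤ |(k : ℝ)| := by
      rw [Finset.mem_Icc, ← abs_le, not_le] at hk
      exact_mod_cast hk.le
    change (2 : ℝ) ≤ _
    rw [Real.dist_eq, sub_zero, abs_div, abs_of_pos (by positivity : (0 : ℝ) < 2 ^ j),
      le_div_iff₀ (by positivity)]
    calc (2 : ℝ) * 2 ^ j = 2 ^ (j + 1) := by ring
      _ ≤ _ := h2
  have hblock : ∀ j : ℕ, k ∈ Finset.Icc (-(2 ^ (j + 1) : ℤ)) (2 ^ (j + 1)) →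
      (lpSymbol j k : ℂ) * coeff u k = 0 := by
    intro j hk
    rw [← fourierCoeff_lpBlock j u k hk, h j]
    simp [fourierCoeff]
  have key : ∀ j : ℕ, ((cutoff ((k : ℝ) / 2 ^ j) : ℝ) : ℂ) * coeff u k = 0 := by
    intro j
    induction j with
    | zero =>
      by_cases hk : k ∈ Finset.Icc (-(2 ^ (0 + 1) : ℤ)) (2 ^ (0 + 1))
      · simpa [lpSymbol] using hblock 0 hk
      · rw [hout 0 hk]
        simp
    | succ j ih =>
      by_cases hk : k ∈ Finset.Icc (-(2 ^ (j + 1 + 1) : ℤ)) (2 ^ (j + 1 + 1))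
      · have h3 := hblock (j + 1) hk
        rw [lpSymbol, Complex.ofReal_sub, sub_mul, ih, sub_zero] at h3
        exact h3
      · rw [hout (j + 1) hk]
        simp
  obtain ⟨J, hJ⟩ := pow_unbounded_of_one_lt |(k : ℝ)| (one_lt_two : (1 : ℝ) < 2)
  have hone : cutoff ((k : ℝ) / 2 ^ J) = 1 := by
    apply cutoff.one_of_mem_closedBall
    rw [Metric.mem_closedBall, Real.dist_eq, sub_zero, abs_div,
      abs_of_pos (by positivity : (0 : ℝ) < 2 ^ J)]
    exact (div_le_one (by positivity)).2 hJ.le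
  simpa [hone] using key J

theorem eq_zero_of_coeff (u : C(Torus, ℝ)) (h : ∀ k, coeff u k = 0) : u = 0 := by
  let U : C(Torus, ℂ) := ⟨fun x => (u x : ℂ), Complex.continuous_ofReal.comp u.continuous⟩
  have hU : fourierCoeff U = 0 := funext h
  ext x
  have h1 := has_pointwise_sum_fourier_series_of_summable (f := U) (by rw [hU]; exact summable_zero) x
  have h2 : U x = 0 := by
    refine h1.unique ?_
    rw [hU]
    simp
  exact Complex.ofReal_eq_zero.1 h2

namespace Zygmund

variable {s : ℝ}

theorem core (s : ℝ) : NormedSpace.Core ℝ (Zygmund s) where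
  norm_nonneg u := Real.iSup_nonneg fun j => zygmundSize_nonneg s _ j
  norm_smul a u := by
    simp only [norm_def, toCont_smul, zygmundSize_smul, Real.norm_eq_abs]
    exact (Real.mul_iSup_of_nonneg (abs_nonneg a) _).symm
  norm_triangle u v := by
    simp only [norm_def, toCont_add]
    refine ciSup_le fun j => (zygmundSize_add s _ _ j).trans ?_
    exact add_le_add (le_ciSup u.bddAbove j) (le_ciSup v.bddAbove j)
  norm_eq_zero_iff u := by
    constructor
    · intro h
      have h1 : ∀ j, lpBlock j u.toCont = 0 := by
        intro j
        have h2 : zygmundSize s u.toCont j ≤ 0 := by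
          rw [← h]
          exact le_ciSup u.bddAbove j
        have h3 : zygmundSize s u.toCont j = 0 := le_antisymm h2 (zygmundSize_nonneg _ _ _)
        have h4 : (2 : ℝ) ^ ((j : ℝ) * s) ≠ 0 := by positivity
        exact norm_eq_zero.1 ((mul_eq_zero.1 h3).resolve_left h4)
      exact toCont_injective (eq_zero_of_coeff _ (coeff_eq_zero_of_lpBlock _ h1))
    · rintro rfl
      have h0 : (0 : Zygmund s).toCont = 0 := rfl
      simp [norm_def, h0, zygmundSize_zero]

instance : NormedAddCommGroup (Zygmund s) := NormedAddCommGroup.ofCore (core s)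

instance : NormedSpace ℝ (Zygmund s) := NormedSpace.ofCore (core s)

end Zygmund

/-! ## The steady capillary Whitham equation -/

/-- The dispersion symbol `m_T(ξ) = √((1 + T ξ²) tanh ξ / ξ)`, extended continuously by
`m_T(0) = 1`. -/
def symbol (T ξ : ℝ) : ℝ :=
  if ξ = 0 then 1 else Real.sqrt ((1 + T * ξ ^ 2) * Real.tanh ξ / ξ)

/-- `(u, c, κ, T)` solves `(M_{T,κ} - c) u + u² = 0`, where `M_{T,κ}` is the Fourier multiplier
with symbol `ξ ↦ m_T(κ ξ)`: there is a continuous function `g = M_{T,κ} u`, identified by its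
Fourier coefficients, with `g - c u + u² = 0`. -/
def IsSolution {s : ℝ} (u : Zygmund s) (c κ T : ℝ) : Prop :=
  ∃ g : C(Torus, ℝ), (∀ k : ℤ, coeff g k = (symbol T (κ * k) : ℂ) * coeff u.toCont k) ∧
    ∀ x : Torus, g x - c * u.toCont x + u.toCont x ^ 2 = 0

/-- A function is symmetric if one of its translates is even. -/
def IsSymmetric (f : ℝ → ℝ) : Prop := ∃ a : ℝ, Function.Even fun x => f (x + a)

/-- A function is asymmetric if none of its translates is even. -/
def IsAsymmetric (f : ℝ → ℝ) : Prop := ¬ IsSymmetric f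

/-! ## Bifurcation points and the symmetry breaking criterion -/

/-- `(c, κ, T)`, with positive entries, is a double bifurcation point with wave numbers
`k₁ ≠ k₂`: these are exactly the positive integers `k` with `c = m_T(κ k)`. -/
def IsDoubleBifurcationPoint (k₁ k₂ : ℕ) (c κ T : ℝ) : Prop :=
  0 < c ∧ 0 < κ ∧ 0 < T ∧ k₁ ≠ k₂ ∧ {k : ℕ | 0 < k ∧ c = symbol T (κ * k)} = {k₁, k₂}

/-- The pair `(c₀(T; k₁, k₂), κ₀(T; k₁, k₂))`: for `0 < T < 1/3` and `1 ≤ k₁ < k₂`, the unique pair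
of positive numbers with `m_T(κ₀ k₁) = c₀ = m_T(κ₀ k₂)`. -/
def bifPair (k₁ k₂ : ℕ) (T : ℝ) : ℝ × ℝ :=
  Classical.epsilon fun p : ℝ × ℝ =>
    0 < p.1 ∧ 0 < p.2 ∧ symbol T (p.2 * k₁) = p.1 ∧ symbol T (p.2 * k₂) = p.1

/-- The symbol `ℓ` of `(c - M_{T,κ})⁻¹ P_W`: it is `(c - m_T(κ n))⁻¹` for `n ≠ ± k₁, ± k₂`, and
`0` for `n = ± k₁, ± k₂`. -/
def ell (k₁ k₂ : ℕ) (c κ T : ℝ) (n : ℤ) : ℝ :=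
  if n.natAbs = k₁ ∨ n.natAbs = k₂ then 0 else (c - symbol T (κ * n))⁻¹

/-- The ways to write a pair of multi-indices `(α, β)` as `(α' + α'', β' + β'')` with
`(α', β') ≠ 0` and `(α'', β'') ≠ 0`. A pair of multi-indices in `ℕ²` is coded as
`((α₁, α₂), (β₁, β₂))`. -/
def splits (m : (ℕ × ℕ) × (ℕ × ℕ)) : Finset (((ℕ × ℕ) × (ℕ × ℕ)) × ((ℕ × ℕ) × (ℕ × ℕ))) :=
  ((Finset.Iic m) ×ˢ (Finset.Iic m)).filter fun p => p.1 + p.2 = m ∧ p.1 ≠ 0 ∧ p.2 ≠ 0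

/-- The total order `|α| + |β|`. -/
def order (m : (ℕ × ℕ) × (ℕ × ℕ)) : ℕ := m.1.1 + m.1.2 + (m.2.1 + m.2.2)

theorem order_lt_of_mem_splits {m : (ℕ × ℕ) × (ℕ × ℕ)}
    {p : ((ℕ × ℕ) × (ℕ × ℕ)) × ((ℕ × ℕ) × (ℕ × ℕ))} (hp : p ∈ splits m) :
    order p.1 < order m ∧ order p.2 < order m := by
  obtain ⟨⟨⟨a, b⟩, ⟨c, d⟩⟩, ⟨⟨a', b'⟩, ⟨c', d'⟩⟩⟩ := p
  obtain ⟨-, rfl, h1, h2⟩ := Finset.mem_filter.1 hp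
  simp only [ne_eq, Prod.mk_eq_zero, Prod.mk_add_mk, order] at *
  omega

/-- The Taylor-Fourier coefficients `û_{α,β}` of the formal solution
`u = ∑ û_{α,β} r^{α+β} E^{α-β}`, `E = (e^{i k₁ (x + θ₁)}, e^{i k₂ (x + θ₂)})`, of `w = L (v + w)²`.
They vanish in order `0`, equal `1/2` in order `1` (that is the function
`v = r₁ cos(k₁(x + θ₁)) + r₂ cos(k₂(x + θ₂))`), and satisfy
`û_{α,β} = ℓ(k₁(α₁-β₁) + k₂(α₂-β₂)) ∑ û_{α',β'} û_{α'',β''}` in higher order. -/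
def uHat (k₁ k₂ : ℕ) (l : ℤ → ℝ) (m : (ℕ × ℕ) × (ℕ × ℕ)) : ℝ :=
  if order m = 1 then 1 / 2
  else l (k₁ * ((m.1.1 : ℤ) - m.2.1) + k₂ * ((m.1.2 : ℤ) - m.2.2)) *
    ∑ p ∈ (splits m).attach, uHat k₁ k₂ l p.1.1 * uHat k₁ k₂ l p.1.2
termination_by order m
decreasing_by
  · exact (order_lt_of_mem_splits p.2).1
  · exact (order_lt_of_mem_splits p.2).2

/-- The Taylor-Fourier coefficients of `u²`: the sum of `û_{α',β'} û_{α'',β''}` over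
`α' + α'' = α`, `β' + β'' = β`. -/
def uSqHat (k₁ k₂ : ℕ) (l : ℤ → ℝ) (m : (ℕ × ℕ) × (ℕ × ℕ)) : ℝ :=
  ∑ p ∈ splits m, uHat k₁ k₂ l p.1 * uHat k₁ k₂ l p.2

/-- The function `φ(T; k₁, k₂)`: the coefficient of `u²` with index `α = (k₂ - 1, 0)`,
`β = (0, k₁)` at `(c₀, κ₀, T)`. -/
def phi (k₁ k₂ : ℕ) (T : ℝ) : ℝ :=
  uSqHat k₁ k₂ (ell k₁ k₂ (bifPair k₁ k₂ T).1 (bifPair k₁ k₂ T).2 T) ((k₂ - 1, 0), (0, k₁))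

/-- A symmetry breaking bifurcation point: a double bifurcation point `(c₀, κ₀, T₀)` such that
`φ(T₀) = 0` and `φ` is strictly monotone near `T₀`. -/
def IsSymmetryBreakingPoint (k₁ k₂ : ℕ) (c₀ κ₀ T₀ : ℝ) : Prop :=
  IsDoubleBifurcationPoint k₁ k₂ c₀ κ₀ T₀ ∧ phi k₁ k₂ T₀ = 0 ∧
    ∃ N ∈ 𝓝 T₀, StrictMonoOn (phi k₁ k₂) N ∨ StrictAntiOn (phi k₁ k₂) N

/-- A symmetry breaking bifurcation point is nondegenerate if `∂_T φ(T₀) ≠ 0`. -/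
def IsNondegenerate (k₁ k₂ : ℕ) (T₀ : ℝ) : Prop := deriv (phi k₁ k₂) T₀ ≠ 0

/-! ## The parameters -/

/-- The torus `Θ = (ℝ / (2π/k₁) ℤ) × (ℝ / (2π/k₂) ℤ)` of phases. -/
abbrev Phases (k₁ k₂ : ℕ) : Type := AddCircle (2 * Real.pi / k₁) × AddCircle (2 * Real.pi / k₂)

/-- The class of `(θ₁, θ₂) ∈ ℝ²` in `Θ`. -/
def phase (k₁ k₂ : ℕ) (θ : ℝ × ℝ) : Phases k₁ k₂ := (θ.1, θ.2)

/-- The amplitudes `r ∈ [0, ε)²`. -/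
def amplitudes (ε : ℝ) : Set (ℝ × ℝ) := Ico 0 ε ×ˢ Ico 0 ε

/-- The bimodal function `v(x; r, θ) = r₁ cos(k₁(x + θ₁)) + r₂ cos(k₂(x + θ₂))`. -/
def bimodal (k₁ k₂ : ℕ) (r θ : ℝ × ℝ) (x : ℝ) : ℝ :=
  r.1 * Real.cos (k₁ * (x + θ.1)) + r.2 * Real.cos (k₂ * (x + θ.2))

/-- `f` is `L²(𝕋)`-orthogonal to `V = span {cos(k₁x), cos(k₂x), sin(k₁x), sin(k₂x)}`. -/
def IsOrthogonalToV (k₁ k₂ : ℕ) (f : ℝ → ℝ) : Prop :=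
  ∀ k ∈ ({k₁, k₂} : Set ℕ),
    (∫ x in (0 : ℝ)..(2 * Real.pi), f x * Real.cos (k * x)) = 0 ∧
    (∫ x in (0 : ℝ)..(2 * Real.pi), f x * Real.sin (k * x)) = 0

end

end Whitham

namespace Whitham

noncomputable section

open scoped BoundedContinuousFunction ENNReal ContDiff ComplexConjugate

/-! ## Summable families -/

/-! The proof is a Lyapunov-Schmidt reduction carried out with explicit power series. Put `z_j = ρ_j
e^{iφ_j}`. The recursion for `û` solves the equation in every mode except `± k₁`, `± k₂`, as a power
series in `z` and its conjugate. Since `ℓ` is bounded, the recursion with weights `τ^{|α|+|β|}` is a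
quadratic equation in `ℓ¹`, solved by the analytic implicit function theorem (`exists_series`). The
family `ℓ` is itself analytic in `(c, κ, T)` with values in `ℓ^∞` (`exists_analytic_ell`), so the
whole series depends analytically on the parameters.

The modes `k₁` and `k₂` leave four real equations for the three unknowns `c, κ, T`. One of them is
redundant: `∫ u' u² = 0`, and `∫ u' Mu = 0` because the symbol is even, so the imaginary part in the
mode `k₂` follows from the other equations (`fc_eq_of_modes`). By coprimality, an index in the mode
`k₁` has `α - β = (1, 0) + j (k₂, -k₁)`, hence phase `jψ` relative to that mode, where `ψ = k₂φ₁ -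
k₁φ₂`. So the imaginary part in the mode `k₁` is divisible by `ρ₁^{k₂-1} ρ₂^{k₁} sin ψ`, and the
real parts by `ρ₁` and `ρ₂` (`sin_term_fst`, `cos_term_fst`, `cos_term_snd`). The identities for
Chebyshev polynomials turn the quotients into power series in `y = (ρ₁, ρ₂, ρ₁ cos ψ)`. The angles
thus enter only through the small vector `y`, and a neighbourhood of `y = 0` serves all phases at
once.

At `y = 0` the reduced equations say `m_T(κk₁) = c = m_T(κk₂)` and `φ(T) = 0`; all corrections are
quadratic in `y`. The first two equations determine `(c, κ)` from `(T, y)`, because the symbol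
decreases up to a unique critical point lying between `κk₁` and `κk₂` and increases after it
(`exists_hasDerivAt_symbol_sub`). The third is a perturbation of `φ(T) = 0`. Strict monotonicity of
`φ` gives a root by the intermediate value theorem; if `∂_T φ ≠ 0`, the implicit function theorem
gives an analytic root at distance `O(|y|²)` (`exists_branch`).

Finally, the coefficients are real, so reflecting the wave conjugates `z`. The wave is symmetric
exactly when some translation makes both `z₁` and `z₂` real (`isSymmetric_wave_iff`), and Bézout's
identity turns this into the condition on `θ₁ - θ₂` (`exists_sin_iff`). -/

/-- The space of absolutely summable families. -/
abbrev L1 (ι E : Type*) [NormedAddCommGroup E] : Type _ := lp (fun _ : ι => E) 1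

theorem L1.summable_norm {ι E : Type*} [NormedAddCommGroup E] (a : L1 ι E) :
    Summable fun i => ‖a i‖ := by
  simpa using a.2.summable

theorem L1.norm_eq {ι E : Type*} [NormedAddCommGroup E] (a : L1 ι E) :
    ‖a‖ = ∑' i, ‖a i‖ := by
  rw [lp.norm_eq_tsum_rpow (by simp)]
  simp

/-- The element of `L1` given by an absolutely summable family. -/
def L1.mk {ι E : Type*} [NormedAddCommGroup E] (f : ι → E) (hf : Summable fun i => ‖f i‖) :
    L1 ι E :=
  ⟨f, memℓp_gen (by simpa using hf)⟩

@[simp] theorem L1.mk_apply {ι E : Type*} [NormedAddCommGroup E] (f : ι → E)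
    (hf : Summable fun i => ‖f i‖) (i : ι) : L1.mk f hf i = f i := rfl

theorem summable_norm_smul {ι E : Type*} [TopologicalSpace ι] [NormedAddCommGroup E]
    [NormedSpace ℝ E] (a : L1 ι ℝ) (h : ι →ᵇ E) : Summable fun i => ‖a i • h i‖ := by
  refine Summable.of_nonneg_of_le (fun i => norm_nonneg _) (fun i => ?_)
    (a.summable_norm.mul_right ‖h‖)
  rw [norm_smul]
  exact mul_le_mul_of_nonneg_left (h.norm_coe_le_norm i) (norm_nonneg _)

/-- The product of a summable family and a bounded family. -/
def mulL (ι E : Type*) [TopologicalSpace ι] [NormedAddCommGroup E] [NormedSpace ℝ E] :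
    L1 ι ℝ →L[ℝ] (ι →ᵇ E) →L[ℝ] L1 ι E :=
  LinearMap.mkContinuous₂
    (LinearMap.mk₂ ℝ (fun a h => L1.mk (fun i => a i • h i) (summable_norm_smul a h))
      (fun a b h => by ext i; simp [add_smul])
      (fun c a h => by ext i; simp [mul_smul])
      (fun a h k => by ext i; simp [smul_add])
      (fun c a h => by ext i; exact smul_comm (a i) c (h i))) 1 (fun a h => by
        rw [LinearMap.mk₂_apply, L1.norm_eq, one_mul, L1.norm_eq, ← tsum_mul_right]
        refine Summable.tsum_le_tsum (fun i => ?_) (summable_norm_smul a h)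
          (a.summable_norm.mul_right ‖h‖)
        rw [L1.mk_apply, norm_smul]
        exact mul_le_mul_of_nonneg_left (h.norm_coe_le_norm i) (norm_nonneg _))

@[simp] theorem mulL_apply {ι E : Type*} [TopologicalSpace ι] [NormedAddCommGroup E]
    [NormedSpace ℝ E] (a : L1 ι ℝ) (h : ι →ᵇ E) (i : ι) : mulL ι E a h i = a i • h i := rfl

theorem norm_mulL_le {ι E : Type*} [TopologicalSpace ι] [NormedAddCommGroup E]
    [NormedSpace ℝ E] (a : L1 ι ℝ) (h : ι →ᵇ E) : ‖mulL ι E a h‖ ≤ ‖a‖ * ‖h‖ := by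
  rw [L1.norm_eq, L1.norm_eq, ← tsum_mul_right]
  refine Summable.tsum_le_tsum (fun i => ?_) (summable_norm_smul a h)
    (a.summable_norm.mul_right ‖h‖)
  rw [mulL_apply, norm_smul]
  exact mul_le_mul_of_nonneg_left (h.norm_coe_le_norm i) (norm_nonneg _)

/-- Pairs of multi-indices. -/
abbrev Idx : Type := (ℕ × ℕ) × (ℕ × ℕ)

instance idxAntidiagonal : Finset.HasAntidiagonal Idx := Finset.HasAntidiagonal.antidiagonalOfLocallyFinite

theorem splits_subset (m : Idx) : splits m ⊆ Finset.HasAntidiagonal.antidiagonal m := by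
  intro p hp
  rw [Finset.HasAntidiagonal.mem_antidiagonal]
  exact (Finset.mem_filter.1 hp).2.1

theorem mem_splits {m : Idx} {p : Idx × Idx} :
    p ∈ splits m ↔ p.1 + p.2 = m ∧ p.1 ≠ 0 ∧ p.2 ≠ 0 := by
  simp only [splits, Finset.mem_filter, Finset.mem_product, Finset.mem_Iic]
  constructor
  · exact fun h => h.2
  · intro h
    exact ⟨⟨h.1 ▸ le_self_add, h.1 ▸ le_add_self⟩, h⟩

theorem summable_norm_mul_norm (a b : L1 Idx ℝ) :
    Summable fun p : Idx × Idx => ‖a p.1‖ * ‖b p.2‖ :=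
  a.summable_norm.mul_of_nonneg b.summable_norm (fun _ => norm_nonneg _) (fun _ => norm_nonneg _)

theorem summable_antidiagonal (a b : L1 Idx ℝ) : Summable fun m =>
    ∑ p ∈ Finset.HasAntidiagonal.antidiagonal m, ‖a p.1‖ * ‖b p.2‖ :=
  summable_sum_mul_antidiagonal_of_summable_mul (f := fun i => ‖a i‖) (g := fun i => ‖b i‖)
    (summable_norm_mul_norm a b)

theorem tsum_antidiagonal (a b : L1 Idx ℝ) : (∑' m, ‖a m‖) * ∑' m, ‖b m‖ = ∑' m,
    ∑ p ∈ Finset.HasAntidiagonal.antidiagonal m, ‖a p.1‖ * ‖b p.2‖ :=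
  Summable.tsum_mul_tsum_eq_tsum_sum_antidiagonal (f := fun i => ‖a i‖) (g := fun i => ‖b i‖)
    a.summable_norm b.summable_norm (summable_norm_mul_norm a b)

theorem norm_sum_splits_le (a b : L1 Idx ℝ) (m : Idx) :
    ‖∑ p ∈ splits m, a p.1 * b p.2‖ ≤ ∑ p ∈ Finset.HasAntidiagonal.antidiagonal m, ‖a p.1‖ * ‖b p.2‖ := by
  refine (norm_sum_le _ _).trans ?_
  simp only [norm_mul]
  exact Finset.sum_le_sum_of_subset_of_nonneg (splits_subset m) fun _ _ _ => by positivity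

theorem summable_norm_sum_splits (a b : L1 Idx ℝ) :
    Summable fun m => ‖∑ p ∈ splits m, a p.1 * b p.2‖ :=
  Summable.of_nonneg_of_le (fun _ => norm_nonneg _) (norm_sum_splits_le a b)
    (summable_antidiagonal a b)

/-- The product of formal power series without constant terms. -/
def convFun (a b : L1 Idx ℝ) : L1 Idx ℝ :=
  L1.mk (fun m => ∑ p ∈ splits m, a p.1 * b p.2) (summable_norm_sum_splits a b)

theorem convFun_apply (a b : L1 Idx ℝ) (m : Idx) :
    convFun a b m = ∑ p ∈ splits m, a p.1 * b p.2 := rfl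

theorem norm_convFun_le (a b : L1 Idx ℝ) : ‖convFun a b‖ ≤ 1 * ‖a‖ * ‖b‖ := by
  rw [L1.norm_eq, one_mul, L1.norm_eq, L1.norm_eq, tsum_antidiagonal]
  exact Summable.tsum_le_tsum (norm_sum_splits_le a b) (summable_norm_sum_splits a b)
    (summable_antidiagonal a b)

theorem convFun_add_left (a b h : L1 Idx ℝ) : convFun (a + b) h = convFun a h + convFun b h := by
  refine lp.ext (funext fun m => ?_)
  rw [lp.coeFn_add, Pi.add_apply, convFun_apply, convFun_apply, convFun_apply,
    ← Finset.sum_add_distrib]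
  exact Finset.sum_congr rfl fun p _ => add_mul _ _ _

theorem convFun_add_right (a b h : L1 Idx ℝ) : convFun a (b + h) = convFun a b + convFun a h := by
  refine lp.ext (funext fun m => ?_)
  rw [lp.coeFn_add, Pi.add_apply, convFun_apply, convFun_apply, convFun_apply,
    ← Finset.sum_add_distrib]
  exact Finset.sum_congr rfl fun p _ => mul_add _ _ _

theorem convFun_smul_left (c : ℝ) (a b : L1 Idx ℝ) : convFun (c • a) b = c • convFun a b := by
  refine lp.ext (funext fun m => ?_)
  rw [lp.coeFn_smul, Pi.smul_apply, convFun_apply, convFun_apply, Finset.smul_sum]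
  exact Finset.sum_congr rfl fun p _ => mul_assoc _ _ _

theorem convFun_smul_right (c : ℝ) (a b : L1 Idx ℝ) : convFun a (c • b) = c • convFun a b := by
  refine lp.ext (funext fun m => ?_)
  rw [lp.coeFn_smul, Pi.smul_apply, convFun_apply, convFun_apply, Finset.smul_sum]
  exact Finset.sum_congr rfl fun p _ => mul_left_comm _ _ _

/-- The product of formal power series without constant terms, as a continuous bilinear map. -/
def conv : L1 Idx ℝ →L[ℝ] L1 Idx ℝ →L[ℝ] L1 Idx ℝ :=
  LinearMap.mkContinuous₂
    (LinearMap.mk₂ ℝ convFun convFun_add_left convFun_smul_left convFun_add_right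
      convFun_smul_right) 1 norm_convFun_le

@[simp] theorem conv_apply (a b : L1 Idx ℝ) (m : Idx) :
    conv a b m = ∑ p ∈ splits m, a p.1 * b p.2 := rfl

/-! ## Bounded families -/

/-- Pullback of bounded families on discrete spaces. -/
def pull {α β : Type*} (E : Type*) [TopologicalSpace α] [DiscreteTopology α] [TopologicalSpace β]
    [NormedAddCommGroup E] [NormedSpace ℝ E] (g : α → β) : (β →ᵇ E) →L[ℝ] (α →ᵇ E) :=
  LinearMap.mkContinuous
    { toFun := fun f => f.compContinuous ⟨g, continuous_of_discreteTopology⟩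
      map_add' := fun _ _ => rfl
      map_smul' := fun _ _ => rfl } 1 (fun f => by
        rw [one_mul]
        exact (BoundedContinuousFunction.norm_le (norm_nonneg _)).2
          fun x => f.norm_coe_le_norm (g x))

@[simp] theorem pull_apply {α β E : Type*} [TopologicalSpace α] [DiscreteTopology α]
    [TopologicalSpace β] [NormedAddCommGroup E] [NormedSpace ℝ E] (g : α → β) (f : β →ᵇ E) (x : α) :
    pull E g f x = f (g x) := rfl

/-- A bounded family on a discrete space. -/
def bdd {α E : Type*} [TopologicalSpace α] [DiscreteTopology α] [NormedAddCommGroup E]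
    (f : α → E) (C : ℝ) (h : ∀ x, ‖f x‖ ≤ C) : α →ᵇ E :=
  BoundedContinuousFunction.ofNormedAddCommGroupDiscrete f C h

@[simp] theorem bdd_apply {α E : Type*} [TopologicalSpace α] [DiscreteTopology α]
    [NormedAddCommGroup E] (f : α → E) (C : ℝ) (h : ∀ x, ‖f x‖ ≤ C) (x : α) :
    bdd f C h x = f x := rfl

/-- The indicator of a set as a bounded family. -/
def ind {α : Type*} (E : Type*) [TopologicalSpace α] [DiscreteTopology α] [RCLike E] (s : Set α) :
    α →ᵇ E :=
  bdd (s.indicator 1) 1 fun x => by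
    by_cases h : x ∈ s <;> simp [h]

open Classical in
theorem ind_apply {α E : Type*} [TopologicalSpace α] [DiscreteTopology α] [RCLike E]
    (s : Set α) (x : α) : ind E s x = if x ∈ s then 1 else 0 := by
  simp [ind, Set.indicator_apply]

/-- The right shift. -/
def shift (𝕜 : Type*) [RCLike 𝕜] : (ℕ →ᵇ 𝕜) →L[𝕜] (ℕ →ᵇ 𝕜) :=
  LinearMap.mkContinuous
    { toFun := fun f => bdd (fun n => Nat.casesOn n 0 fun k => f k) ‖f‖ (by
        rintro (_ | n)
        · simp
        · exact f.norm_coe_le_norm n)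
      map_add' := fun f g => by ext (_ | n) <;> simp
      map_smul' := fun c f => by ext (_ | n) <;> simp } 1 (fun f => by
        rw [one_mul]
        refine (BoundedContinuousFunction.norm_le (norm_nonneg _)).2 ?_
        rintro (_ | n)
        · simp
        · exact f.norm_coe_le_norm n)

@[simp] theorem shift_zero {𝕜 : Type*} [RCLike 𝕜] (f : ℕ →ᵇ 𝕜) : shift 𝕜 f 0 = 0 := rfl

@[simp] theorem shift_succ {𝕜 : Type*} [RCLike 𝕜] (f : ℕ →ᵇ 𝕜) (n : ℕ) :
    shift 𝕜 f (n + 1) = f n := rfl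

/-! ## Analytic functions -/

attribute [fun_prop] analyticAt_fst analyticAt_snd

theorem analyticAt_bilin {𝕜 X E F G : Type*} [NontriviallyNormedField 𝕜] [NormedAddCommGroup X]
    [NormedSpace 𝕜 X] [NormedAddCommGroup E] [NormedSpace 𝕜 E] [NormedAddCommGroup F]
    [NormedSpace 𝕜 F] [NormedAddCommGroup G] [NormedSpace 𝕜 G] (B : E →L[𝕜] F →L[𝕜] G)
    {f : X → E} {g : X → F} {x : X} (hf : AnalyticAt 𝕜 f x) (hg : AnalyticAt 𝕜 g x) :
    AnalyticAt 𝕜 (fun x => B (f x) (g x)) x :=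
  AnalyticAt.fun_comp (f := fun x => (f x, g x)) (B.analyticAt_bilinear (f x, g x)) (hf.prod hg)

theorem analyticAt_lin {𝕜 X E F : Type*} [NontriviallyNormedField 𝕜] [NormedAddCommGroup X]
    [NormedSpace 𝕜 X] [NormedAddCommGroup E] [NormedSpace 𝕜 E] [NormedAddCommGroup F]
    [NormedSpace 𝕜 F] (B : E →L[𝕜] F) {f : X → E} {x : X} (hf : AnalyticAt 𝕜 f x) :
    AnalyticAt 𝕜 (fun x => B (f x)) x :=
  AnalyticAt.fun_comp (f := f) (B.analyticAt (f x)) hf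

theorem exists_equiv_sub {𝕜 F : Type*} [RCLike 𝕜] [NormedAddCommGroup F] [NormedSpace 𝕜 F]
    [CompleteSpace F] (A : F →L[𝕜] F) (hA : ‖A‖ < 1) :
    ∃ e : F ≃L[𝕜] F, (e : F →L[𝕜] F) = ContinuousLinearMap.id 𝕜 F - A := by
  obtain ⟨u, hu⟩ := isUnit_one_sub_of_norm_lt_one hA
  exact ⟨ContinuousLinearEquiv.unitsEquiv 𝕜 F u, hu⟩

/-- At class `ω` the implicit function theorem for `ContDiffAt` is the analytic one. Geometric and
Chebyshev sequences, inverses and square roots in `ℓ^∞`, and the formal solution are all obtained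
from it, as solutions of polynomial equations in Banach spaces. -/
theorem exists_analytic_implicit {𝕜 E F : Type*} [RCLike 𝕜] [NormedAddCommGroup E]
    [NormedSpace 𝕜 E]
    [CompleteSpace E] [NormedAddCommGroup F] [NormedSpace 𝕜 F] [CompleteSpace F]
    {f : E × F → F} {y : E} {a : F} (hf : AnalyticAt 𝕜 f (y, a)) (h0 : f (y, a) = 0)
    (e : F ≃L[𝕜] F) (he : HasFDerivAt (fun t => f (y, t)) (e : F →L[𝕜] F) a) :
    ∃ g : E → F, AnalyticAt 𝕜 g y ∧ g y = a ∧ (∀ᶠ z in 𝓝 y, f (z, g z) = 0) ∧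
      ∀ᶠ z in 𝓝 (y, a), f z = 0 → g z.1 = z.2 := by
  have hc : ContDiffAt 𝕜 ω f (y, a) := hf.contDiffAt
  have h1 : fderiv 𝕜 f (y, a) ∘L ContinuousLinearMap.inr 𝕜 E F = e := by
    have h2 : HasFDerivAt (fun t : F => (y, t)) (ContinuousLinearMap.inr 𝕜 E F) a :=
      hasFDerivAt_prodMk_right y a
    exact (hf.differentiableAt.hasFDerivAt.comp a h2).unique he
  have hi : (fderiv 𝕜 f (y, a) ∘L ContinuousLinearMap.inr 𝕜 E F).IsInvertible := ⟨e, h1.symm⟩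
  refine ⟨hc.implicitFunction (by simp) hi, ?_, ?_, ?_, ?_⟩
  · exact (hc.contDiffAt_implicitFunction (by simp) hi).analyticAt
  · exact hc.implicitFunction_apply_self (by simp) hi
  · have := hc.eventually_apply_implicitFunction (by simp) hi
    rwa [h0] at this
  · filter_upwards [hc.eventually_apply_eq_iff_implicitFunction (by simp) hi] with z hz
    rw [h0] at hz
    exact hz.1
/-- The scalar analytic implicit function theorem, with a Lipschitz bound. -/
theorem exists_analytic_implicit_scalar {E : Type*} [NormedAddCommGroup E] [NormedSpace ℝ E]
    [CompleteSpace E] {f : ℝ × E → ℝ} {a d : ℝ} {y : E} (hf : AnalyticAt ℝ f (a, y))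
    (h0 : f (a, y) = 0) (hd : HasDerivAt (fun t => f (t, y)) d a) (hd0 : d ≠ 0) :
    ∃ g : E → ℝ, AnalyticAt ℝ g y ∧ g y = a ∧ (∀ᶠ z in 𝓝 y, f (g z, z) = 0) ∧
      ∃ K : ℝ, ∀ᶠ z in 𝓝 (a, y), |z.1 - g z.2| ≤ K * |f z| := by
  let e : ℝ ≃L[ℝ] ℝ := ContinuousLinearEquiv.unitsEquivAut ℝ (Units.mk0 d hd0)
  have hf' : AnalyticAt ℝ (fun z : E × ℝ => f (z.2, z.1)) (y, a) :=
    AnalyticAt.fun_comp (f := fun z : E × ℝ => (z.2, z.1)) (by simpa using hf) (by fun_prop)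
  have he : (e : ℝ →L[ℝ] ℝ) = ContinuousLinearMap.toSpanSingleton ℝ d := by
    ext
    simp [e]
  obtain ⟨g, g1, g2, g3, -⟩ := exists_analytic_implicit hf' h0 e (by
    rw [he]
    exact hd.hasFDerivAt)
  refine ⟨g, g1, g2, g3, 2 / |d|, ?_⟩
  have hs : HasStrictFDerivAt f (fderiv ℝ f (a, y)) (a, y) := hf.hasStrictFDerivAt
  have hd1 : fderiv ℝ f (a, y) (1, 0) = d := by
    have h2 : HasFDerivAt (fun t : ℝ => (t, y)) (ContinuousLinearMap.inl ℝ ℝ E) a :=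
      hasFDerivAt_prodMk_left a y
    have h3 := (hf.differentiableAt.hasFDerivAt.comp a h2).hasDerivAt
    simpa using h3.unique hd
  -- Strict differentiability is used between `(t, z)` and `(g z, z)`. The error constant `|d| / 2`
  -- is absorbed into the main term `d (t - g z)`, which leaves the factor `2 / |d|`.
  have hlip := hs.isLittleO.def (c := |d| / 2) (by positivity)
  have hpair : Tendsto (fun z : ℝ × E => (z, (g z.2, z.2))) (𝓝 (a, y)) (𝓝 ((a, y), (a, y))) := by
    have h4 : ContinuousAt (fun z : ℝ × E => g z.2) (a, y) :=
      ContinuousAt.comp (f := Prod.snd) (x := (a, y)) g1.continuousAt continuousAt_snd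
    have h5 : ContinuousAt (fun z : ℝ × E => (z, (g z.2, z.2))) (a, y) :=
      continuousAt_id.prodMk (h4.prodMk continuousAt_snd)
    have h6 := h5.tendsto
    simpa only [g2] using h6
  have h7 : ∀ᶠ z : ℝ × E in 𝓝 (a, y), f (g z.2, z.2) = 0 :=
    (continuousAt_snd (p := (a, y))).eventually g3
  filter_upwards [hpair.eventually hlip, h7] with z hz hz0
  simp only [hz0, sub_zero] at hz
  have e1 : z - (g z.2, z.2) = (z.1 - g z.2) • ((1 : ℝ), (0 : E)) := by
    ext <;> simp
  rw [e1, map_smul, hd1, norm_smul, smul_eq_mul, Real.norm_eq_abs, Real.norm_eq_abs] at hz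
  have e2 : ‖((1 : ℝ), (0 : E))‖ = 1 := by simp [Prod.norm_def]
  rw [e2, mul_one] at hz
  have e3 : |d| * |z.1 - g z.2| ≤ |f z| + |d| / 2 * |z.1 - g z.2| := by
    rw [← abs_mul, mul_comm d]
    calc |(z.1 - g z.2) * d| = |f z - (f z - (z.1 - g z.2) * d)| := by ring_nf
      _ ≤ |f z| + |f z - (z.1 - g z.2) * d| := abs_sub _ _
      _ ≤ _ := by linarith
  have e4 : 0 < |d| := abs_pos.2 hd0
  rw [div_mul_eq_mul_div, le_div_iff₀ e4]
  linarith

/-! ## Geometric and Chebyshev sequences -/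

theorem norm_shift_le (𝕜 : Type*) [RCLike 𝕜] : ‖shift 𝕜‖ ≤ 1 :=
  LinearMap.mkContinuous_norm_le _ zero_le_one _

open Classical in
/-- The geometric sequence `(xⁿ)`, for `‖x‖ ≤ 1`. -/
def geo {𝕜 : Type*} [RCLike 𝕜] (x : 𝕜) : ℕ →ᵇ 𝕜 :=
  if h : ‖x‖ ≤ 1 then
    bdd (fun n => x ^ n) 1 fun n => by rw [norm_pow]; exact pow_le_one₀ (norm_nonneg _) h
  else 0

theorem geo_apply {𝕜 : Type*} [RCLike 𝕜] {x : 𝕜} (hx : ‖x‖ ≤ 1) (n : ℕ) : geo x n = x ^ n := by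
  simp [geo, hx]

/-- With `S` the right shift, the geometric sequence solves the linear equation `h = xSh + δ₀`,
whose operator `1 - xS` is invertible when `‖x‖ < 1`. -/
theorem analyticAt_geo {𝕜 : Type*} [RCLike 𝕜] {x : 𝕜} (hx : ‖x‖ < 1) :
    AnalyticAt 𝕜 (geo : 𝕜 → ℕ →ᵇ 𝕜) x := by
  let f : 𝕜 × (ℕ →ᵇ 𝕜) → ℕ →ᵇ 𝕜 := fun z => z.2 - z.1 • shift 𝕜 z.2 - ind 𝕜 {0}
  have hf0 : f (x, geo x) = 0 := by
    ext (_ | n)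
    · simp [f, geo_apply hx.le, ind_apply]
    · simp [f, geo_apply hx.le, ind_apply, pow_succ']
  have hfa : AnalyticAt 𝕜 f (x, geo x) := by
    refine (analyticAt_snd.sub (analyticAt_fst.smul ?_)).sub analyticAt_const
    exact analyticAt_lin (shift 𝕜) analyticAt_snd
  obtain ⟨e, he⟩ := exists_equiv_sub (x • shift 𝕜) (by
    rw [norm_smul]
    calc ‖x‖ * ‖shift 𝕜‖ ≤ ‖x‖ * 1 := by gcongr; exact norm_shift_le 𝕜
      _ < 1 := by simpa using hx)
  obtain ⟨g, g1, -, g3, -⟩ := exists_analytic_implicit hfa hf0 e (by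
    rw [he]
    exact ((ContinuousLinearMap.id 𝕜 (ℕ →ᵇ 𝕜) - x • shift 𝕜).hasFDerivAt).sub_const _)
  refine g1.congr ?_
  have hev : ∀ᶠ z : 𝕜 in 𝓝 x, ‖z‖ < 1 := continuous_norm.continuousAt.eventually (gt_mem_nhds hx)
  filter_upwards [g3, hev] with z hz hz1
  ext n
  rw [geo_apply hz1.le]
  induction n with
  | zero =>
    have h0 := congrArg (fun f : ℕ →ᵇ 𝕜 => f 0) hz
    simp [f, ind_apply] at h0
    simpa using (sub_eq_zero.1 h0)
  | succ n ih =>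
    have h0 := congrArg (fun f : ℕ →ᵇ 𝕜 => f (n + 1)) hz
    simp [f, ind_apply, ih] at h0
    rw [pow_succ']
    exact sub_eq_zero.1 h0

/-- The solution of `h (n + 2) = 2 q h (n + 1) - s² h n` with `h 0 = 1`, `h 1 = b`. -/
def chebSeq (s q b : ℝ) : ℕ → ℝ
  | 0 => 1
  | 1 => b
  | n + 2 => 2 * q * chebSeq s q b (n + 1) - s ^ 2 * chebSeq s q b n

/-- With `|s|, |q| ≤ X / 3` the recursion multiplies the bound by at most `2/3 + 1/9 < 1` times the
expected power of `X`. -/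
theorem abs_chebSeq_le {s q b X : ℝ} (hs : 3 * |s| ≤ X) (hq : 3 * |q| ≤ X) (hb : |b| ≤ 2 * |q|)
    (n : ℕ) : |chebSeq s q b n| ≤ X ^ n := by
  have hX : 0 ≤ X := le_trans (by positivity) hs
  have key : ∀ n, |chebSeq s q b n| ≤ X ^ n ∧ |chebSeq s q b (n + 1)| ≤ X ^ (n + 1) := by
    intro n
    induction n with
    | zero =>
      refine ⟨by simp [chebSeq], ?_⟩
      simp only [zero_add, pow_one, chebSeq]
      linarith [abs_nonneg q]
    | succ n ih =>
      refine ⟨ih.2, ?_⟩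
      rw [chebSeq]
      have e1 : |2 * q * chebSeq s q b (n + 1)| ≤ 2 * (X / 3) * X ^ (n + 1) := by
        rw [abs_mul, abs_mul, abs_two]
        gcongr
        · linarith
        · exact ih.2
      have e2 : |s ^ 2 * chebSeq s q b n| ≤ (X / 3) ^ 2 * X ^ n := by
        rw [abs_mul, abs_pow]
        gcongr
        · linarith
        · exact ih.1
      have e3 : (X / 3) ^ 2 * X ^ n = X ^ (n + 2) / 9 := by ring
      have e4 : 2 * (X / 3) * X ^ (n + 1) = 2 / 3 * X ^ (n + 2) := by ring
      have e5 : 0 ≤ X ^ (n + 2) := by positivity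
      calc |2 * q * chebSeq s q b (n + 1) - s ^ 2 * chebSeq s q b n|
          ≤ |2 * q * chebSeq s q b (n + 1)| + |s ^ 2 * chebSeq s q b n| := abs_sub _ _
        _ ≤ X ^ (n + 2) := by linarith
  exact (key n).1

open Classical in
/-- The sequence `chebSeq s q (a q)` for small `(s, q)`, with `a = 2` for Chebyshev polynomials of
the second kind and `a = 1` for those of the first kind. -/
def cheb (a : ℝ) (z : ℝ × ℝ) : ℕ →ᵇ ℝ :=
  if h : 3 * |z.1| ≤ 1 ∧ 3 * |z.2| ≤ 1 ∧ |a * z.2| ≤ 2 * |z.2| then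
    bdd (chebSeq z.1 z.2 (a * z.2)) 1 fun n => by
      simpa using abs_chebSeq_le h.1 h.2.1 h.2.2 n
  else 0

theorem cheb_apply {a s q : ℝ} (ha : |a| ≤ 2) (hs : 3 * |s| ≤ 1) (hq : 3 * |q| ≤ 1) (n : ℕ) :
    cheb a (s, q) n = chebSeq s q (a * q) n := by
  have h : |a * q| ≤ 2 * |q| := by
    rw [abs_mul]
    gcongr
  have h' : 3 * |s| ≤ 1 ∧ 3 * |q| ≤ 1 ∧ |a * q| ≤ 2 * |q| := ⟨hs, hq, h⟩
  rw [cheb, dif_pos h', bdd_apply]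

/-- The recursion is a linear equation in the shift whose operator is the identity at `(s, q) = (0,
0)`. -/
theorem analyticAt_cheb {a : ℝ} (ha : |a| ≤ 2) : AnalyticAt ℝ (cheb a) 0 := by
  -- The recursion alone would give `h 1 = 2q`; the source `(a - 2) q` at the index `1` corrects
  -- this to `h 1 = a q`.
  let f : (ℝ × ℝ) × (ℕ →ᵇ ℝ) → ℕ →ᵇ ℝ := fun z =>
    z.2 - (2 * z.1.2) • shift ℝ z.2 + (z.1.1 ^ 2) • shift ℝ (shift ℝ z.2)
      - (ind ℝ {0} + ((a - 2) * z.1.2) • ind ℝ {1})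
  have hf0 : f (0, ind ℝ {0}) = 0 := by
    ext n
    simp [f]
  have hfa : AnalyticAt ℝ f (0, ind ℝ {0}) := by
    have h1 : AnalyticAt ℝ (fun z : (ℝ × ℝ) × (ℕ →ᵇ ℝ) => shift ℝ z.2) (0, ind ℝ {0}) :=
      analyticAt_lin (shift ℝ) analyticAt_snd
    have h2 := analyticAt_lin (shift ℝ) h1
    have h3 : AnalyticAt ℝ (fun z : (ℝ × ℝ) × (ℕ →ᵇ ℝ) => z.1.1) (0, ind ℝ {0}) := by fun_prop
    have h4 : AnalyticAt ℝ (fun z : (ℝ × ℝ) × (ℕ →ᵇ ℝ) => z.1.2) (0, ind ℝ {0}) := by fun_prop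
    exact ((analyticAt_snd.sub ((analyticAt_const.mul h4).smul h1)).add ((h3.pow 2).smul h2)).sub
      (analyticAt_const.add ((analyticAt_const.mul h4).smul analyticAt_const))
  obtain ⟨g, g1, -, g3, -⟩ := exists_analytic_implicit hfa hf0
    (ContinuousLinearEquiv.refl ℝ (ℕ →ᵇ ℝ)) (by
      have h : (fun t => f (0, t)) = fun t => t - ind ℝ {0} := by
        funext t
        simp [f]
      rw [h]
      exact (hasFDerivAt_id _).sub_const _)
  refine g1.congr ?_
  have hev1 : ∀ᶠ z : ℝ × ℝ in 𝓝 0, 3 * |z.1| < 1 := by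
    have : Continuous fun z : ℝ × ℝ => 3 * |z.1| := by fun_prop
    exact this.continuousAt.eventually (gt_mem_nhds (by simp))
  have hev2 : ∀ᶠ z : ℝ × ℝ in 𝓝 0, 3 * |z.2| < 1 := by
    have : Continuous fun z : ℝ × ℝ => 3 * |z.2| := by fun_prop
    exact this.continuousAt.eventually (gt_mem_nhds (by simp))
  filter_upwards [g3, hev1, hev2] with z hz hz1 hz2
  have key : ∀ n, g z n = chebSeq z.1 z.2 (a * z.2) n ∧
      g z (n + 1) = chebSeq z.1 z.2 (a * z.2) (n + 1) := by
    intro n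
    induction n with
    | zero =>
      have h0 := congrArg (fun f : ℕ →ᵇ ℝ => f 0) hz
      have h1 := congrArg (fun f : ℕ →ᵇ ℝ => f (0 + 1)) hz
      simp only [f, BoundedContinuousFunction.coe_add, BoundedContinuousFunction.coe_sub,
        Pi.add_apply, Pi.sub_apply, BoundedContinuousFunction.coe_smul, shift_succ, smul_eq_mul,
        shift_zero] at h0 h1
      simp [ind_apply] at h0 h1
      simp only [chebSeq, zero_add]
      have h2 : g z 0 = 1 := by linarith
      rw [h2] at h1
      constructor <;> linarith
    | succ n ih =>
      refine ⟨ih.2, ?_⟩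
      have h1 := congrArg (fun f : ℕ →ᵇ ℝ => f (n + 1 + 1)) hz
      simp only [f, BoundedContinuousFunction.coe_add, BoundedContinuousFunction.coe_sub,
        Pi.add_apply, Pi.sub_apply, BoundedContinuousFunction.coe_smul, shift_succ, smul_eq_mul] at h1
      simp [ind_apply, ih.1, ih.2] at h1
      rw [show n + 1 + 1 = n + 2 from rfl] at h1 ⊢
      rw [chebSeq]
      linarith
  ext n
  obtain ⟨s, q⟩ := z
  rw [(key n).1, cheb_apply ha hz1.le hz2.le]

/-- Homogenized Chebyshev polynomials of the second kind: `sⁿ sin((n + 1)ψ) / sin ψ` is a polynomial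
in `s` and `s cos ψ`. This allows the division by `sin ψ` without excluding its zeros. -/
theorem chebSeq_mul_sin (s ψ : ℝ) (n : ℕ) :
    chebSeq s (s * Real.cos ψ) (2 * (s * Real.cos ψ)) n * Real.sin ψ =
      s ^ n * Real.sin ((n + 1) * ψ) := by
  induction n using Nat.twoStepInduction with
  | zero => simp [chebSeq]
  | one =>
    simp only [chebSeq, Nat.cast_one, one_add_one_eq_two, Real.sin_two_mul]
    ring
  | more n ih1 ih2 =>
    rw [chebSeq, sub_mul, mul_assoc (2 * (s * Real.cos ψ)), ih2, mul_assoc (s ^ 2), ih1]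
    have e1 : ((n : ℝ) + 1) * ψ = (n + 2) * ψ - ψ := by ring
    have e2 : (((n + 2 : ℕ) : ℝ) + 1) * ψ = (n + 2) * ψ + ψ := by push_cast; ring
    have e3 : (((n + 1 : ℕ) : ℝ) + 1) * ψ = (n + 2) * ψ := by push_cast; ring
    rw [e1, e2, e3, Real.sin_sub, Real.sin_add]
    ring

theorem chebSeq_eq_cos (s ψ : ℝ) (n : ℕ) :
    chebSeq s (s * Real.cos ψ) (1 * (s * Real.cos ψ)) n = s ^ n * Real.cos (n * ψ) := by
  induction n using Nat.twoStepInduction with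
  | zero => simp [chebSeq]
  | one => simp [chebSeq]
  | more n ih1 ih2 =>
    rw [chebSeq, ih2, ih1]
    have e1 : (n : ℝ) * ψ = (n + 1) * ψ - ψ := by ring
    have e2 : ((n + 2 : ℕ) : ℝ) * ψ = (n + 1) * ψ + ψ := by push_cast; ring
    have e3 : ((n + 1 : ℕ) : ℝ) * ψ = (n + 1) * ψ := by push_cast; ring
    rw [e1, e2, e3, Real.cos_sub, Real.cos_add]
    ring

/-! ## The formal solution -/

/-- The wave number `k₁ (α₁ - β₁) + k₂ (α₂ - β₂)`. -/
def mode (k₁ k₂ : ℕ) (m : Idx) : ℤ :=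
  k₁ * ((m.1.1 : ℤ) - m.2.1) + k₂ * ((m.1.2 : ℤ) - m.2.2)

theorem mode_add (k₁ k₂ : ℕ) (p q : Idx) : mode k₁ k₂ (p + q) = mode k₁ k₂ p + mode k₁ k₂ q := by
  simp only [mode, Prod.fst_add, Prod.snd_add]
  push_cast
  ring

theorem mode_swap (k₁ k₂ : ℕ) (m : Idx) : mode k₁ k₂ m.swap = -mode k₁ k₂ m := by
  simp only [mode, Prod.fst_swap, Prod.snd_swap]
  ring

theorem order_add (p q : Idx) : order (p + q) = order p + order q := by
  simp only [order, Prod.fst_add, Prod.snd_add]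
  ring

theorem order_swap (m : Idx) : order m.swap = order m := by
  simp only [order, Prod.fst_swap, Prod.snd_swap]
  ring

theorem order_eq_zero {m : Idx} : order m = 0 ↔ m = 0 := by
  obtain ⟨⟨a, b⟩, ⟨c, d⟩⟩ := m
  simp only [order, Prod.mk_eq_zero]
  omega

theorem order_pos {m : Idx} (h : m ≠ 0) : 0 < order m :=
  Nat.pos_of_ne_zero fun h0 => h (order_eq_zero.1 h0)

theorem splits_eq_empty {m : Idx} (h : order m ≤ 1) : splits m = ∅ := by
  refine Finset.eq_empty_of_forall_notMem fun p hp => ?_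
  obtain ⟨h1, h2, h3⟩ := mem_splits.1 hp
  have h4 := order_add p.1 p.2
  have := order_pos h2
  have := order_pos h3
  rw [h1] at h4
  omega

theorem finite_order_le (n : ℕ) : {m : Idx | order m ≤ n}.Finite := by
  refine (Set.finite_Iic (((n, n), (n, n)) : Idx)).subset ?_
  rintro ⟨⟨a, b⟩, ⟨c, d⟩⟩ h
  simp only [order, mem_ofPred_eq, mem_Iic, Prod.mk_le_mk] at h ⊢
  omega

theorem uHat_of_order_ne_one (k₁ k₂ : ℕ) (l : ℤ → ℝ) {m : Idx} (h : order m ≠ 1) :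
    uHat k₁ k₂ l m = l (mode k₁ k₂ m) * uSqHat k₁ k₂ l m := by
  rw [uHat, if_neg h, uSqHat, ← Finset.sum_attach (splits m)]
  rfl

theorem uHat_of_order_eq_one (k₁ k₂ : ℕ) (l : ℤ → ℝ) {m : Idx} (h : order m = 1) :
    uHat k₁ k₂ l m = 1 / 2 := by
  rw [uHat, if_pos h]

theorem uHat_zero (k₁ k₂ : ℕ) (l : ℤ → ℝ) : uHat k₁ k₂ l 0 = 0 := by
  rw [uHat_of_order_ne_one _ _ _ (by simp [order]), uSqHat, splits_eq_empty (by simp [order])]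
  simp

theorem swap_mem_splits {m : Idx} {p : Idx × Idx} (h : p ∈ splits m) :
    (p.1.swap, p.2.swap) ∈ splits m.swap := by
  obtain ⟨h1, h2, h3⟩ := mem_splits.1 h
  refine mem_splits.2 ⟨?_, ?_, ?_⟩
  · rw [← h1]
    rfl
  · intro h0
    exact h2 (Prod.swap_injective h0)
  · intro h0
    exact h3 (Prod.swap_injective h0)

/-- Exchanging `α` and `β` reverses the wave number, which an even `ℓ` does not see. The symmetry
makes the wave real and moves the index in the definition of `phi`, of mode `-k₁`, to `critIdx`, of
mode `k₁`. -/
theorem uHat_swap (k₁ k₂ : ℕ) {l : ℤ → ℝ} (hl : ∀ n, l (-n) = l n) (m : Idx) :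
    uHat k₁ k₂ l m.swap = uHat k₁ k₂ l m := by
  induction hn : order m using Nat.strong_induction_on generalizing m with
  | _ n ih =>
    by_cases h1 : order m = 1
    · rw [uHat_of_order_eq_one _ _ _ h1, uHat_of_order_eq_one _ _ _ (by rw [order_swap, h1])]
    · rw [uHat_of_order_ne_one _ _ _ h1, uHat_of_order_ne_one _ _ _ (by rwa [order_swap]),
        mode_swap, hl, uSqHat, uSqHat]
      congr 1
      refine Finset.sum_bij' (fun p _ => (p.1.swap, p.2.swap)) (fun p _ => (p.1.swap, p.2.swap))
        (fun p hp => by simpa using swap_mem_splits hp) (fun p hp => swap_mem_splits hp)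
        (fun p _ => by simp) (fun p _ => by simp) (fun p hp => ?_)
      have h2 := order_lt_of_mem_splits hp
      rw [order_swap, hn] at h2
      rw [ih _ h2.1 p.1 rfl, ih _ h2.2 p.2 rfl]

theorem uSqHat_swap (k₁ k₂ : ℕ) {l : ℤ → ℝ} (hl : ∀ n, l (-n) = l n) (m : Idx) :
    uSqHat k₁ k₂ l m.swap = uSqHat k₁ k₂ l m := by
  rw [uSqHat, uSqHat]
  refine Finset.sum_bij' (fun p _ => (p.1.swap, p.2.swap)) (fun p _ => (p.1.swap, p.2.swap))
    (fun p hp => by simpa using swap_mem_splits hp) (fun p hp => swap_mem_splits hp)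
    (fun p _ => by simp) (fun p _ => by simp) (fun p hp => ?_)
  rw [uHat_swap _ _ hl, uHat_swap _ _ hl]

open Classical in
/-- The linear part of the formal solution. -/
def unitSum : L1 Idx ℝ :=
  L1.mk (fun m => if order m = 1 then 1 / 2 else 0) (by
    refine summable_of_hasFiniteSupport ((finite_order_le 1).subset fun m hm => ?_)
    by_contra h
    exact hm (by simp [show order m ≠ 1 from fun h1 => h h1.le]))

theorem unitSum_apply (m : Idx) : unitSum m = if order m = 1 then 1 / 2 else 0 := by
  simp [unitSum]

/-- The equation satisfied by the formal solution with weights `τ ^ |m|`. -/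
def seriesEq (k₁ k₂ : ℕ) (z : (ℝ × (ℤ →ᵇ ℝ)) × L1 Idx ℝ) : L1 Idx ℝ :=
  z.2 - z.1.1 • unitSum - mulL Idx ℝ (conv z.2 z.2) (pull ℝ (mode k₁ k₂) z.1.2)

/-- The order is additive along splittings, so the factors `τ ^ order` pass through the recursion,
and both sides agree by induction on the order. -/
theorem eq_uHat_of_seriesEq {k₁ k₂ : ℕ} {τ : ℝ} {l : ℤ →ᵇ ℝ} {U : L1 Idx ℝ}
    (h : seriesEq k₁ k₂ ((τ, l), U) = 0) (m : Idx) :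
    U m = uHat k₁ k₂ l m * τ ^ order m := by
  have h1 : ∀ m, U m = τ * (if order m = 1 then 1 / 2 else 0) +
      (∑ p ∈ splits m, U p.1 * U p.2) * l (mode k₁ k₂ m) := by
    intro m
    have h2 : U - τ • unitSum - mulL Idx ℝ (conv U U) (pull ℝ (mode k₁ k₂) l) = 0 := h
    have h3 := congrArg (fun a : L1 Idx ℝ => a m) h2
    simp only [lp.coeFn_sub, Pi.sub_apply, lp.coeFn_smul, Pi.smul_apply, unitSum_apply, mulL_apply,
      conv_apply, pull_apply, smul_eq_mul, lp.coeFn_zero, Pi.zero_apply] at h3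
    linarith
  induction hn : order m using Nat.strong_induction_on generalizing m with
  | _ n ih =>
    rw [h1, ← hn]
    by_cases h2 : order m = 1
    · rw [if_pos h2, splits_eq_empty h2.le, uHat_of_order_eq_one _ _ _ h2, h2]
      simp [mul_comm]
    · rw [if_neg h2, uHat_of_order_ne_one _ _ _ h2, mul_zero, zero_add, uSqHat, mul_assoc,
        mul_comm _ (l _), Finset.sum_mul]
      congr 1
      refine Finset.sum_congr rfl fun p hp => ?_
      have h3 := order_lt_of_mem_splits hp
      rw [hn] at h3
      rw [ih _ h3.1 p.1 rfl, ih _ h3.2 p.2 rfl, ← (mem_splits.1 hp).1, order_add]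
      ring

theorem analyticAt_seriesEq (k₁ k₂ : ℕ) (z : (ℝ × (ℤ →ᵇ ℝ)) × L1 Idx ℝ) :
    AnalyticAt ℝ (seriesEq k₁ k₂) z := by
  have h1 : AnalyticAt ℝ (fun z : (ℝ × (ℤ →ᵇ ℝ)) × L1 Idx ℝ => z.1.1) z := by fun_prop
  have h2 : AnalyticAt ℝ (fun z : (ℝ × (ℤ →ᵇ ℝ)) × L1 Idx ℝ => z.1.2) z := by fun_prop
  exact (analyticAt_snd.sub (h1.smul analyticAt_const)).sub
    (analyticAt_bilin (mulL Idx ℝ) (analyticAt_bilin conv analyticAt_snd analyticAt_snd)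
      (analyticAt_lin (pull ℝ (mode k₁ k₂)) h2))

/-- The nonlinear term is quadratic in `U`, so its derivative at `U = 0` vanishes whatever `l` is.
-/
theorem hasFDerivAt_seriesEq (k₁ k₂ : ℕ) (l : ℤ →ᵇ ℝ) :
    HasFDerivAt (fun U => seriesEq k₁ k₂ ((0, l), U))
      ((ContinuousLinearEquiv.refl ℝ (L1 Idx ℝ) : L1 Idx ℝ →L[ℝ] L1 Idx ℝ)) 0 := by
  have h1 := conv.hasFDerivAt_of_bilinear (hasFDerivAt_id (𝕜 := ℝ) (0 : L1 Idx ℝ))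
    (hasFDerivAt_id (𝕜 := ℝ) (0 : L1 Idx ℝ))
  have h2 := ((mulL Idx ℝ).flip (pull ℝ (mode k₁ k₂) l)).hasFDerivAt.comp 0 h1
  have h3 := (hasFDerivAt_id (𝕜 := ℝ) (0 : L1 Idx ℝ)).sub h2
  have e1 : (fun U => seriesEq k₁ k₂ ((0, l), U)) = id -
      ⇑((mulL Idx ℝ).flip (pull ℝ (mode k₁ k₂) l)) ∘ fun y => conv (id y) (id y) := by
    funext U
    simp [seriesEq]
  have e2 : (ContinuousLinearEquiv.refl ℝ (L1 Idx ℝ) : L1 Idx ℝ →L[ℝ] L1 Idx ℝ) =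
      ContinuousLinearMap.id ℝ (L1 Idx ℝ) := rfl
  rw [e1, e2]
  refine h3.congr_fderiv (ContinuousLinearMap.ext fun U => ?_)
  simp

/-- The formal solution converges, and depends analytically on the bounded symbol `l`. -/
theorem exists_series (k₁ k₂ : ℕ) (l₀ : ℤ →ᵇ ℝ) :
    ∃ τ : ℝ, 0 < τ ∧ ∃ U : (ℤ →ᵇ ℝ) → L1 Idx ℝ, AnalyticAt ℝ U l₀ ∧
      ∀ᶠ l in 𝓝 l₀, ∀ m, U l m = uHat k₁ k₂ l m * τ ^ order m := by
  obtain ⟨g, g1, -, g3, -⟩ := exists_analytic_implicit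
    (analyticAt_seriesEq k₁ k₂ ((0, l₀), 0)) (by simp [seriesEq]) _ (hasFDerivAt_seriesEq k₁ k₂ l₀)
  have h1 : ∀ᶠ z in 𝓝 ((0 : ℝ), l₀), AnalyticAt ℝ g z ∧
      ∀ᶠ w in 𝓝 z, seriesEq k₁ k₂ (w, g w) = 0 :=
    g1.eventually_analyticAt.and g3.eventually_nhds
  have h2 : Tendsto (fun t : ℝ => (t, l₀)) (𝓝[>] 0) (𝓝 ((0 : ℝ), l₀)) :=
    (Continuous.tendsto (by fun_prop) 0).mono_left nhdsWithin_le_nhds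
  -- The implicit function lives near `τ = 0`; one positive `τ` in its domain is fixed, and from
  -- then on only `l` varies.
  obtain ⟨τ, ⟨h3, h4⟩, hτ⟩ := ((h2.eventually h1).and self_mem_nhdsWithin).exists
  refine ⟨τ, hτ, fun l => g (τ, l), ?_, ?_⟩
  · exact AnalyticAt.fun_comp (f := fun l : ℤ →ᵇ ℝ => (τ, l)) h3 (analyticAt_const.prod analyticAt_id)
  · have h5 : Tendsto (fun l : ℤ →ᵇ ℝ => (τ, l)) (𝓝 l₀) (𝓝 (τ, l₀)) :=
      Continuous.tendsto (by fun_prop) l₀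
    filter_upwards [h5.eventually h4] with l hl m
    exact eq_uHat_of_seriesEq hl m

theorem conv_eq_uSqHat {k₁ k₂ : ℕ} {l : ℤ → ℝ} {τ : ℝ} {U : L1 Idx ℝ}
    (h : ∀ m, U m = uHat k₁ k₂ l m * τ ^ order m) (m : Idx) :
    conv U U m = uSqHat k₁ k₂ l m * τ ^ order m := by
  rw [conv_apply, uSqHat, Finset.sum_mul]
  refine Finset.sum_congr rfl fun p hp => ?_
  rw [h, h, ← (mem_splits.1 hp).1, order_add]
  ring

/-! ## The dispersion relation -/

theorem pos_of_deriv_pos {F F' : ℝ → ℝ} (h0 : F 0 = 0) (hd : ∀ x, HasDerivAt F (F' x) x)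
    (hp : ∀ x, 0 < x → 0 < F' x) {z : ℝ} (hz : 0 < z) : 0 < F z := by
  have h : StrictMonoOn F (Ici 0) :=
    strictMonoOn_of_deriv_pos (convex_Ici 0) (fun x _ => (hd x).continuousAt.continuousWithinAt)
      fun x hx => by
        rw [interior_Ici] at hx
        rw [(hd x).deriv]
        exact hp x hx
  have := h (mem_Ici.2 le_rfl) (mem_Ici.2 hz.le) hz
  rwa [h0] at this

theorem sinh_lt_mul_cosh {z : ℝ} (hz : 0 < z) : Real.sinh z < z * Real.cosh z := by
  have h := pos_of_deriv_pos (F := fun z => z * Real.cosh z - Real.sinh z)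
    (F' := fun z => (1 * Real.cosh z + z * Real.sinh z) - Real.cosh z) (by simp)
    (fun x => ((hasDerivAt_id x).mul (Real.hasDerivAt_cosh x)).sub (Real.hasDerivAt_sinh x))
    (fun x hx => by
      have : 0 < x * Real.sinh x := mul_pos hx (Real.sinh_pos_iff.2 hx)
      linarith) hz
  simpa using h

theorem cube_lt_sinh {z : ℝ} (hz : 0 < z) : z + z ^ 3 / 6 < Real.sinh z := by
  have h := pos_of_deriv_pos (F := fun z => Real.sinh z - (z + z ^ 3 / 6))
    (F' := fun z => Real.cosh z - (1 + 3 * z ^ 2 / 6)) (by simp)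
    (fun x => (Real.hasDerivAt_sinh x).sub ((hasDerivAt_id x).add
      (by simpa using (hasDerivAt_pow 3 x).div_const 6)))
    (fun x hx => by
      have h1 : Real.cosh x = 1 + 2 * Real.sinh (x / 2) ^ 2 := by
        have h2 := Real.cosh_two_mul (x / 2)
        have h3 := Real.cosh_sq (x / 2)
        rw [mul_div_cancel₀ x (two_ne_zero)] at h2
        linarith
      have h4 : x / 2 < Real.sinh (x / 2) := Real.self_lt_sinh_iff.2 (by positivity)
      have h5 : (x / 2) ^ 2 < Real.sinh (x / 2) ^ 2 := by gcongr
      rw [h1]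
      linarith) hz
  linarith

theorem mul_cosh_lt_sinh {z : ℝ} (hz : 0 < z) : (z - z ^ 3 / 3) * Real.cosh z < Real.sinh z := by
  have h := pos_of_deriv_pos (F := fun z => Real.sinh z - (z - z ^ 3 / 3) * Real.cosh z)
    (F' := fun z => Real.cosh z - ((1 - 3 * z ^ 2 / 3) * Real.cosh z +
      (z - z ^ 3 / 3) * Real.sinh z)) (by simp)
    (fun x => (Real.hasDerivAt_sinh x).sub (((hasDerivAt_id x).sub
      (by simpa using (hasDerivAt_pow 3 x).div_const 3)).mul (Real.hasDerivAt_cosh x)))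
    (fun x hx => by
      have h1 := sinh_lt_mul_cosh hx
      have h2 : 0 < Real.sinh x := Real.sinh_pos_iff.2 hx
      have h3 : 0 < x * (x * Real.cosh x - Real.sinh x) := mul_pos hx (by linarith)
      have h4 : 0 < x ^ 3 * Real.sinh x := by positivity
      nlinarith) hz
  linarith

/-- Multiply the square of `z + z³/6 < sinh z` by `cosh² z`, multiply `(z - z³/3) cosh z < sinh z`
by `z cosh z`, and add. The terms `± z⁴ cosh² z / 3` cancel. -/
theorem two_mul_sq_lt {z : ℝ} (hz : 0 < z) : 2 * z ^ 2 * Real.cosh z ^ 2 <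
    z * (Real.sinh z * Real.cosh z) + (Real.sinh z * Real.cosh z) ^ 2 := by
  have h1 := cube_lt_sinh hz
  have h2 := mul_cosh_lt_sinh hz
  have h3 : 0 < Real.cosh z := Real.cosh_pos z
  have h4 : z ^ 2 + z ^ 4 / 3 < Real.sinh z ^ 2 := by
    have h5 : (z + z ^ 3 / 6) ^ 2 < Real.sinh z ^ 2 := by gcongr
    have h6 : 0 < z ^ 6 := by positivity
    nlinarith
  have h5 : z * Real.cosh z * ((z - z ^ 3 / 3) * Real.cosh z) <
      z * Real.cosh z * Real.sinh z := by gcongr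
  have h6 : (z ^ 2 + z ^ 4 / 3) * Real.cosh z ^ 2 < Real.sinh z ^ 2 * Real.cosh z ^ 2 := by gcongr
  nlinarith

/-! ### Monotonicity of the symbol and uniqueness of the crossing. -/

/-- The square of the dispersion symbol. -/
def dispSq (T ξ : ℝ) : ℝ := (1 + T * ξ ^ 2) * Real.tanh ξ / ξ

/-- The value of `T` for which `ξ` is a critical point of the symbol. -/
def critT (ξ : ℝ) : ℝ :=
  (Real.sinh ξ * Real.cosh ξ - ξ) / (ξ ^ 2 * (Real.sinh ξ * Real.cosh ξ + ξ))

/-- After `sinh² = cosh² - 1`, the numerator of the derivative is `2ξ` times the difference of the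
two sides of `two_mul_sq_lt`. -/
theorem critT_strictAntiOn : StrictAntiOn critT (Ioi 0) := by
  have hD : ∀ ξ : ℝ, 0 < ξ → 0 < ξ ^ 2 * (Real.sinh ξ * Real.cosh ξ + ξ) := fun ξ hξ => by
    have := Real.sinh_pos_iff.2 hξ
    have := Real.cosh_pos ξ
    positivity
  have hd : ∀ ξ : ℝ, 0 < ξ → HasDerivAt critT
      ((((Real.cosh ξ * Real.cosh ξ + Real.sinh ξ * Real.sinh ξ) - 1) *
        (ξ ^ 2 * (Real.sinh ξ * Real.cosh ξ + ξ)) - (Real.sinh ξ * Real.cosh ξ - ξ) *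
        (2 * ξ * (Real.sinh ξ * Real.cosh ξ + ξ) + ξ ^ 2 *
          ((Real.cosh ξ * Real.cosh ξ + Real.sinh ξ * Real.sinh ξ) + 1))) /
        (ξ ^ 2 * (Real.sinh ξ * Real.cosh ξ + ξ)) ^ 2) ξ := fun ξ hξ => by
    have h1 := (Real.hasDerivAt_sinh ξ).mul (Real.hasDerivAt_cosh ξ)
    have h2 : HasDerivAt (fun ξ : ℝ => ξ ^ 2) (2 * ξ) ξ := by simpa using hasDerivAt_pow 2 ξ
    exact (h1.sub (hasDerivAt_id ξ)).div (h2.mul (h1.add (hasDerivAt_id ξ))) (hD ξ hξ).ne'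
  refine strictAntiOn_of_deriv_neg (convex_Ioi 0)
    (fun ξ hξ => (hd ξ hξ).continuousAt.continuousWithinAt) fun ξ hξ => ?_
  rw [interior_Ioi] at hξ
  rw [(hd ξ hξ).deriv]
  refine div_neg_of_neg_of_pos ?_ (pow_pos (hD ξ hξ) 2)
  have h1 := two_mul_sq_lt hξ
  have h2 := Real.cosh_sq ξ
  have h3 : 0 < ξ := hξ
  have e : ((Real.cosh ξ * Real.cosh ξ + Real.sinh ξ * Real.sinh ξ) - 1) *
        (ξ ^ 2 * (Real.sinh ξ * Real.cosh ξ + ξ)) - (Real.sinh ξ * Real.cosh ξ - ξ) *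
        (2 * ξ * (Real.sinh ξ * Real.cosh ξ + ξ) + ξ ^ 2 *
          ((Real.cosh ξ * Real.cosh ξ + Real.sinh ξ * Real.sinh ξ) + 1)) =
      2 * ξ * (2 * ξ ^ 2 * Real.cosh ξ ^ 2 - (ξ * (Real.sinh ξ * Real.cosh ξ) +
        (Real.sinh ξ * Real.cosh ξ) ^ 2)) := by
    have h4 : Real.sinh ξ * Real.sinh ξ = Real.cosh ξ ^ 2 - 1 := by linarith
    rw [h4]
    ring
  rw [e]
  exact mul_neg_of_pos_of_neg (by positivity) (by linarith)

/-- The difference of the two sides and its first three derivatives vanish at `0`, and the fourth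
derivative, `8x cosh x + x² sinh x`, is positive. The facts `h3`, `h2`, `h1`, `h0` integrate this
back one order at a time. -/
theorem sinh_sub_lt {y : ℝ} (hy : 0 < y) :
    12 * (Real.sinh y - y) < y ^ 2 * (Real.sinh y + y) := by
  have d2 : ∀ x : ℝ, HasDerivAt (fun x : ℝ => x ^ 2) (2 * x) x := fun x => by
    simpa using hasDerivAt_pow 2 x
  have s := Real.hasDerivAt_sinh
  have c := Real.hasDerivAt_cosh
  have h3 : ∀ x : ℝ, 0 < x → 0 < x ^ 2 * Real.cosh x + 6 * (x * Real.sinh x) + 6 -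
      6 * Real.cosh x := fun x hx =>
    pos_of_deriv_pos (F := fun x => x ^ 2 * Real.cosh x + 6 * (x * Real.sinh x) + 6 -
      6 * Real.cosh x) (F' := fun x => (2 * x * Real.cosh x + x ^ 2 * Real.sinh x) +
        6 * (1 * Real.sinh x + x * Real.cosh x) - 6 * Real.sinh x) (by simp)
      (fun x => ((((d2 x).mul (c x)).add (((hasDerivAt_id x).mul (s x)).const_mul 6)).add_const
        6).sub ((c x).const_mul 6)) (fun x hx => by
          have := Real.sinh_pos_iff.2 hx
          have := Real.cosh_pos x
          have h5 : 0 < x * Real.cosh x := by positivity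
          have h6 : 0 < x ^ 2 * Real.sinh x := by positivity
          nlinarith) hx
  have h2 : ∀ x : ℝ, 0 < x → 0 < x ^ 2 * Real.sinh x + 4 * (x * Real.cosh x) + 6 * x -
      10 * Real.sinh x := fun x hx =>
    pos_of_deriv_pos (F := fun x => x ^ 2 * Real.sinh x + 4 * (x * Real.cosh x) + 6 * x -
      10 * Real.sinh x) (F' := fun x => (2 * x * Real.sinh x + x ^ 2 * Real.cosh x) +
        4 * (1 * Real.cosh x + x * Real.sinh x) + 6 * 1 - 10 * Real.cosh x) (by simp)
      (fun x => ((((d2 x).mul (s x)).add (((hasDerivAt_id x).mul (c x)).const_mul 4)).add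
        ((hasDerivAt_id x).const_mul 6)).sub ((s x).const_mul 10)) (fun x hx => by
          have := h3 x hx
          linarith) hx
  have h1 : ∀ x : ℝ, 0 < x → 0 < 2 * (x * Real.sinh x) + x ^ 2 * Real.cosh x + 3 * x ^ 2 -
      12 * Real.cosh x + 12 := fun x hx =>
    pos_of_deriv_pos (F := fun x => 2 * (x * Real.sinh x) + x ^ 2 * Real.cosh x + 3 * x ^ 2 -
      12 * Real.cosh x + 12) (F' := fun x => 2 * (1 * Real.sinh x + x * Real.cosh x) +
        (2 * x * Real.cosh x + x ^ 2 * Real.sinh x) + 3 * (2 * x) - 12 * Real.sinh x) (by simp)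
      (fun x => ((((((hasDerivAt_id x).mul (s x)).const_mul 2).add ((d2 x).mul (c x))).add
        ((d2 x).const_mul 3)).sub ((c x).const_mul 12)).add_const 12) (fun x hx => by
          have := h2 x hx
          linarith) hx
  have h0 := pos_of_deriv_pos (F := fun x => x ^ 2 * (Real.sinh x + x) - 12 * (Real.sinh x - x))
    (F' := fun x => 2 * x * (Real.sinh x + x) + x ^ 2 * (Real.cosh x + 1) -
      12 * (Real.cosh x - 1)) (by simp)
    (fun x => ((d2 x).mul ((s x).add (hasDerivAt_id x))).sub
      (((s x).sub (hasDerivAt_id x)).const_mul 12)) (fun x hx => by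
        have := h1 x hx
        nlinarith) hy
  linarith

/-- The value `1/3` is the limit of `critT` at `0`. In terms of `y = 2ξ` the claim is `sinh_sub_lt`.
-/
theorem critT_lt {ξ : ℝ} (hξ : 0 < ξ) : critT ξ < 1 / 3 := by
  have := Real.sinh_pos_iff.2 hξ
  have := Real.cosh_pos ξ
  have h := sinh_sub_lt (mul_pos two_pos hξ)
  rw [Real.sinh_two_mul] at h
  rw [critT, div_lt_iff₀ (by positivity)]
  nlinarith

theorem hasDerivAt_tanh (ξ : ℝ) : HasDerivAt Real.tanh (1 / Real.cosh ξ ^ 2) ξ := by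
  have h2 := (Real.hasDerivAt_sinh ξ).div (Real.hasDerivAt_cosh ξ) (Real.cosh_pos ξ).ne'
  have e : Real.tanh = Real.sinh / Real.cosh := by
    funext x
    exact Real.tanh_eq_sinh_div_cosh x
  rw [e]
  refine h2.congr_deriv ?_
  congr 1
  have := Real.cosh_sq ξ
  linarith

/-- The derivative is written as a positive factor times `T - critT ξ`, so monotonicity of `critT`
settles its sign. -/
theorem hasDerivAt_dispSq (T : ℝ) {ξ : ℝ} (hξ : 0 < ξ) : HasDerivAt (dispSq T)
    ((Real.sinh ξ * Real.cosh ξ + ξ) / Real.cosh ξ ^ 2 * (T - critT ξ)) ξ := by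
  have hc := Real.cosh_pos ξ
  have hs := Real.sinh_pos_iff.2 hξ
  have h1 := hasDerivAt_tanh ξ
  have h2 : HasDerivAt (fun ξ : ℝ => 1 + T * ξ ^ 2) (T * (2 * ξ)) ξ := by
    simpa using ((hasDerivAt_pow 2 ξ).const_mul T).const_add 1
  have h3 := (h2.mul h1).div (hasDerivAt_id ξ) hξ.ne'
  refine h3.congr_deriv ?_
  have h4 : Real.sinh ξ * Real.cosh ξ + ξ ≠ 0 := by positivity
  simp only [id, critT, Real.tanh_eq_sinh_div_cosh, Pi.mul_apply]
  field_simp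
  ring

theorem dispSq_pos {T ξ : ℝ} (hT : 0 < T) (hξ : 0 < ξ) : 0 < dispSq T ξ := by
  have h : 0 < Real.tanh ξ := by
    rw [Real.tanh_eq_sinh_div_cosh]
    exact div_pos (Real.sinh_pos_iff.2 hξ) (Real.cosh_pos ξ)
  unfold dispSq
  positivity

theorem symbol_eq_sqrt (T : ℝ) {ξ : ℝ} (hξ : ξ ≠ 0) : symbol T ξ = √(dispSq T ξ) := by
  rw [symbol, if_neg hξ, dispSq]

theorem symbol_sq {T ξ : ℝ} (hT : 0 < T) (hξ : 0 < ξ) : symbol T ξ ^ 2 = dispSq T ξ := by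
  rw [symbol_eq_sqrt T hξ.ne', Real.sq_sqrt (dispSq_pos hT hξ).le]

theorem symbol_neg (T ξ : ℝ) : symbol T (-ξ) = symbol T ξ := by
  simp only [symbol, neg_eq_zero, Real.tanh_neg]
  split_ifs
  · rfl
  · congr 1
    rw [neg_sq, mul_neg, neg_div_neg_eq]

theorem exists_critical {T a b : ℝ} (ha : 0 < a) (hab : a < b) (h : dispSq T a = dispSq T b) :
    ∃ ξ, a < ξ ∧ ξ < b ∧ T = critT ξ := by
  obtain ⟨ξ, hξ, h1⟩ := exists_hasDerivAt_eq_zero hab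
    (fun x hx => (hasDerivAt_dispSq T (ha.trans_le hx.1)).continuousAt.continuousWithinAt) h
    (fun x hx => hasDerivAt_dispSq T (ha.trans hx.1))
  have h0 : 0 < ξ := ha.trans hξ.1
  have := Real.sinh_pos_iff.2 h0
  have := Real.cosh_pos ξ
  have h2 : (Real.sinh ξ * Real.cosh ξ + ξ) / Real.cosh ξ ^ 2 ≠ 0 := by positivity
  exact ⟨ξ, hξ.1, hξ.2, sub_eq_zero.1 ((mul_eq_zero.1 h1).resolve_left h2)⟩

theorem deriv_dispSq_neg {x ξ : ℝ} (hx : 0 < x) (h : x < ξ) :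
    (Real.sinh x * Real.cosh x + x) / Real.cosh x ^ 2 * (critT ξ - critT x) < 0 := by
  have := Real.sinh_pos_iff.2 hx
  have := Real.cosh_pos x
  exact mul_neg_of_pos_of_neg (by positivity)
    (sub_neg.2 (critT_strictAntiOn hx (hx.trans h) h))

theorem deriv_dispSq_pos {x ξ : ℝ} (hξ : 0 < ξ) (h : ξ < x) :
    0 < (Real.sinh x * Real.cosh x + x) / Real.cosh x ^ 2 * (critT ξ - critT x) := by
  have hx := hξ.trans h
  have := Real.sinh_pos_iff.2 hx
  have := Real.cosh_pos x
  exact mul_pos (by positivity) (sub_pos.2 (critT_strictAntiOn hξ hx h))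

theorem dispSq_strictAntiOn (ξ : ℝ) : StrictAntiOn (dispSq (critT ξ)) (Ioc 0 ξ) :=
  strictAntiOn_of_deriv_neg (convex_Ioc 0 ξ)
    (fun x hx => (hasDerivAt_dispSq _ hx.1).continuousAt.continuousWithinAt) fun x hx => by
      rw [interior_Ioc] at hx
      rw [(hasDerivAt_dispSq _ hx.1).deriv]
      exact deriv_dispSq_neg hx.1 hx.2

theorem dispSq_strictMonoOn {ξ : ℝ} (hξ : 0 < ξ) : StrictMonoOn (dispSq (critT ξ)) (Ici ξ) :=
  strictMonoOn_of_deriv_pos (convex_Ici ξ)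
    (fun x hx => (hasDerivAt_dispSq _ (hξ.trans_le hx)).continuousAt.continuousWithinAt)
    fun x hx => by
      rw [interior_Ici] at hx
      rw [(hasDerivAt_dispSq _ (hξ.trans hx)).deriv]
      exact deriv_dispSq_pos hξ hx

/-- For a given `T` both crossings straddle the same critical point. Increasing `κ` lowers the value
at the left end and raises it at the right end, so equality cannot hold twice. -/
theorem crossing_unique {T k₁ k₂ κ κ' : ℝ} (hk₁ : 0 < k₁) (hk : k₁ < k₂) (hκ : 0 < κ)
    (hκ' : κ < κ') (h : dispSq T (κ * k₁) = dispSq T (κ * k₂))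
    (h' : dispSq T (κ' * k₁) = dispSq T (κ' * k₂)) : False := by
  obtain ⟨ξ, h1, h2, rfl⟩ := exists_critical (by positivity) (by gcongr) h
  have hκ0 : 0 < κ' := hκ.trans hκ'
  obtain ⟨ξ', h3, h4, h5⟩ := exists_critical (by positivity) (by gcongr) h'
  have hξ : 0 < ξ := lt_trans (by positivity) h1
  have hξ' : 0 < ξ' := lt_trans (by positivity) h3
  obtain rfl : ξ = ξ' := critT_strictAntiOn.injOn hξ hξ' h5
  have e1 : κ * k₁ < κ' * k₁ := by gcongr
  have e2 : κ * k₂ < κ' * k₂ := by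
    have := hk₁.trans hk
    gcongr
  have a1 := dispSq_strictAntiOn ξ ⟨by positivity, h1.le⟩ ⟨by positivity, h3.le⟩ e1
  have a2 := dispSq_strictMonoOn hξ (mem_Ici.2 h2.le) (mem_Ici.2 h4.le) e2
  linarith

theorem tendsto_dispSq (T : ℝ) : Tendsto (dispSq T) (𝓝[>] 0) (𝓝 1) := by
  have h1 : HasDerivAt Real.tanh 1 0 := by simpa using hasDerivAt_tanh 0
  have h2 := (hasDerivAt_iff_tendsto_slope_zero.1 h1).mono_left
    (nhdsWithin_mono 0 (fun x (hx : x ∈ Ioi (0 : ℝ)) => ne_of_gt hx))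
  have h3 : Tendsto (fun x : ℝ => 1 + T * x ^ 2) (𝓝[>] 0) (𝓝 (1 + T * 0 ^ 2)) :=
    (Continuous.tendsto (by fun_prop) 0).mono_left nhdsWithin_le_nhds
  have h4 := h3.mul h2
  simp only [ne_eq, OfNat.ofNat_ne_zero, not_false_eq_true, zero_pow, mul_zero, add_zero, mul_one,
    zero_add, Real.tanh_zero, sub_zero, smul_eq_mul] at h4
  refine h4.congr fun x => ?_
  rw [dispSq]
  ring

/-- On `(0, ξ]` the function decreases from its limit `1` at `0`. The intermediate point `a / 2`
keeps the inequality strict in the limit. -/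
theorem dispSq_lt_one {ξ a : ℝ} (ha : 0 < a) (h : a ≤ ξ) : dispSq (critT ξ) a < 1 := by
  have h1 : dispSq (critT ξ) a < dispSq (critT ξ) (a / 2) :=
    dispSq_strictAntiOn ξ ⟨by positivity, by linarith⟩ ⟨ha, h⟩ (by linarith)
  refine h1.trans_le (ge_of_tendsto (tendsto_dispSq (critT ξ)) ?_)
  filter_upwards [Ioo_mem_nhdsGT (show (0 : ℝ) < a / 2 by positivity)] with x hx
  exact (dispSq_strictAntiOn ξ ⟨hx.1, by linarith [hx.2]⟩ ⟨by positivity, by linarith⟩ hx.2).le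

/-- The choice made by `Classical.epsilon` satisfies the crossing equations because some pair does,
and `crossing_unique` then identifies it with the given pair. -/
theorem bifPair_eq {k₁ k₂ : ℕ} (hk₁ : 0 < k₁) (hk : k₁ < k₂) {c κ T : ℝ} (hc : 0 < c)
    (hκ : 0 < κ) (hT : 0 < T) (h1 : symbol T (κ * k₁) = c) (h2 : symbol T (κ * k₂) = c) :
    bifPair k₁ k₂ T = (c, κ) := by
  have hk1 : (0 : ℝ) < k₁ := by exact_mod_cast hk₁
  have hk2 : (k₁ : ℝ) < k₂ := by exact_mod_cast hk
  have hk3 : (0 : ℝ) < k₂ := hk1.trans hk2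
  have hsp := Classical.epsilon_spec (p := fun p : ℝ × ℝ =>
    0 < p.1 ∧ 0 < p.2 ∧ symbol T (p.2 * k₁) = p.1 ∧ symbol T (p.2 * k₂) = p.1)
    ⟨(c, κ), hc, hκ, h1, h2⟩
  change 0 < (bifPair k₁ k₂ T).1 ∧ 0 < (bifPair k₁ k₂ T).2 ∧
    symbol T ((bifPair k₁ k₂ T).2 * k₁) = (bifPair k₁ k₂ T).1 ∧
    symbol T ((bifPair k₁ k₂ T).2 * k₂) = (bifPair k₁ k₂ T).1 at hsp
  obtain ⟨-, a2, a3, a4⟩ := hsp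
  have e1 : dispSq T (κ * k₁) = dispSq T (κ * k₂) := by
    rw [← symbol_sq hT (by positivity), ← symbol_sq hT (by positivity), h1, h2]
  have e2 : dispSq T ((bifPair k₁ k₂ T).2 * k₁) = dispSq T ((bifPair k₁ k₂ T).2 * k₂) := by
    rw [← symbol_sq hT (by positivity), ← symbol_sq hT (by positivity), a3, a4]
  have e3 : (bifPair k₁ k₂ T).2 = κ := by
    rcases lt_trichotomy (bifPair k₁ k₂ T).2 κ with h | h | h
    · exact (crossing_unique hk1 hk2 a2 h e2 e1).elim
    · exact h
    · exact (crossing_unique hk1 hk2 hκ h e1 e2).elim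
  refine Prod.ext ?_ e3
  rw [← a3, e3, h1]

theorem exists_critical_of_bif {k₁ k₂ : ℕ} (hk₁ : 0 < k₁) (hk : k₁ < k₂) {κ T : ℝ}
    (hκ : 0 < κ) (hT : 0 < T) (h : symbol T (κ * k₁) = symbol T (κ * k₂)) :
    ∃ ξ, κ * k₁ < ξ ∧ ξ < κ * k₂ ∧ T = critT ξ := by
  have hk1 : (0 : ℝ) < k₁ := by exact_mod_cast hk₁
  have hk2 : (k₁ : ℝ) < k₂ := by exact_mod_cast hk
  have hk3 : (0 : ℝ) < k₂ := hk1.trans hk2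
  refine exists_critical (by positivity) (by gcongr) ?_
  rw [← symbol_sq hT (by positivity), ← symbol_sq hT (by positivity), h]

/-- The second bound gives `c₀ ≠ 1 = m_T(0)`, so the constant mode is not resonant. -/
theorem bif_lt {k₁ k₂ : ℕ} (hk₁ : 0 < k₁) (hk : k₁ < k₂) {κ T : ℝ}
    (hκ : 0 < κ) (hT : 0 < T) (h : symbol T (κ * k₁) = symbol T (κ * k₂)) :
    T < 1 / 3 ∧ symbol T (κ * k₁) < 1 := by
  have hk1 : (0 : ℝ) < k₁ := by exact_mod_cast hk₁
  have h0 : 0 < κ * k₁ := by positivity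
  obtain ⟨ξ, h1, h2, rfl⟩ := exists_critical_of_bif hk₁ hk hκ hT h
  refine ⟨critT_lt (h0.trans h1), ?_⟩
  rw [symbol_eq_sqrt _ h0.ne', Real.sqrt_lt' one_pos, one_pow]
  exact dispSq_lt_one h0 h1.le

theorem hasDerivAt_symbol {T κ k : ℝ} (hT : 0 < T) (hκ : 0 < κ) (hk : 0 < k) :
    HasDerivAt (fun κ => symbol T (κ * k))
      ((Real.sinh (κ * k) * Real.cosh (κ * k) + κ * k) / Real.cosh (κ * k) ^ 2 *
        (T - critT (κ * k)) * k / (2 * √(dispSq T (κ * k)))) κ := by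
  have h0 : 0 < κ * k := by positivity
  have h1 : HasDerivAt (fun κ : ℝ => κ * k) k κ := by simpa using (hasDerivAt_id κ).mul_const k
  have h2 := (hasDerivAt_dispSq T h0).comp κ h1
  have h3 := h2.sqrt (dispSq_pos hT h0).ne'
  refine h3.congr_of_eventuallyEq ?_
  filter_upwards [lt_mem_nhds hκ] with x hx
  rw [symbol_eq_sqrt _ (mul_pos hx hk).ne']
  rfl

/-- Transversality of the crossing: the slope is negative at `κk₁` and positive at `κk₂`, since the
critical point lies strictly between them. -/
theorem exists_hasDerivAt_symbol_sub {k₁ k₂ : ℕ} (hk₁ : 0 < k₁) (hk : k₁ < k₂) {κ T : ℝ}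
    (hκ : 0 < κ) (hT : 0 < T) (h : symbol T (κ * k₁) = symbol T (κ * k₂)) :
    ∃ d, d ≠ 0 ∧ HasDerivAt (fun κ => symbol T (κ * k₁) - symbol T (κ * k₂)) d κ := by
  have hk1 : (0 : ℝ) < k₁ := by exact_mod_cast hk₁
  have hk2 : (k₁ : ℝ) < k₂ := by exact_mod_cast hk
  have hk3 : (0 : ℝ) < k₂ := hk1.trans hk2
  have h0 : 0 < κ * k₁ := by positivity
  have h0' : 0 < κ * k₂ := by positivity
  obtain ⟨ξ, h1, h2, rfl⟩ := exists_critical_of_bif hk₁ hk hκ hT h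
  refine ⟨_, ?_, (hasDerivAt_symbol hT hκ hk1).sub (hasDerivAt_symbol hT hκ hk3)⟩
  have e1 := deriv_dispSq_neg h0 h1
  have e2 := deriv_dispSq_pos (h0.trans h1) h2
  have q1 := Real.sqrt_pos.2 (dispSq_pos hT h0)
  have q2 := Real.sqrt_pos.2 (dispSq_pos hT h0')
  refine ne_of_lt (sub_neg.2 (lt_trans (b := 0) ?_ ?_))
  · exact div_neg_of_neg_of_pos (mul_neg_of_neg_of_pos e1 hk1) (by positivity)
  · exact div_pos (mul_pos e2 hk3) (by positivity)

/-! ## Analytic dependence of the resolvent symbol on the parameters -/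

/-- The pointwise inverse of a bounded family that is bounded away from zero. -/
theorem exists_bdd_inv {w : ℕ →ᵇ ℝ} {d : ℝ} (hd : 0 < d) (h : ∀ i, d ≤ |w i|) :
    ∃ v : ℕ →ᵇ ℝ, (∀ i, v i = (w i)⁻¹) ∧ w * v = 1 := by
  refine ⟨bdd (fun i => (w i)⁻¹) d⁻¹ fun i => ?_, fun i => rfl, ?_⟩
  · rw [norm_inv, Real.norm_eq_abs]
    exact inv_anti₀ hd (h i)
  · ext i
    have : w i ≠ 0 := abs_pos.1 (hd.trans_le (h i))
    simp [this]

theorem mul_eq_one_apply {w v : ℕ →ᵇ ℝ} (h : w * v = 1) (i : ℕ) : v i = (w i)⁻¹ := by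
  have h1 := congrArg (fun f : ℕ →ᵇ ℝ => f i) h
  simp only [BoundedContinuousFunction.mul_apply, BoundedContinuousFunction.coe_one,
    Pi.one_apply] at h1
  exact eq_inv_of_mul_eq_one_right h1

theorem exists_mul_equiv {b v : ℕ →ᵇ ℝ} (h : b * v = 1) :
    ∃ e : (ℕ →ᵇ ℝ) ≃L[ℝ] (ℕ →ᵇ ℝ),
      (e : (ℕ →ᵇ ℝ) →L[ℝ] (ℕ →ᵇ ℝ)) = ContinuousLinearMap.mul ℝ (ℕ →ᵇ ℝ) b := by
  refine ⟨ContinuousLinearEquiv.equivOfInverse (ContinuousLinearMap.mul ℝ (ℕ →ᵇ ℝ) b)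
    (ContinuousLinearMap.mul ℝ (ℕ →ᵇ ℝ) v) (fun x => ?_) (fun x => ?_), rfl⟩
  · rw [ContinuousLinearMap.mul_apply', ContinuousLinearMap.mul_apply', ← mul_assoc, mul_comm v, h,
      one_mul]
  · rw [ContinuousLinearMap.mul_apply', ContinuousLinearMap.mul_apply', ← mul_assoc, h, one_mul]

theorem exists_analytic_inv {E : Type*} [NormedAddCommGroup E] [NormedSpace ℝ E]
    {w : E → ℕ →ᵇ ℝ} {y : E} (hw : AnalyticAt ℝ w y) {d : ℝ} (hd : 0 < d)
    (h : ∀ i, d ≤ |w y i|) :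
    ∃ v : E → ℕ →ᵇ ℝ, AnalyticAt ℝ v y ∧ ∀ᶠ z in 𝓝 y, ∀ i, w z i ≠ 0 ∧ v z i = (w z i)⁻¹ := by
  obtain ⟨v₀, -, hv0⟩ := exists_bdd_inv hd h
  obtain ⟨e, he⟩ := exists_mul_equiv hv0
  let B := ContinuousLinearMap.mul ℝ (ℕ →ᵇ ℝ)
  let f : (ℕ →ᵇ ℝ) × (ℕ →ᵇ ℝ) → ℕ →ᵇ ℝ := fun z => B z.1 z.2 - 1
  have hf : AnalyticAt ℝ f (w y, v₀) :=
    (analyticAt_bilin B analyticAt_fst analyticAt_snd).sub analyticAt_const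
  obtain ⟨g, g1, -, g3, -⟩ := exists_analytic_implicit hf
    (by simp only [f, B, ContinuousLinearMap.mul_apply', hv0, sub_self]) e (by
      rw [he]
      exact (B (w y)).hasFDerivAt.sub_const _)
  refine ⟨fun z => g (w z), AnalyticAt.fun_comp (f := w) g1 hw, ?_⟩
  filter_upwards [hw.continuousAt.eventually g3] with z hz i
  have h1 : w z * g (w z) = 1 := sub_eq_zero.1 hz
  refine ⟨fun h0 => ?_, mul_eq_one_apply h1 i⟩
  have h2 := congrArg (fun f : ℕ →ᵇ ℝ => f i) h1
  simp [h0] at h2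

/-- The linearization of `v² = w` at the positive root `b` is multiplication by `2b`, which is
invertible in `ℓ^∞` thanks to the uniform lower bound. -/
theorem exists_analytic_sqrt {E : Type*} [NormedAddCommGroup E] [NormedSpace ℝ E]
    {w : E → ℕ →ᵇ ℝ} {y : E} (hw : AnalyticAt ℝ w y) {d : ℝ} (hd : 0 < d)
    (h : ∀ i, d ≤ w y i) :
    ∃ v : E → ℕ →ᵇ ℝ, AnalyticAt ℝ v y ∧ ∀ᶠ z in 𝓝 y, ∀ i, v z i = √(w z i) := by
  let b : ℕ →ᵇ ℝ := bdd (fun i => √(w y i)) √‖w y‖ fun i => by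
    rw [Real.norm_eq_abs, abs_of_nonneg (Real.sqrt_nonneg _)]
    exact Real.sqrt_le_sqrt ((le_abs_self _).trans ((w y).norm_coe_le_norm i))
  have hd2 : 0 < √d := Real.sqrt_pos.2 hd
  have hb : ∀ i, √d ≤ b i := fun i => Real.sqrt_le_sqrt (h i)
  have hbb : b * b = w y := by
    ext i
    exact Real.mul_self_sqrt (hd.le.trans (h i))
  obtain ⟨v₀, -, hv0⟩ := exists_bdd_inv (w := b + b) hd2 fun i => by
    have h1 := hb i
    rw [BoundedContinuousFunction.coe_add, Pi.add_apply, abs_of_pos (by linarith)]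
    linarith
  obtain ⟨e, he⟩ := exists_mul_equiv hv0
  let B := ContinuousLinearMap.mul ℝ (ℕ →ᵇ ℝ)
  let f : (ℕ →ᵇ ℝ) × (ℕ →ᵇ ℝ) → ℕ →ᵇ ℝ := fun z => B z.2 z.2 - z.1
  have hf : AnalyticAt ℝ f (w y, b) :=
    (analyticAt_bilin B analyticAt_snd analyticAt_snd).sub analyticAt_fst
  obtain ⟨g, g1, g2, g3, -⟩ := exists_analytic_implicit hf
    (by simp only [f, B, ContinuousLinearMap.mul_apply', hbb, sub_self]) e (by
      rw [he]
      have h1 := B.hasFDerivAt_of_bilinear (hasFDerivAt_id (𝕜 := ℝ) b) (hasFDerivAt_id (𝕜 := ℝ) b)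
      refine (h1.sub_const (w y)).congr_fderiv (ContinuousLinearMap.ext fun U => ?_)
      simp [B, mul_comm])
  refine ⟨fun z => g (w z), AnalyticAt.fun_comp (f := w) g1 hw, ?_⟩
  -- Uniform closeness to the positive root `b ≥ √d` excludes the other sign of the square root in
  -- every component.
  have hc : ∀ᶠ z in 𝓝 y, ‖g (w z) - b‖ < √d := by
    have h1 : ContinuousAt (fun z => ‖g (w z) - b‖) y :=
      ((AnalyticAt.fun_comp (f := w) g1 hw).continuousAt.sub continuousAt_const).norm
    exact h1.eventually (gt_mem_nhds (by simpa [g2] using hd2))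
  filter_upwards [hw.continuousAt.eventually g3, hc] with z hz hz2 i
  have h1 : g (w z) * g (w z) = w z := sub_eq_zero.1 hz
  have h2 : |g (w z) i - b i| < √d := ((g (w z) - b).norm_coe_le_norm i).trans_lt hz2
  have h3 : 0 ≤ g (w z) i := by
    have := (abs_lt.1 h2).1
    linarith [hb i]
  have h4 : w z i = g (w z) i * g (w z) i := (congrArg (fun f : ℕ →ᵇ ℝ => f i) h1).symm
  exact ((Real.sqrt_eq_iff_mul_self_eq (h4 ▸ mul_self_nonneg _) h3).2 h4).symm

/-- In this form `tanh(κ(i + 1))` depends only on the geometric sequence `e^{-2κ(i + 1)}`, which is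
analytic in `κ` uniformly in `i`. -/
theorem tanh_eq_exp (y : ℝ) :
    Real.tanh y = (1 - Real.exp (-2 * y)) * (1 + Real.exp (-2 * y))⁻¹ := by
  have h1 : Real.exp (-2 * y) = Real.exp (-y) * Real.exp (-y) := by
    rw [← Real.exp_add]
    ring_nf
  have h2 : Real.exp y * Real.exp (-y) = 1 := by rw [← Real.exp_add]; simp
  rw [Real.tanh_eq, h1, ← div_eq_mul_inv, div_eq_div_iff (by positivity) (by positivity)]
  linear_combination (2 * Real.exp (-y)) * h2

/-- The family `tanh (κ (i + 1))` depends analytically on `κ`. -/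
theorem exists_analytic_tanh {κ₀ : ℝ} (hκ : 0 < κ₀) : ∃ t : ℝ → ℕ →ᵇ ℝ, AnalyticAt ℝ t κ₀ ∧
    ∀ᶠ κ in 𝓝 κ₀, ∀ i : ℕ, t κ i = Real.tanh (κ * (i + 1)) := by
  let x : ℝ → ℝ := fun κ => Real.exp (-2 * κ)
  have hx1 : ∀ κ, 0 < κ → x κ < 1 := fun κ hκ => by
    rw [← Real.exp_zero]
    exact Real.exp_lt_exp.2 (by linarith)
  have hx0 : ∀ κ, 0 < x κ := fun κ => Real.exp_pos _
  have hxn : ∀ κ, 0 < κ → ‖x κ‖ < 1 := fun κ hκ => by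
    rw [Real.norm_eq_abs, abs_of_pos (hx0 κ)]
    exact hx1 κ hκ
  have hxa : AnalyticAt ℝ x κ₀ := by fun_prop
  let e : ℝ → ℕ →ᵇ ℝ := fun κ => x κ • geo (x κ)
  have hea : AnalyticAt ℝ e κ₀ :=
    hxa.smul (AnalyticAt.fun_comp (f := x) (analyticAt_geo (hxn κ₀ hκ)) hxa)
  have hev : ∀ κ, 0 < κ → ∀ i, e κ i = Real.exp (-2 * (κ * (i + 1))) := fun κ hκ i => by
    have h1 : e κ i = x κ * x κ ^ i := by
      simp only [e, BoundedContinuousFunction.coe_smul, smul_eq_mul]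
      rw [geo_apply (hxn κ hκ).le]
    rw [h1, ← pow_succ', ← Real.exp_nat_mul]
    congr 1
    push_cast
    ring
  obtain ⟨v, v1, v2⟩ := exists_analytic_inv (w := fun κ => 1 + e κ) (analyticAt_const.add hea)
    one_pos fun i => by
      have h1 : (1 + e κ₀) i = 1 + e κ₀ i := rfl
      rw [h1, hev κ₀ hκ i, abs_of_pos (by positivity)]
      linarith [Real.exp_pos (-2 * (κ₀ * (i + 1)))]
  refine ⟨fun κ => (1 - e κ) * v κ, (analyticAt_const.sub hea).mul v1, ?_⟩
  filter_upwards [v2, lt_mem_nhds hκ] with κ h1 h2 i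
  rw [tanh_eq_exp, ← hev κ h2 i, BoundedContinuousFunction.mul_apply, (h1 i).2]
  rfl

theorem tanh_ge {κ : ℝ} (hκ : 0 < κ) (i : ℕ) : Real.tanh κ ≤ Real.tanh (κ * (i + 1)) := by
  have h : Monotone Real.tanh := monotone_of_deriv_nonneg
    (fun x => (hasDerivAt_tanh x).differentiableAt) fun x => by
      rw [(hasDerivAt_tanh x).deriv]
      positivity
  apply h
  have : (0 : ℝ) ≤ i := Nat.cast_nonneg i
  nlinarith

theorem tanh_pos {κ : ℝ} (hκ : 0 < κ) : 0 < Real.tanh κ := by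
  rw [Real.tanh_eq_sinh_div_cosh]
  exact div_pos (Real.sinh_pos_iff.2 hκ) (Real.cosh_pos κ)

/-- The family `(1 / (i + 1)²)`. -/
def invSq : ℕ →ᵇ ℝ := bdd (fun i => 1 / ((i : ℝ) + 1) ^ 2) 1 fun i => by
  have : (0 : ℝ) ≤ i := Nat.cast_nonneg i
  rw [Real.norm_eq_abs, abs_of_nonneg (by positivity), div_le_one (by positivity)]
  nlinarith

/-- The family `1 / √(i + 1)`. -/
def invSqrt : ℕ →ᵇ ℝ := bdd (fun i => 1 / √((i : ℝ) + 1)) 1 fun i => by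
  have : (0 : ℝ) ≤ i := Nat.cast_nonneg i
  rw [Real.norm_eq_abs, abs_of_nonneg (by positivity), div_le_one (by positivity)]
  exact Real.one_le_sqrt.2 (by linarith)

/-- The normalized symbol `√((1 / (i + 1)² + T κ²) tanh (κ (i + 1)) / κ)`. -/
def rootSeq (κ T : ℝ) (i : ℕ) : ℝ :=
  √((1 / ((i : ℝ) + 1) ^ 2 + T * κ ^ 2) * Real.tanh (κ * (i + 1)) * κ⁻¹)

/-- The symbol grows like the square root of the frequency. Dividing by `√(i + 1)` makes the family
bounded, and it stays bounded away from zero since `T₀ > 0`, so its root can be taken in `ℓ^∞`. -/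
theorem exists_analytic_root {κ₀ T₀ : ℝ} (hκ : 0 < κ₀) (hT : 0 < T₀) :
    ∃ v : ℝ × ℝ → ℕ →ᵇ ℝ, AnalyticAt ℝ v (κ₀, T₀) ∧
      ∀ᶠ z in 𝓝 (κ₀, T₀), ∀ i, v z i = rootSeq z.1 z.2 i := by
  obtain ⟨t, t1, t2⟩ := exists_analytic_tanh hκ
  let w : ℝ × ℝ → ℕ →ᵇ ℝ := fun z => z.1⁻¹ • ((invSq + (z.2 * z.1 ^ 2) • 1) * t z.1)
  have hf : AnalyticAt ℝ (fun z : ℝ × ℝ => z.1) (κ₀, T₀) := analyticAt_fst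
  have hs : AnalyticAt ℝ (fun z : ℝ × ℝ => z.2) (κ₀, T₀) := analyticAt_snd
  have ht : AnalyticAt ℝ (fun z : ℝ × ℝ => t z.1) (κ₀, T₀) :=
    AnalyticAt.fun_comp (f := fun z : ℝ × ℝ => z.1) t1 hf
  have hwa : AnalyticAt ℝ w (κ₀, T₀) :=
    (hf.inv hκ.ne').smul ((analyticAt_const.add ((hs.mul (hf.pow 2)).smul analyticAt_const)).mul ht)
  have hw : ∀ z : ℝ × ℝ, (∀ i : ℕ, t z.1 i = Real.tanh (z.1 * (i + 1))) → ∀ i : ℕ,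
      w z i = (1 / ((i : ℝ) + 1) ^ 2 + z.2 * z.1 ^ 2) * Real.tanh (z.1 * (i + 1)) * z.1⁻¹ := by
    intro z hz i
    simp only [w, BoundedContinuousFunction.coe_smul, BoundedContinuousFunction.mul_apply,
      BoundedContinuousFunction.coe_add, Pi.add_apply, BoundedContinuousFunction.coe_one,
      Pi.one_apply, smul_eq_mul, mul_one, hz, invSq, bdd_apply]
    ring
  have hd : 0 < T₀ * κ₀ ^ 2 * Real.tanh κ₀ * κ₀⁻¹ := by
    have := tanh_pos hκ
    positivity
  obtain ⟨v, v1, v2⟩ := exists_analytic_sqrt hwa hd fun i => by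
    rw [hw (κ₀, T₀) t2.self_of_nhds]
    have h1 := tanh_ge hκ i
    have h2 := tanh_pos hκ
    have h3 : 0 ≤ 1 / ((i : ℝ) + 1) ^ 2 := by positivity
    have h4 : T₀ * κ₀ ^ 2 * Real.tanh κ₀ ≤
        (1 / ((i : ℝ) + 1) ^ 2 + T₀ * κ₀ ^ 2) * Real.tanh (κ₀ * (i + 1)) := by
      gcongr
      linarith
    gcongr
  refine ⟨v, v1, ?_⟩
  filter_upwards [v2, hf.continuousAt.eventually t2] with z h1 h2 i
  rw [h1, hw z h2, rootSeq]

theorem symbol_eq_rootSeq {κ T : ℝ} (hκ : 0 < κ) (i : ℕ) :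
    symbol T (κ * (i + 1)) = √((i : ℝ) + 1) * rootSeq κ T i := by
  have h0 : (0 : ℝ) < i + 1 := by positivity
  rw [symbol_eq_sqrt T (by positivity), rootSeq, ← Real.sqrt_mul h0.le]
  congr 1
  rw [dispSq]
  field_simp

theorem analyticAt_symbol {κ₀ T₀ : ℝ} (hκ : 0 < κ₀) (hT : 0 < T₀) {k : ℕ} (hk : 0 < k) :
    AnalyticAt ℝ (fun z : ℝ × ℝ => symbol z.2 (z.1 * k)) (κ₀, T₀) := by
  obtain ⟨v, v1, v2⟩ := exists_analytic_root hκ hT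
  obtain ⟨i, rfl⟩ : ∃ i, k = i + 1 := ⟨k - 1, by omega⟩
  have h1 : AnalyticAt ℝ (fun z => √((i : ℝ) + 1) * v z i) (κ₀, T₀) :=
    analyticAt_const.mul (analyticAt_lin (BoundedContinuousFunction.evalCLM ℝ i) v1)
  refine h1.congr ?_
  have h2 : ∀ᶠ z : ℝ × ℝ in 𝓝 (κ₀, T₀), 0 < z.1 :=
    continuousAt_fst.eventually (lt_mem_nhds hκ)
  filter_upwards [v2, h2] with z h3 h4
  rw [h3]
  push_cast
  rw [symbol_eq_rootSeq h4]

theorem exists_le_abs_of_tendsto {s : ℕ → ℝ} {L : ℝ} (hL : L ≠ 0) (hs : Tendsto s atTop (𝓝 L))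
    (h : ∀ i, s i ≠ 0) : ∃ d, 0 < d ∧ ∀ i, d ≤ |s i| := by
  obtain ⟨B, hB⟩ := (hs.inv₀ hL).abs.bddAbove_range
  have h1 : ∀ i, |(s i)⁻¹| ≤ B := fun i => hB ⟨i, rfl⟩
  have h2 : 0 < B := (abs_pos.2 (inv_ne_zero (h 0))).trans_le (h1 0)
  refine ⟨B⁻¹, inv_pos.2 h2, fun i => ?_⟩
  rw [inv_le_comm₀ h2 (abs_pos.2 (h i)), ← abs_inv]
  exact h1 i

theorem tendsto_tanh_atTop : Tendsto Real.tanh atTop (𝓝 1) := by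
  have h0 : Tendsto (fun y : ℝ => Real.exp (-2 * y)) atTop (𝓝 0) :=
    Real.tendsto_exp_atBot.comp (tendsto_id.const_mul_atTop_of_neg (by norm_num))
  have h1 := (tendsto_const_nhds (x := (1 : ℝ)).sub h0).mul
    ((tendsto_const_nhds (x := (1 : ℝ)).add h0).inv₀ (by norm_num))
  simp only [sub_zero, add_zero, inv_one, mul_one] at h1
  exact h1.congr fun y => (tanh_eq_exp y).symm

theorem tendsto_rootSeq {κ T : ℝ} (hκ : 0 < κ) :
    Tendsto (rootSeq κ T) atTop (𝓝 √(T * κ ^ 2 * κ⁻¹)) := by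
  have h0 : Tendsto (fun i : ℕ => (i : ℝ) + 1) atTop atTop :=
    tendsto_atTop_add_const_right _ _ tendsto_natCast_atTop_atTop
  have h1 : Tendsto (fun i : ℕ => 1 / ((i : ℝ) + 1) ^ 2) atTop (𝓝 0) := by
    simp only [one_div]
    exact tendsto_inv_atTop_zero.comp ((tendsto_pow_atTop two_ne_zero).comp h0)
  have h2 : Tendsto (fun i : ℕ => Real.tanh (κ * (i + 1))) atTop (𝓝 1) :=
    tendsto_tanh_atTop.comp (h0.const_mul_atTop hκ)
  have h3 := (((h1.add_const (T * κ ^ 2)).mul h2).mul_const κ⁻¹).sqrt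
  simp only [zero_add, mul_one] at h3
  exact h3

theorem tendsto_invSqrt : Tendsto (invSqrt : ℕ → ℝ) atTop (𝓝 0) := by
  have h0 : Tendsto (fun i : ℕ => (i : ℝ) + 1) atTop atTop :=
    tendsto_atTop_add_const_right _ _ tendsto_natCast_atTop_atTop
  have h1 : (invSqrt : ℕ → ℝ) = fun i : ℕ => (√((i : ℝ) + 1))⁻¹ := by
    funext i
    simp [invSqrt]
  rw [h1]
  exact tendsto_inv_atTop_zero.comp (Real.tendsto_sqrt_atTop.comp h0)

theorem ell_neg (k₁ k₂ : ℕ) (c κ T : ℝ) (n : ℤ) : ell k₁ k₂ c κ T (-n) = ell k₁ k₂ c κ T n := by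
  unfold ell
  rw [Int.natAbs_neg, Int.cast_neg, mul_neg, symbol_neg]

open Classical in
/-- The symbol `ell` depends analytically on the parameters, as a bounded family. -/
theorem exists_analytic_ell {k₁ k₂ : ℕ} (hk₁ : 0 < k₁) (hk₂ : 0 < k₂) {c₀ κ₀ T₀ : ℝ}
    (hκ : 0 < κ₀) (hT : 0 < T₀) (hc : c₀ ≠ 1)
    (hne : ∀ n : ℕ, 0 < n → n ≠ k₁ → n ≠ k₂ → c₀ ≠ symbol T₀ (κ₀ * n)) :
    ∃ L : ℝ × ℝ × ℝ → ℤ →ᵇ ℝ, AnalyticAt ℝ L (c₀, κ₀, T₀) ∧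
      ∀ᶠ p in 𝓝 (c₀, κ₀, T₀), ∀ n : ℤ, L p n = ell k₁ k₂ p.1 p.2.1 p.2.2 n ∧
        (n.natAbs ≠ k₁ → n.natAbs ≠ k₂ → p.1 ≠ symbol p.2.2 (p.2.1 * n)) := by
  obtain ⟨v, v1, v2⟩ := exists_analytic_root hκ hT
  let good : Set ℕ := {i | i + 1 ≠ k₁ ∧ i + 1 ≠ k₂}
  -- The denominator `c - m_T(κn)` divided by `√n`, with `n = i + 1`. At the resonant indices the
  -- value `1` keeps it invertible; these entries are masked out again at the end.
  let D : ℝ × ℝ × ℝ → ℕ →ᵇ ℝ := fun p =>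
    ind ℝ good * (p.1 • invSqrt - v p.2) + ind ℝ goodᶜ
  have hva : AnalyticAt ℝ (fun p : ℝ × ℝ × ℝ => v p.2) (c₀, κ₀, T₀) :=
    AnalyticAt.fun_comp (f := fun p : ℝ × ℝ × ℝ => p.2) v1 analyticAt_snd
  have hDa : AnalyticAt ℝ D (c₀, κ₀, T₀) :=
    (analyticAt_const.mul ((analyticAt_fst.smul analyticAt_const).sub hva)).add analyticAt_const
  have hD : ∀ p i, D p i = if i ∈ good then p.1 * invSqrt i - v p.2 i else 1 := by
    intro p i
    have h1 : D p i = ind ℝ good i * (p.1 * invSqrt i - v p.2 i) + ind ℝ goodᶜ i := rfl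
    rw [h1, ind_apply, ind_apply]
    by_cases h2 : i ∈ good <;> simp [h2]
  have hinv : ∀ i, invSqrt i = 1 / √((i : ℝ) + 1) := fun i => rfl
  have hD0 : ∀ i, D (c₀, κ₀, T₀) i ≠ 0 := by
    intro i
    rw [hD]
    split_ifs with h
    · have h1 := hne (i + 1) (by omega) h.1 h.2
      push_cast at h1
      rw [symbol_eq_rootSeq hκ] at h1
      simp only [v2.self_of_nhds i, hinv]
      intro h2
      apply h1
      have h3 : 0 < √((i : ℝ) + 1) := by positivity
      field_simp at h2
      linarith
    · exact one_ne_zero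
  have hDt : Tendsto (D (c₀, κ₀, T₀)) atTop (𝓝 (c₀ * 0 - √(T₀ * κ₀ ^ 2 * κ₀⁻¹))) := by
    refine ((tendsto_invSqrt.const_mul c₀).sub (tendsto_rootSeq hκ)).congr' ?_
    filter_upwards [eventually_ge_atTop (k₁ + k₂)] with i hi
    rw [hD, if_pos (show i ∈ good from ⟨by omega, by omega⟩), v2.self_of_nhds i]
  obtain ⟨d, hd, hd2⟩ := exists_le_abs_of_tendsto
    (by
      have : 0 < √(T₀ * κ₀ ^ 2 * κ₀⁻¹) := Real.sqrt_pos.2 (by positivity)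
      rw [mul_zero, zero_sub]
      exact neg_ne_zero.2 this.ne') hDt hD0
  obtain ⟨w, w1, w2⟩ := exists_analytic_inv hDa hd hd2
  -- The mode `0` is not of the form `i + 1` and gets its value `(c - 1)⁻¹` separately. There the
  -- truncated `natAbs - 1` gives `0`, an entry removed by the indicator of the complement of `{0}`.
  refine ⟨fun p => (p.1 - 1)⁻¹ • ind ℝ {0} +
    ind ℝ {0}ᶜ * pull ℝ (fun n : ℤ => n.natAbs - 1) (ind ℝ good * (invSqrt * w p)), ?_, ?_⟩
  · refine AnalyticAt.add ?_ ?_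
    · exact ((analyticAt_fst.sub analyticAt_const).inv (sub_ne_zero.2 hc)).smul analyticAt_const
    · exact analyticAt_const.mul
        (analyticAt_lin _ (analyticAt_const.mul (analyticAt_const.mul w1)))
  · have hp : ∀ᶠ p : ℝ × ℝ × ℝ in 𝓝 (c₀, κ₀, T₀), 0 < p.2.1 := by
      have : Continuous fun p : ℝ × ℝ × ℝ => p.2.1 := by fun_prop
      exact this.continuousAt.eventually (lt_mem_nhds hκ)
    have hv : ∀ᶠ p : ℝ × ℝ × ℝ in 𝓝 (c₀, κ₀, T₀), ∀ i, v p.2 i = rootSeq p.2.1 p.2.2 i :=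
      (continuousAt_snd (p := (c₀, (κ₀, T₀)))).eventually v2
    have hc1 : ∀ᶠ p : ℝ × ℝ × ℝ in 𝓝 (c₀, κ₀, T₀), p.1 ≠ 1 :=
      (continuousAt_fst (p := (c₀, (κ₀, T₀)))).eventually_ne hc
    filter_upwards [w2, hp, hv, hc1] with p h1 h2 h3 hc2 n
    have e1 : ((p.1 - 1)⁻¹ • ind ℝ {0} + ind ℝ {0}ᶜ *
        pull ℝ (fun n : ℤ => n.natAbs - 1) (ind ℝ good * (invSqrt * w p)) : ℤ →ᵇ ℝ) n =
        (p.1 - 1)⁻¹ * ind ℝ {0} n + ind ℝ {0}ᶜ n *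
          (ind ℝ good (n.natAbs - 1) * (invSqrt (n.natAbs - 1) * w p (n.natAbs - 1))) := rfl
    rw [e1, (h1 _).2, hD, ind_apply, ind_apply, ind_apply, ell]
    by_cases hn : n = 0
    · subst hn
      simp [hk₁.ne, hk₂.ne, symbol, hc2]
    · obtain ⟨i, hi⟩ : ∃ i, n.natAbs = i + 1 := ⟨n.natAbs - 1, by omega⟩
      have e2 : symbol p.2.2 (p.2.1 * n) = symbol p.2.2 (p.2.1 * ((i : ℝ) + 1)) := by
        have e3 : ((i : ℝ) + 1) = |(n : ℝ)| := by
          rw [← Int.cast_abs, Int.abs_eq_natAbs, hi]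
          push_cast
          rfl
        rw [e3]
        rcases abs_choice (n : ℝ) with h | h <;> rw [h]
        rw [mul_neg, symbol_neg]
      rw [e2, symbol_eq_rootSeq h2, hi, Nat.add_sub_cancel, hinv, h3]
      by_cases hg : i ∈ good
      · have hg' : ¬ (i + 1 = k₁ ∨ i + 1 = k₂) := by
          rintro (h | h)
          · exact hg.1 h
          · exact hg.2 h
        have h5 : 0 < √((i : ℝ) + 1) := by positivity
        simp only [mem_singleton_iff, hn, if_false, mul_zero, zero_add, mem_compl_iff,
          not_false_eq_true, if_true, hg, one_mul, hg']
        have h6 := (h1 i).1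
        rw [hD, if_pos hg, hinv, h3] at h6
        refine ⟨?_, fun _ _ h7 => h6 ?_⟩
        · rw [one_div, ← mul_inv]
          congr 1
          field_simp
        · rw [h7]
          field_simp
          ring
      · have hg' : i + 1 = k₁ ∨ i + 1 = k₂ := by
          by_contra h
          exact hg ⟨fun h' => h (Or.inl h'), fun h' => h (Or.inr h')⟩
        refine ⟨by simp [hn, hg, hg'], fun h7 h8 => ?_⟩
        exact (hg'.elim h7 h8).elim

/-! ## Absolutely convergent trigonometric series -/

/-- The trigonometric series with coefficients `f i` at the frequencies `μ i`. -/
def syn {ι : Type*} (μ : ι → ℤ) (f : ι → ℂ) : C(Torus, ℂ) :=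
  ∑' i, f i • (fourier (μ i) : C(Torus, ℂ))

section syn

variable {ι : Type*} {μ : ι → ℤ} {f : ι → ℂ}

theorem norm_smul_fourier (c : ℂ) (n : ℤ) : ‖c • (fourier n : C(Torus, ℂ))‖ = ‖c‖ := by
  rw [norm_smul, fourier_norm, mul_one]

theorem summable_norm_syn (hf : Summable fun i => ‖f i‖) :
    Summable fun i => ‖f i • (fourier (μ i) : C(Torus, ℂ))‖ := by
  simpa only [norm_smul_fourier] using hf

theorem hasSum_syn (μ : ι → ℤ) (hf : Summable fun i => ‖f i‖) :
    HasSum (fun i => f i • (fourier (μ i) : C(Torus, ℂ))) (syn μ f) :=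
  (Summable.of_norm (summable_norm_syn hf)).hasSum

theorem hasSum_syn_apply (μ : ι → ℤ) (hf : Summable fun i => ‖f i‖) (x : Torus) :
    HasSum (fun i => f i * (fourier (μ i) x : ℂ)) (syn μ f x) :=
  (ContinuousMap.evalCLM ℂ x).hasSum (hasSum_syn μ hf)

/-- The Fourier coefficient as a continuous linear functional. -/
def fc (n : ℤ) : C(Torus, ℂ) →L[ℂ] ℂ :=
  LinearMap.mkContinuous
    { toFun := fun g => fourierCoeff g n
      map_add' := fun g h => by
        have hi : ∀ g : C(Torus, ℂ), Integrable g AddCircle.haarAddCircle := fun g =>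
          g.continuous.integrable_of_hasCompactSupport (HasCompactSupport.of_compactSpace _)
        exact congrFun (fourierCoeff.add (hi g) (hi h)) n
      map_smul' := fun c g => fourierCoeff.const_smul g c n } 1 (fun g => by
        rw [one_mul]
        change ‖∫ t : Torus, fourier (-n) t • g t ∂AddCircle.haarAddCircle‖ ≤ ‖g‖
        have h := norm_integral_le_of_norm_le_const (μ := (AddCircle.haarAddCircle : Measure Torus))
          (f := fun t : Torus => fourier (-n) t • g t) (C := ‖g‖) (Eventually.of_forall fun t => by
            rw [norm_smul, fourier_apply, Circle.norm_coe, one_mul]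
            exact g.norm_coe_le_norm t)
        simpa using h)

theorem fc_apply (n : ℤ) (g : C(Torus, ℂ)) : fc n g = fourierCoeff g n := rfl

theorem fc_fourier (n k : ℤ) : fc n (fourier k : C(Torus, ℂ)) = if k = n then 1 else 0 := by
  rw [fc_apply, fourierCoeff_fourier]
  by_cases h : k = n
  · simp [h]
  · simp [h, Ne.symm h]

theorem hasSum_fc_syn (μ : ι → ℤ) (hf : Summable fun i => ‖f i‖) (n : ℤ) :
    HasSum (fun i => if μ i = n then f i else 0) (fc n (syn μ f)) := by
  have h := (fc n).hasSum (hasSum_syn μ hf)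
  refine h.congr_fun ?_
  intro i
  simp only [map_smul, fc_fourier, smul_eq_mul]
  split_ifs <;> simp

theorem syn_add {g : ι → ℂ} (hf : Summable fun i => ‖f i‖) (hg : Summable fun i => ‖g i‖) :
    syn μ (fun i => f i + g i) = syn μ f + syn μ g := by
  have h := (hasSum_syn μ hf).add (hasSum_syn μ hg)
  rw [← h.tsum_eq, syn]
  simp only [add_smul]

theorem syn_mul {κ : Type*} {ν : κ → ℤ} {g : κ → ℂ} (hf : Summable fun i => ‖f i‖)
    (hg : Summable fun i => ‖g i‖) :
    syn μ f * syn ν g = syn (fun p : ι × κ => μ p.1 + ν p.2) fun p => f p.1 * g p.2 := by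
  rw [syn, syn, tsum_mul_tsum_of_summable_norm (summable_norm_syn hf) (summable_norm_syn hg), syn]
  congr 1
  funext p
  ext x
  simp only [ContinuousMap.mul_apply, ContinuousMap.smul_apply, smul_eq_mul, fourier_add]
  ring

theorem summable_norm_prod {κ : Type*} {g : κ → ℂ} (hf : Summable fun i => ‖f i‖)
    (hg : Summable fun i => ‖g i‖) : Summable fun p : ι × κ => ‖f p.1 * g p.2‖ :=
  hf.mul_norm hg

end syn

/-- The real part of a trigonometric series. -/
def reSyn {ι : Type*} (μ : ι → ℤ) (f : ι → ℂ) : C(Torus, ℝ) :=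
  ⟨fun x => (syn μ f x).re, Complex.continuous_re.comp (syn μ f).continuous⟩

theorem hasSum_coeff_reSyn {ι : Type*} (μ : ι → ℤ) {f : ι → ℂ} (hf : Summable fun i => ‖f i‖)
    (n : ℤ) : HasSum (fun i => ((if μ i = n then f i else 0) +
      (if -μ i = n then conj (f i) else 0)) / 2) (coeff (reSyn μ f) n) := by
  have hf' : Summable fun i => ‖conj (f i)‖ := by simpa using hf
  have h1 := ((hasSum_fc_syn μ hf n).add (hasSum_fc_syn (fun i => -μ i) hf' n)).div_const 2
  have h2 : coeff (reSyn μ f) n =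
      (fc n (syn μ f) + fc n (syn (fun i => -μ i) fun i => conj (f i))) / 2 := by
    have h3 : (fun x : Torus => ((reSyn μ f x : ℝ) : ℂ)) =
        ((1 / 2 : ℂ) • (syn μ f + syn (fun i => -μ i) fun i => conj (f i)) : C(Torus, ℂ)) := by
      funext x
      have h4 : syn (fun i => -μ i) (fun i => conj (f i)) x = conj (syn μ f x) := by
        have h5 := (hasSum_syn_apply μ hf x).map (starRingEnd ℂ) Complex.continuous_conj
        refine (hasSum_syn_apply _ hf' x).unique ?_
        refine h5.congr_fun ?_
        intro i
        simp
      have h6 : (((syn μ f x).re : ℝ) : ℂ) = (syn μ f x + conj (syn μ f x)) / 2 :=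
        Complex.re_eq_add_conj _
      simp only [ContinuousMap.smul_apply, ContinuousMap.add_apply, h4, smul_eq_mul]
      change (((syn μ f x).re : ℝ) : ℂ) = _
      rw [h6]
      ring
    rw [coeff, h3, ← fc_apply, map_smul, map_add, smul_eq_mul]
    ring
  rw [h2]
  exact h1

/-- Taking the real part gives half of each term to the frequency `μ i` and half to `-μ i`; an even
weight counts the two halves alike. -/
theorem sum_weight_coeff_le {ι : Type*} (μ : ι → ℤ) {f : ι → ℂ} (w : ℤ → ℝ) (hw : ∀ n, 0 ≤ w n)
    (hwe : ∀ n, w (-n) = w n) (hf : Summable fun i => ‖f i‖)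
    (hwf : Summable fun i => w (μ i) * ‖f i‖) (S : Finset ℤ) :
    ∑ n ∈ S, w n * ‖coeff (reSyn μ f) n‖ ≤ ∑' i, w (μ i) * ‖f i‖ := by
  let F : ℤ → ι → ℝ := fun n i =>
    w n * (((if μ i = n then ‖f i‖ else 0) + (if -μ i = n then ‖f i‖ else 0)) / 2)
  have hle : ∀ n i, ((if μ i = n then ‖f i‖ else 0) + (if -μ i = n then ‖f i‖ else 0)) / 2 ≤
      ‖f i‖ := by
    intro n i
    have := norm_nonneg (f i)
    split_ifs <;> linarith
  have hnn : ∀ n i, 0 ≤ ((if μ i = n then ‖f i‖ else 0) + (if -μ i = n then ‖f i‖ else 0)) / 2 := by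
    intro n i
    have := norm_nonneg (f i)
    split_ifs <;> linarith
  have hs : ∀ n, Summable fun i =>
      ((if μ i = n then ‖f i‖ else 0) + (if -μ i = n then ‖f i‖ else 0)) / 2 := fun n =>
    Summable.of_nonneg_of_le (hnn n) (hle n) hf
  have h1 : ∀ n, w n * ‖coeff (reSyn μ f) n‖ ≤ ∑' i, F n i := by
    intro n
    rw [tsum_mul_left]
    refine mul_le_mul_of_nonneg_left ?_ (hw n)
    rw [← (hasSum_coeff_reSyn μ hf n).tsum_eq]
    refine tsum_of_norm_bounded (hs n).hasSum fun i => ?_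
    rw [norm_div, Complex.norm_ofNat]
    gcongr
    refine (norm_add_le _ _).trans (le_of_eq ?_)
    split_ifs <;> simp
  refine (Finset.sum_le_sum fun n _ => h1 n).trans ?_
  rw [← Summable.tsum_finsetSum fun n _ => (hs n).mul_left (w n)]
  refine Summable.tsum_le_tsum (fun i => ?_) (summable_sum fun n _ => (hs n).mul_left (w n)) hwf
  calc ∑ n ∈ S, F n i = (∑ n ∈ S, if μ i = n then w n * ‖f i‖ / 2 else 0) +
        ∑ n ∈ S, if -μ i = n then w n * ‖f i‖ / 2 else 0 := by
        rw [← Finset.sum_add_distrib]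
        refine Finset.sum_congr rfl fun n _ => ?_
        simp only [F]
        split_ifs <;> ring
    _ ≤ w (μ i) * ‖f i‖ / 2 + w (μ i) * ‖f i‖ / 2 := by
        have h2 : 0 ≤ w (μ i) * ‖f i‖ / 2 := by
          have := hw (μ i)
          positivity
        rw [Finset.sum_ite_eq, Finset.sum_ite_eq, hwe]
        gcongr <;> split_ifs <;> simp [h2]
    _ = w (μ i) * ‖f i‖ := by ring

/-! ## The Zygmund norm of a trigonometric series -/

/-- The weights `(1 + 2 |n|)ˢ`. -/
def wt (s : ℝ) (n : ℤ) : ℝ := (1 + 2 * |(n : ℝ)|) ^ s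

theorem wt_nonneg (s : ℝ) (n : ℤ) : 0 ≤ wt s n := by
  unfold wt
  positivity

theorem cutoff_eq_one {ξ : ℝ} (h : |ξ| ≤ 1) : cutoff ξ = 1 := by
  apply cutoff.one_of_mem_closedBall
  rw [Metric.mem_closedBall, Real.dist_eq, sub_zero]
  exact h

/-- The `j`-th symbol with `j ≥ 1` vanishes for `|n| ≤ 2^{j-1}`, so `2^j < 2|n|` wherever it
matters. The summand `1` in the weight covers `j = 0`. -/
theorem two_rpow_mul_lpSymbol_le {s : ℝ} (hs : 0 ≤ s) (j : ℕ) (n : ℤ) :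
    (2 : ℝ) ^ ((j : ℝ) * s) * |lpSymbol j n| ≤ wt s n := by
  have hn := abs_nonneg (n : ℝ)
  have h01 : ∀ ξ, 0 ≤ cutoff ξ ∧ cutoff ξ ≤ 1 := fun ξ => ⟨cutoff.nonneg, cutoff.le_one⟩
  cases j with
  | zero =>
    rw [lpSymbol, abs_of_nonneg (h01 _).1]
    simp only [Nat.cast_zero, zero_mul, Real.rpow_zero, one_mul]
    exact (h01 _).2.trans (Real.one_le_rpow (by linarith) hs)
  | succ j =>
    rw [lpSymbol, Real.rpow_mul zero_le_two, Real.rpow_natCast]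
    by_cases h : |(n : ℝ)| ≤ 2 ^ j
    · rw [cutoff_eq_one (ξ := n / 2 ^ (j + 1)), cutoff_eq_one (ξ := n / 2 ^ j)]
      · simp [wt_nonneg]
      · rw [abs_div, abs_of_pos (by positivity : (0 : ℝ) < 2 ^ j)]
        exact (div_le_one (by positivity)).2 h
      · rw [abs_div, abs_of_pos (by positivity : (0 : ℝ) < 2 ^ (j + 1))]
        refine (div_le_one (by positivity)).2 (h.trans ?_)
        exact pow_le_pow_right₀ one_le_two (by omega)
    · have h1 : |cutoff ((n : ℝ) / 2 ^ (j + 1)) - cutoff ((n : ℝ) / 2 ^ j)| ≤ 1 := by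
        have h2 := h01 ((n : ℝ) / 2 ^ (j + 1))
        have h3 := h01 ((n : ℝ) / 2 ^ j)
        rw [abs_le]
        constructor <;> linarith [h2.1, h2.2, h3.1, h3.2]
      refine (mul_le_of_le_one_right (by positivity) h1).trans ?_
      refine Real.rpow_le_rpow (by positivity) ?_ hs
      rw [pow_succ]
      linarith [not_le.1 h]

theorem zygmundSize_le {s : ℝ} (hs : 0 ≤ s) (u : C(Torus, ℝ)) (j : ℕ) :
    zygmundSize s u j ≤
      ∑ n ∈ Finset.Icc (-(2 ^ (j + 1) : ℤ)) (2 ^ (j + 1)), wt s n * ‖coeff u n‖ := by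
  have h1 : ‖lpBlock j u‖ ≤ ∑ n ∈ Finset.Icc (-(2 ^ (j + 1) : ℤ)) (2 ^ (j + 1)),
      |lpSymbol j n| * ‖coeff u n‖ := by
    refine (norm_sum_le _ _).trans (Finset.sum_le_sum fun n _ => le_of_eq ?_)
    rw [norm_smul_fourier, norm_mul, Complex.norm_real, Real.norm_eq_abs]
  refine (mul_le_mul_of_nonneg_left h1 (by positivity)).trans ?_
  rw [Finset.mul_sum]
  refine Finset.sum_le_sum fun n _ => ?_
  rw [← mul_assoc]
  exact mul_le_mul_of_nonneg_right (two_rpow_mul_lpSymbol_le hs j n) (norm_nonneg _)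

theorem abs_mode_le (k₁ k₂ : ℕ) (m : Idx) :
    |(mode k₁ k₂ m : ℝ)| ≤ ((k₁ : ℝ) + k₂) * order m := by
  obtain ⟨⟨a, b⟩, ⟨c, d⟩⟩ := m
  simp only [mode, order]
  push_cast
  have ha : (0 : ℝ) ≤ a := Nat.cast_nonneg a
  have hb : (0 : ℝ) ≤ b := Nat.cast_nonneg b
  have hc : (0 : ℝ) ≤ c := Nat.cast_nonneg c
  have hd : (0 : ℝ) ≤ d := Nat.cast_nonneg d
  have h1 : (0 : ℝ) ≤ k₁ := Nat.cast_nonneg k₁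
  have h2 : (0 : ℝ) ≤ k₂ := Nat.cast_nonneg k₂
  rw [abs_le]
  have := mul_nonneg h1 ha
  have := mul_nonneg h1 hb
  have := mul_nonneg h1 hc
  have := mul_nonneg h1 hd
  have := mul_nonneg h2 ha
  have := mul_nonneg h2 hb
  have := mul_nonneg h2 hc
  have := mul_nonneg h2 hd
  constructor <;> linarith

/-- The weight grows polynomially in the order. Giving up a factor `2` in the radius of convergence
therefore pays for any Zygmund regularity. -/
theorem exists_wt_mode_le {s : ℝ} (hs : 0 ≤ s) (k₁ k₂ : ℕ) :
    ∃ C : ℝ, 0 ≤ C ∧ ∀ m : Idx, wt s (mode k₁ k₂ m) * (1 / 2) ^ order m ≤ C := by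
  have h1 := (tendsto_pow_const_div_const_pow_of_one_lt ⌈s⌉₊ (one_lt_two : (1 : ℝ) < 2))
  obtain ⟨B, hB⟩ := (h1.comp (tendsto_add_atTop_nat 1)).bddAbove_range
  have hB' : ∀ N : ℕ, ((N : ℝ) + 1) ^ ⌈s⌉₊ / 2 ^ (N + 1) ≤ B := fun N => by
    have := hB ⟨N, rfl⟩
    simpa using this
  have hB0 : 0 ≤ B := le_trans (by positivity) (hB' 0)
  let K : ℝ := 1 + 2 * ((k₁ : ℝ) + k₂)
  have hK : 1 ≤ K := by
    have h1 : (0 : ℝ) ≤ k₁ := Nat.cast_nonneg k₁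
    have h2 : (0 : ℝ) ≤ k₂ := Nat.cast_nonneg k₂
    simp only [K]
    linarith
  refine ⟨K ^ s * (2 * B), by positivity, fun m => ?_⟩
  have h2 : wt s (mode k₁ k₂ m) ≤ K ^ s * ((order m : ℝ) + 1) ^ ⌈s⌉₊ := by
    have h3 : (1 + 2 * |(mode k₁ k₂ m : ℝ)|) ≤ K * ((order m : ℝ) + 1) := by
      have h4 := abs_mode_le k₁ k₂ m
      have h5 : (0 : ℝ) ≤ order m := Nat.cast_nonneg _
      simp only [K] at hK ⊢
      nlinarith
    calc wt s (mode k₁ k₂ m) ≤ (K * ((order m : ℝ) + 1)) ^ s :=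
          Real.rpow_le_rpow (by positivity) h3 hs
      _ = K ^ s * ((order m : ℝ) + 1) ^ s := Real.mul_rpow (by positivity) (by positivity)
      _ ≤ K ^ s * ((order m : ℝ) + 1) ^ ((⌈s⌉₊ : ℕ) : ℝ) := by
          gcongr
          · have : (0 : ℝ) ≤ order m := Nat.cast_nonneg _
            linarith
          · exact Nat.le_ceil s
      _ = _ := by rw [Real.rpow_natCast]
  calc wt s (mode k₁ k₂ m) * (1 / 2) ^ order m
      ≤ K ^ s * ((order m : ℝ) + 1) ^ ⌈s⌉₊ * (1 / 2) ^ order m := by gcongr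
    _ = K ^ s * (2 * (((order m : ℝ) + 1) ^ ⌈s⌉₊ / 2 ^ (order m + 1))) := by
        rw [one_div, inv_pow, pow_succ]
        field_simp
    _ ≤ _ := by
        gcongr
        exact hB' _

/-- Power series with weights `2⁻ᵐ` as elements of the Zygmund space. -/
theorem exists_zygmund_syn {s : ℝ} (hs : 0 ≤ s) (k₁ k₂ : ℕ) :
    ∃ Z : L1 Idx ℂ →L[ℝ] Zygmund s, ∀ a, (Z a).toCont =
      reSyn (mode k₁ k₂) fun m => a m * (1 / 2) ^ order m := by
  obtain ⟨C, hC0, hC⟩ := exists_wt_mode_le hs k₁ k₂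
  have hwe : ∀ n, wt s (-n) = wt s n := fun n => by simp [wt]
  have hle : ∀ (a : L1 Idx ℂ) (m : Idx), ‖a m * (1 / 2) ^ order m‖ ≤ ‖a m‖ := by
    intro a m
    rw [norm_mul]
    refine mul_le_of_le_one_right (norm_nonneg _) ?_
    rw [norm_pow]
    exact pow_le_one₀ (norm_nonneg _) (by norm_num)
  have hsum : ∀ a : L1 Idx ℂ, Summable fun m => ‖a m * (1 / 2) ^ order m‖ := fun a =>
    Summable.of_nonneg_of_le (fun _ => norm_nonneg _) (hle a) a.summable_norm
  have hwle : ∀ (a : L1 Idx ℂ) (m : Idx),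
      wt s (mode k₁ k₂ m) * ‖a m * (1 / 2) ^ order m‖ ≤ C * ‖a m‖ := by
    intro a m
    have h1 : ‖((1 : ℂ) / 2) ^ order m‖ = (1 / 2 : ℝ) ^ order m := by
      rw [norm_pow]
      norm_num
    rw [norm_mul, h1, mul_left_comm, mul_comm C]
    exact mul_le_mul_of_nonneg_left (hC m) (norm_nonneg _)
  have hwsum : ∀ a : L1 Idx ℂ, Summable fun m =>
      wt s (mode k₁ k₂ m) * ‖a m * (1 / 2) ^ order m‖ := fun a =>
    Summable.of_nonneg_of_le (fun m => mul_nonneg (wt_nonneg _ _) (norm_nonneg _)) (hwle a)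
      (a.summable_norm.mul_left C)
  have hbd : ∀ (a : L1 Idx ℂ) (j : ℕ), zygmundSize s
      (reSyn (mode k₁ k₂) fun m => a m * (1 / 2) ^ order m) j ≤ C * ‖a‖ := by
    intro a j
    refine (zygmundSize_le hs _ j).trans ((sum_weight_coeff_le _ _ (wt_nonneg s) hwe (hsum a)
      (hwsum a) _).trans ?_)
    rw [L1.norm_eq, ← tsum_mul_left]
    exact Summable.tsum_le_tsum (hwle a) (hwsum a) (a.summable_norm.mul_left C)
  let Z₀ : L1 Idx ℂ →ₗ[ℝ] zygmundSubmodule s :=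
    { toFun := fun a => ⟨reSyn (mode k₁ k₂) fun m => a m * (1 / 2) ^ order m, C * ‖a‖, by
        rintro _ ⟨j, rfl⟩
        exact hbd a j⟩
      map_add' := fun a b => by
        refine Subtype.ext (ContinuousMap.ext fun x => ?_)
        change (syn _ _ x).re = (syn _ _ x).re + (syn _ _ x).re
        rw [← Complex.add_re, ← ContinuousMap.add_apply, ← syn_add (hsum a) (hsum b)]
        simp only [lp.coeFn_add, Pi.add_apply, add_mul]
      map_smul' := fun c a => by
        refine Subtype.ext (ContinuousMap.ext fun x => ?_)
        change (syn _ _ x).re = c * (syn _ _ x).re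
        have h1 := (hasSum_syn_apply (mode k₁ k₂) (hsum a) x).mul_left (c : ℂ)
        have h2 := hasSum_syn_apply (mode k₁ k₂) (hsum (c • a)) x
        rw [← Complex.re_ofReal_mul]
        congr 1
        refine h2.unique ?_
        refine h1.congr_fun ?_
        intro m
        simp only [lp.coeFn_smul, Pi.smul_apply, Complex.real_smul]
        ring }
  let Z₁ : L1 Idx ℂ →ₗ[ℝ] Zygmund s :=
    { toFun := fun a => (Z₀ a : zygmundSubmodule s)
      map_add' := fun a b => Z₀.map_add a b
      map_smul' := fun c a => Z₀.map_smul c a }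
  exact ⟨LinearMap.mkContinuous Z₁ C fun a => ciSup_le fun j => hbd a j, fun a => rfl⟩

/-! ## Power series on the circle -/

theorem fc_mul_fourier (n : ℤ) (v : C(Torus, ℂ)) :
    fc 0 ((fourier n : C(Torus, ℂ)) * v) = fc (-n) v := by
  rw [fc_apply, fc_apply, fourierCoeff, fourierCoeff]
  congr 1
  funext x
  simp

theorem summable_syn_triple {ι : Type*} {f g h : ι → ℂ} (hf : Summable fun i => ‖f i‖)
    (hg : Summable fun i => ‖g i‖) (hh : Summable fun i => ‖h i‖) :
    Summable fun p : (ι × ι) × ι => ‖f p.1.1 * g p.1.2 * h p.2‖ :=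
  summable_norm_prod (f := fun p : ι × ι => f p.1 * g p.2) (g := h)
    (summable_norm_prod (f := f) (g := g) hf hg) hh

/-- The integral of `u' u²` vanishes. -/
theorem fc_deriv_mul_sq {ι : Type*} {μ : ι → ℤ} {f : ι → ℂ} (hf : Summable fun i => ‖f i‖)
    (hf' : Summable fun i => ‖(μ i : ℂ) * f i‖) :
    fc 0 (syn μ (fun i => (μ i : ℂ) * f i) * (syn μ f * syn μ f)) = 0 := by
  let u := syn μ f
  let D := syn μ fun i => (μ i : ℂ) * f i
  let ν : (ι × ι) × ι → ℤ := fun p => μ p.1.1 + μ p.1.2 + μ p.2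
  have e1 : D * u * u = syn ν fun p => (μ p.1.1 : ℂ) * f p.1.1 * f p.1.2 * f p.2 := by
    rw [syn_mul hf' hf, syn_mul (summable_norm_prod hf' hf) hf]
  have e2 : u * D * u = syn ν fun p => f p.1.1 * ((μ p.1.2 : ℂ) * f p.1.2) * f p.2 := by
    rw [syn_mul hf hf', syn_mul (summable_norm_prod hf hf') hf]
  have e3 : u * u * D = syn ν fun p => f p.1.1 * f p.1.2 * ((μ p.2 : ℂ) * f p.2) := by
    rw [syn_mul hf hf, syn_mul (summable_norm_prod hf hf) hf']
  have h1 := hasSum_fc_syn ν (summable_syn_triple hf' hf hf) 0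
  have h2 := hasSum_fc_syn ν (summable_syn_triple hf hf' hf) 0
  have h3 := hasSum_fc_syn ν (summable_syn_triple hf hf hf') 0
  rw [← e1] at h1
  rw [← e2] at h2
  rw [← e3] at h3
  have h4 := (h1.add h2).add h3
  have e4 : u * D * u = D * u * u := by ring
  have e5 : u * u * D = D * u * u := by ring
  have e6 : D * (u * u) = D * u * u := by ring
  rw [e4, e5] at h4
  -- The three placements of the derivative add up to the total frequency times the product, and the
  -- total frequency is zero in the mode `0`. This is `∫ (u³)' = 0`.
  have h5 : fc 0 (D * u * u) + fc 0 (D * u * u) + fc 0 (D * u * u) = 0 := by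
    refine h4.unique ((hasSum_zero (α := ℂ)).congr_fun fun p => ?_)
    by_cases hp : ν p = 0
    · have h6 : (μ p.1.1 : ℂ) + μ p.1.2 + μ p.2 = 0 := by exact_mod_cast hp
      simp only [hp, if_true]
      linear_combination (f p.1.1 * f p.1.2 * f p.2) * h6
    · simp [hp]
  change fc 0 (D * (u * u)) = 0
  rw [e6]
  have h7 : (3 : ℂ) * fc 0 (D * u * u) = 0 := by linear_combination h5
  exact (mul_eq_zero.1 h7).resolve_left (by norm_num)

/-- The integral of `u' M u` vanishes for an even Fourier multiplier `M`. -/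
theorem fc_deriv_mul_multiplier {ι : Type*} {μ : ι → ℤ} {f : ι → ℂ} (hf : Summable fun i => ‖f i‖)
    (hf' : Summable fun i => ‖(μ i : ℂ) * f i‖) {σ : ℤ → ℂ} (hσ : ∀ n, σ (-n) = σ n)
    {v : C(Torus, ℂ)} (hv : ∀ n, fc n v = σ n * fc n (syn μ f)) :
    fc 0 (syn μ (fun i => (μ i : ℂ) * f i) * v) = 0 := by
  let A : ℤ → ℂ := fun n => fc n (syn μ f)
  let S := fc 0 (syn μ (fun i => (μ i : ℂ) * f i) * v)
  let B : C(Torus, ℂ) →L[ℂ] ℂ := (fc 0).comp ((ContinuousLinearMap.mul ℂ C(Torus, ℂ)).flip v)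
  have h1 : HasSum (fun i => (μ i : ℂ) * f i * (σ (μ i) * A (-μ i))) S := by
    have h2 := B.hasSum (hasSum_syn μ hf')
    refine h2.congr_fun fun i => ?_
    rw [map_smul, smul_eq_mul]
    congr 1
    change _ = fc 0 ((fourier (μ i) : C(Torus, ℂ)) * v)
    rw [fc_mul_fourier, hv, hσ]
  have h3 : HasSum (fun n : ℤ => (n : ℂ) * σ n * A (-n) * A n) S := by
    refine (h1.tsum_fiberwise μ).congr_fun fun n => ?_
    have h4 : (∑' b : μ ⁻¹' {n}, f b) = A n := by
      rw [tsum_subtype (μ ⁻¹' {n}) f]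
      refine HasSum.tsum_eq ((hasSum_fc_syn μ hf n).congr_fun fun i => ?_)
      by_cases h : μ i = n <;> simp [h]
    rw [← h4, ← tsum_mul_left]
    refine tsum_congr fun b => ?_
    rw [show μ b = n from b.2]
    ring
  -- With `σ` even, the summand is odd under `n ↦ -n`, so the sum equals its own negative.
  have h5 : HasSum (fun n : ℤ => (n : ℂ) * σ n * A (-n) * A n) (-S) := by
    have h6 := ((Equiv.neg ℤ).hasSum_iff.2 h3).neg
    refine h6.congr_fun fun n => ?_
    change _ = -(((-n : ℤ) : ℂ) * σ (-n) * A (- -n) * A (-n))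
    rw [hσ, neg_neg]
    push_cast
    ring
  have h7 : S = -S := h3.unique h5
  have h8 : (2 : ℂ) * S = 0 := by linear_combination h7
  exact (mul_eq_zero.1 h8).resolve_left two_ne_zero

theorem fc_syn_deriv {ι : Type*} {μ : ι → ℤ} {f : ι → ℂ} (hf : Summable fun i => ‖f i‖)
    (hf' : Summable fun i => ‖(μ i : ℂ) * f i‖) (n : ℤ) :
    fc n (syn μ fun i => (μ i : ℂ) * f i) = n * fc n (syn μ f) := by
  refine (hasSum_fc_syn μ hf' n).unique (((hasSum_fc_syn μ hf n).mul_left (n : ℂ)).congr_fun ?_)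
  intro i
  split_ifs with h
  · rw [h]
  · simp

theorem fc_neg_of_real {v : C(Torus, ℂ)} (hv : ∀ x, conj (v x) = v x) (n : ℤ) :
    fc (-n) v = conj (fc n v) := by
  rw [fc_apply, fc_apply, fourierCoeff, fourierCoeff, ← integral_conj]
  congr 1
  funext x
  simp only [smul_eq_mul, map_mul, hv, ← fourier_neg, neg_neg]

/-- If the equation `σ(D) u = u²` holds in all modes but `± k`, and its real part holds in the
mode `k`, then it holds in all modes. -/
theorem fc_eq_of_modes {ι : Type*} {μ : ι → ℤ} {f : ι → ℂ} (hf : Summable fun i => ‖f i‖)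
    (hf' : Summable fun i => ‖(μ i : ℂ) * f i‖) (hreal : ∀ x, conj (syn μ f x) = syn μ f x)
    {σ : ℤ → ℝ} (hσ : ∀ n, σ (-n) = σ n) {k : ℤ} (hk : k ≠ 0)
    (h1 : ∀ n, n ≠ k → n ≠ -k → fc n (syn μ f * syn μ f) = σ n * fc n (syn μ f))
    (h2 : ((σ k * fc k (syn μ f) - fc k (syn μ f * syn μ f)) * conj (fc k (syn μ f))).re = 0)
    (h3 : fc k (syn μ f) = 0 → fc k (syn μ f * syn μ f) = 0) (n : ℤ) :
    fc n (syn μ f * syn μ f) = σ n * fc n (syn μ f) := by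
  set u := syn μ f with hu
  let e : ℤ → ℂ := fun n => σ n * fc n u - fc n (u * u)
  have hreal2 : ∀ x, conj ((u * u) x) = (u * u) x := fun x => by
    rw [ContinuousMap.mul_apply, map_mul, hreal]
  have hen : ∀ n, e (-n) = conj (e n) := by
    intro n
    simp only [e, map_sub, map_mul, Complex.conj_ofReal]
    rw [fc_neg_of_real hreal, fc_neg_of_real hreal2, hσ]
  have he0 : ∀ n, n ≠ k → n ≠ -k → e n = 0 := fun n a b => sub_eq_zero.2 (h1 n a b).symm
  -- The residual of the equation is supported in the modes `± k`. Adding it to `u²` yields exactly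
  -- the multiplier applied to `u`, so `∫ u' E = 0` by the two orthogonality relations.
  let E : C(Torus, ℂ) := e k • fourier k + e (-k) • fourier (-k)
  have hkk : k ≠ -k := by omega
  have hE : ∀ n, fc n E = e n := by
    intro n
    simp only [E, map_add, map_smul, fc_fourier, smul_eq_mul]
    by_cases a : k = n
    · subst a
      simp [hkk.symm]
    · by_cases b : -k = n
      · subst b
        simp [hkk]
      · simp [a, b, he0 n (Ne.symm a) (Ne.symm b)]
  have h4 := fc_deriv_mul_multiplier hf hf' (σ := fun n => (σ n : ℂ)) (v := u * u + E)
    (fun n => by rw [hσ]) (fun n => by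
      rw [map_add, hE]
      simp only [e]
      ring)
  have h5 := fc_deriv_mul_sq hf hf'
  rw [mul_add, map_add, h5, zero_add] at h4
  have h6 : ∀ (c : ℂ) (D : C(Torus, ℂ)) (j : ℤ), fc 0 (D * c • fourier j) = c * fc (-j) D := by
    intro c D j
    rw [mul_smul_comm, map_smul, mul_comm D, fc_mul_fourier, smul_eq_mul]
  rw [mul_add, map_add, h6, h6, fc_syn_deriv hf hf', fc_syn_deriv hf hf', hen, neg_neg,
    fc_neg_of_real hreal] at h4
  -- The orthogonality says that the residual times the conjugate coefficient has zero imaginary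
  -- part; its real part is zero by `h2`.
  have h7 : (k : ℂ) * (e k * conj (fc k u) - conj (e k * conj (fc k u))) = 0 := by
    rw [map_mul, Complex.conj_conj]
    push_cast at h4
    linear_combination -h4
  have h8 := (mul_eq_zero.1 h7).resolve_left (by exact_mod_cast hk)
  have h9 : e k * conj (fc k u) = 0 := by
    refine Complex.ext h2 ?_
    have := congrArg Complex.im h8
    simp only [Complex.sub_im, Complex.conj_im, Complex.zero_im] at this
    rw [Complex.zero_im]
    linarith
  have h10 : e k = 0 := by
    rcases mul_eq_zero.1 h9 with h | h
    · exact h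
    · have h11 : fc k u = 0 := by simpa using h
      simp only [e]
      rw [h3 h11, h11]
      simp
  have h12 : ∀ n, e n = 0 := by
    intro n
    by_cases a : n = k
    · rw [a, h10]
    · by_cases b : n = -k
      · rw [b, hen, h10, map_zero]
      · exact he0 n a b
  exact (sub_eq_zero.1 (h12 n)).symm

theorem conj_syn_of_swap {k₁ k₂ : ℕ} {f : Idx → ℂ} (hf : Summable fun m => ‖f m‖)
    (hs : ∀ m : Idx, f m.swap = conj (f m)) (x : Torus) :
    conj (syn (mode k₁ k₂) f x) = syn (mode k₁ k₂) f x := by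
  have h1 := (hasSum_syn_apply (mode k₁ k₂) hf x).map (starRingEnd ℂ) Complex.continuous_conj
  have h2 := (Equiv.prodComm (ℕ × ℕ) (ℕ × ℕ)).hasSum_iff.2 (hasSum_syn_apply (mode k₁ k₂) hf x)
  refine h1.unique (h2.congr_fun fun m => ?_)
  simp only [Function.comp_apply, Equiv.prodComm_apply, hs, mode_swap, map_mul, fourier_neg]

theorem ofReal_reSyn {ι : Type*} {μ : ι → ℤ} {f : ι → ℂ}
    (hreal : ∀ x, conj (syn μ f x) = syn μ f x) (x : Torus) :
    ((reSyn μ f x : ℝ) : ℂ) = syn μ f x :=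
  Complex.conj_eq_iff_re.1 (hreal x)

theorem coeff_reSyn_of_real {ι : Type*} {μ : ι → ℤ} {f : ι → ℂ}
    (hreal : ∀ x, conj (syn μ f x) = syn μ f x) (n : ℤ) :
    coeff (reSyn μ f) n = fc n (syn μ f) := by
  rw [coeff, fc_apply]
  congr 1
  funext x
  exact ofReal_reSyn hreal x

theorem isSolution_of_fc {s c κ T : ℝ} {u : Zygmund s} {ι : Type*} {μ : ι → ℤ} {f : ι → ℂ}
    (hreal : ∀ x, conj (syn μ f x) = syn μ f x) (hu : u.toCont = reSyn μ f)
    (h : ∀ n : ℤ, fc n (syn μ f * syn μ f) =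
      ((c - symbol T (κ * n) : ℝ) : ℂ) * fc n (syn μ f)) :
    IsSolution u c κ T := by
  refine ⟨c • u.toCont - u.toCont * u.toCont, fun n => ?_, fun x => ?_⟩
  · have h1 : (fun x : Torus => (((c • u.toCont - u.toCont * u.toCont) x : ℝ) : ℂ)) =
        ((c : ℂ) • syn μ f - syn μ f * syn μ f : C(Torus, ℂ)) := by
      funext x
      rw [hu]
      simp only [ContinuousMap.sub_apply, ContinuousMap.smul_apply, ContinuousMap.mul_apply,
        smul_eq_mul, Complex.ofReal_sub, Complex.ofReal_mul, ofReal_reSyn hreal]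
    rw [coeff, h1, ← fc_apply, map_sub, map_smul, h, hu, coeff_reSyn_of_real hreal, smul_eq_mul]
    push_cast
    ring
  · simp only [ContinuousMap.sub_apply, ContinuousMap.smul_apply, ContinuousMap.mul_apply,
      smul_eq_mul]
    ring

/-- The square of a power series without constant term. -/
theorem hasSum_fc_sq {k₁ k₂ : ℕ} {f : Idx → ℂ} (hf : Summable fun m => ‖f m‖) (h0 : f 0 = 0)
    (n : ℤ) : HasSum (fun m => if mode k₁ k₂ m = n then ∑ p ∈ splits m, f p.1 * f p.2 else 0)
      (fc n (syn (mode k₁ k₂) f * syn (mode k₁ k₂) f)) := by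
  let G : Idx → C(Torus, ℂ) := fun m => f m • fourier (mode k₁ k₂ m)
  have hG : Summable fun m => ‖G m‖ := summable_norm_syn hf
  have h1 : HasSum (fun p : Idx × Idx => G p.1 * G p.2)
      (syn (mode k₁ k₂) f * syn (mode k₁ k₂) f) := by
    have h2 := (summable_mul_of_summable_norm hG hG).hasSum
    rwa [← tsum_mul_tsum_of_summable_norm hG hG] at h2
  have h3 := (Finset.HasAntidiagonal.sigmaAntidiagonalEquivProd (A := Idx)).hasSum_iff.2 h1
  have h4 := h3.sigma fun m => Finset.hasSum (Finset.HasAntidiagonal.antidiagonal m)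
    fun p => G p.1 * G p.2
  refine ((fc n).hasSum h4).congr_fun fun m => ?_
  rw [map_sum]
  have h5 : ∀ p ∈ Finset.HasAntidiagonal.antidiagonal m, fc n (G p.1 * G p.2) =
      if mode k₁ k₂ m = n then f p.1 * f p.2 else 0 := by
    intro p hp
    rw [Finset.HasAntidiagonal.mem_antidiagonal] at hp
    have h6 : G p.1 * G p.2 = (f p.1 * f p.2) • fourier (mode k₁ k₂ m) := by
      ext x
      simp only [G, ContinuousMap.mul_apply, ContinuousMap.smul_apply, smul_eq_mul]
      rw [← hp, mode_add, fourier_add]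
      ring
    rw [h6, map_smul, fc_fourier, smul_eq_mul]
    split_ifs <;> simp
  rw [Finset.sum_congr rfl h5]
  split_ifs with h
  -- The pairs missing from `splits` have a zero component and contribute nothing, because `f 0 =
  -- 0`.
  · refine (Finset.sum_subset (splits_subset m) fun p hp hp' => ?_)
    rw [Finset.HasAntidiagonal.mem_antidiagonal] at hp
    by_contra hne
    exact hp' (mem_splits.2 ⟨hp, fun h7 => hne (by rw [h7, h0, zero_mul]),
      fun h7 => hne (by rw [h7, h0, mul_zero])⟩)
  · simp

/-! ## Sums over one mode -/

/-- The sum of the products of a summable and a bounded family. -/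
def pairing : L1 Idx ℝ →L[ℝ] (Idx →ᵇ ℝ) →L[ℝ] ℝ :=
  (ContinuousLinearMap.compL ℝ (Idx →ᵇ ℝ) (L1 Idx ℝ) ℝ (lp.tsumCLM (α := Idx) (𝕜 := ℝ) (E := ℝ))).comp (mulL Idx ℝ)

theorem hasSum_pairing (a : L1 Idx ℝ) (h : Idx →ᵇ ℝ) :
    HasSum (fun m => a m * h m) (pairing a h) := by
  have h1 : Summable fun m => a m * h m := Summable.of_norm (summable_norm_smul a h)
  have h2 : pairing a h = ∑' m, a m * h m := rfl
  rw [h2]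
  exact h1.hasSum

theorem abs_pairing_le (a : L1 Idx ℝ) (h : Idx →ᵇ ℝ) : |pairing a h| ≤ ‖a‖ * ‖h‖ := by
  rw [← (hasSum_pairing a h).tsum_eq, ← Real.norm_eq_abs]
  have h1 := summable_norm_smul a h
  calc ‖∑' m, a m * h m‖ ≤ ∑' m, ‖a m * h m‖ := norm_tsum_le_tsum_norm h1
    _ = ‖mulL Idx ℝ a h‖ := by
      rw [L1.norm_eq]
      rfl
    _ ≤ _ := norm_mulL_le a h

/-- The family `x₁ ^ N₁ * x₂ ^ N₂ * P_{N₃}(x₁, x₃)` with the Chebyshev sequence `P`. -/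
def chebMono (N : Idx → ℕ × ℕ × ℕ) (a : ℝ) (y : ℝ × ℝ × ℝ) : Idx →ᵇ ℝ :=
  pull ℝ (fun m => (N m).1) (geo y.1) * pull ℝ (fun m => (N m).2.1) (geo y.2.1) *
    pull ℝ (fun m => (N m).2.2) (cheb a (y.1, y.2.2))

theorem analyticAt_chebMono (N : Idx → ℕ × ℕ × ℕ) {a : ℝ} (ha : |a| ≤ 2) :
    AnalyticAt ℝ (chebMono N a) 0 := by
  have h1 : AnalyticAt ℝ (fun y : ℝ × ℝ × ℝ => geo y.1) 0 :=
    AnalyticAt.fun_comp (f := fun y : ℝ × ℝ × ℝ => y.1) (analyticAt_geo (by simp)) (by fun_prop)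
  have h2 : AnalyticAt ℝ (fun y : ℝ × ℝ × ℝ => geo y.2.1) 0 :=
    AnalyticAt.fun_comp (f := fun y : ℝ × ℝ × ℝ => y.2.1) (analyticAt_geo (by simp)) (by fun_prop)
  have h3 : AnalyticAt ℝ (fun y : ℝ × ℝ × ℝ => cheb a (y.1, y.2.2)) 0 :=
    AnalyticAt.fun_comp (f := fun y : ℝ × ℝ × ℝ => (y.1, y.2.2)) (analyticAt_cheb ha)
      (by fun_prop)
  exact ((analyticAt_lin _ h1).mul (analyticAt_lin _ h2)).mul (analyticAt_lin _ h3)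

theorem abs_le_of_norm {y : ℝ × ℝ × ℝ} {X : ℝ} (h : 3 * ‖y‖ ≤ X) :
    3 * |y.1| ≤ X ∧ 3 * |y.2.1| ≤ X ∧ 3 * |y.2.2| ≤ X := by
  have h1 : |y.1| ≤ ‖y‖ := norm_fst_le y
  have h2 : ‖y.2‖ ≤ ‖y‖ := norm_snd_le y
  have h3 : |y.2.1| ≤ ‖y.2‖ := norm_fst_le y.2
  have h4 : |y.2.2| ≤ ‖y.2‖ := norm_snd_le y.2
  refine ⟨?_, ?_, ?_⟩ <;> linarith

theorem chebMono_apply {N : Idx → ℕ × ℕ × ℕ} {a : ℝ} (ha : |a| ≤ 2) {y : ℝ × ℝ × ℝ}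
    (hy : 3 * ‖y‖ ≤ 1) (m : Idx) : chebMono N a y m =
      y.1 ^ (N m).1 * y.2.1 ^ (N m).2.1 * chebSeq y.1 y.2.2 (a * y.2.2) (N m).2.2 := by
  obtain ⟨h1, h2, h3⟩ := abs_le_of_norm hy
  have e1 : ‖y.1‖ ≤ 1 := by
    rw [Real.norm_eq_abs]
    linarith [abs_nonneg y.1]
  have e2 : ‖y.2.1‖ ≤ 1 := by
    rw [Real.norm_eq_abs]
    linarith [abs_nonneg y.2.1]
  simp only [chebMono, BoundedContinuousFunction.mul_apply, pull_apply]
  rw [geo_apply e1, geo_apply e2, cheb_apply ha h1 h3]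

theorem abs_chebMono_le {N : Idx → ℕ × ℕ × ℕ} {a : ℝ} (ha : |a| ≤ 2) {y : ℝ × ℝ × ℝ}
    (hy : 3 * ‖y‖ ≤ 1) (m : Idx) :
    |chebMono N a y m| ≤ (3 * ‖y‖) ^ ((N m).1 + (N m).2.1 + (N m).2.2) := by
  obtain ⟨h1, h2, h3⟩ := abs_le_of_norm (y := y) le_rfl
  rw [chebMono_apply ha hy, abs_mul, abs_mul, abs_pow, abs_pow, pow_add, pow_add]
  have h4 : |a * y.2.2| ≤ 2 * |y.2.2| := by
    rw [abs_mul]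
    gcongr
  gcongr
  · linarith [abs_nonneg y.1]
  · linarith [abs_nonneg y.2.1]
  · exact abs_chebSeq_le h1 h3 h4 _

/-- The sum of a family against a masked family of monomials. -/
def modeSum (w : Idx →ᵇ ℝ) (N : Idx → ℕ × ℕ × ℕ) (a : ℝ) (V : L1 Idx ℝ) (y : ℝ × ℝ × ℝ) : ℝ :=
  pairing V (w * chebMono N a y)

theorem hasSum_modeSum (w : Idx →ᵇ ℝ) (N : Idx → ℕ × ℕ × ℕ) (a : ℝ) (V : L1 Idx ℝ)
    (y : ℝ × ℝ × ℝ) : HasSum (fun m => V m * (w m * chebMono N a y m)) (modeSum w N a V y) :=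
  hasSum_pairing _ _

theorem analyticAt_modeSum (w : Idx →ᵇ ℝ) (N : Idx → ℕ × ℕ × ℕ) {a : ℝ} (ha : |a| ≤ 2)
    {P : Type*} [NormedAddCommGroup P] [NormedSpace ℝ P] {V : P → L1 Idx ℝ} {p : P}
    (hV : AnalyticAt ℝ V p) :
    AnalyticAt ℝ (fun z : P × (ℝ × ℝ × ℝ) => modeSum w N a (V z.1) z.2) (p, 0) := by
  have h1 : AnalyticAt ℝ (fun z : P × (ℝ × ℝ × ℝ) => V z.1) (p, 0) :=
    AnalyticAt.fun_comp (f := fun z : P × (ℝ × ℝ × ℝ) => z.1) hV (by fun_prop)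
  have h2 : AnalyticAt ℝ (fun z : P × (ℝ × ℝ × ℝ) => chebMono N a z.2) (p, 0) :=
    AnalyticAt.fun_comp (f := fun z : P × (ℝ × ℝ × ℝ) => z.2) (analyticAt_chebMono N ha)
      (by fun_prop)
  exact analyticAt_bilin pairing h1 (analyticAt_const.mul h2)

/-- Each monomial is at most `(3‖y‖)` to its total degree. If all unmasked monomials have degree at
least two, the sum is quadratically small. -/
theorem abs_modeSum_le {w : Idx →ᵇ ℝ} {N : Idx → ℕ × ℕ × ℕ} {a : ℝ} (ha : |a| ≤ 2)
    (hw1 : ∀ m, |w m| ≤ 1) (hw : ∀ m, w m ≠ 0 → 2 ≤ (N m).1 + (N m).2.1 + (N m).2.2)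
    (V : L1 Idx ℝ) {y : ℝ × ℝ × ℝ} (hy : 3 * ‖y‖ ≤ 1) :
    |modeSum w N a V y| ≤ ‖V‖ * (3 * ‖y‖) ^ 2 := by
  refine (abs_pairing_le _ _).trans (mul_le_mul_of_nonneg_left ?_ (norm_nonneg _))
  refine (BoundedContinuousFunction.norm_le (by positivity)).2 fun m => ?_
  rw [BoundedContinuousFunction.mul_apply, norm_mul, Real.norm_eq_abs, Real.norm_eq_abs]
  by_cases h : w m = 0
  · rw [h, abs_zero, zero_mul]
    positivity
  · calc |w m| * |chebMono N a y m| ≤ 1 * (3 * ‖y‖) ^ ((N m).1 + (N m).2.1 + (N m).2.2) := by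
          gcongr
          · exact hw1 m
          · exact abs_chebMono_le ha hy m
      _ ≤ _ := by
          rw [one_mul]
          exact pow_le_pow_of_le_one (by positivity) hy (hw m h)

/-! ## Multi-indices with a given mode -/

theorem eq_of_mul_sub_eq {k₁ k₂ : ℕ} (hk₁ : 2 ≤ k₁) (hcop : Nat.Coprime k₁ k₂) {a b : ℤ}
    (h : k₁ * a + k₂ * b = 0) : ∃ j : ℤ, a = k₂ * j ∧ b = -(k₁ * j) := by
  have h1 : (k₁ : ℤ) ∣ k₂ * b := ⟨-a, by linear_combination h⟩
  have hc : IsCoprime (k₁ : ℤ) k₂ := Nat.isCoprime_iff_coprime.2 hcop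
  obtain ⟨j, hj⟩ := hc.dvd_of_dvd_mul_left h1
  have hk : (k₁ : ℤ) ≠ 0 := by omega
  refine ⟨-j, ?_, by rw [hj]; ring⟩
  apply mul_left_cancel₀ hk
  rw [hj] at h
  linear_combination h

theorem eq_zero_or_succ (j : ℤ) : j = 0 ∨ ∃ n : ℕ, j = (n : ℤ) + 1 ∨ j = -((n : ℤ) + 1) := by
  by_cases h : j = 0
  · exact Or.inl h
  · exact Or.inr ⟨j.natAbs - 1, by omega⟩

/-- By coprimality `α - β` is `(1, 0)` plus a multiple `j` of `(k₂, -k₁)`; the cases are `j = 0`, `j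
= n + 1` and `j = -(n + 1)`. The products `P = k₂n` and `Q = k₁n` are recorded with linear bounds so
that the exponent comparisons below become linear arithmetic. -/
theorem mode_eq_fst_cases {k₁ k₂ : ℕ} (hk₁ : 2 ≤ k₁) (hk : k₁ < k₂) (hcop : Nat.Coprime k₁ k₂)
    {m : Idx} (h : mode k₁ k₂ m = k₁) :
    (m.1.1 = m.2.1 + 1 ∧ m.1.2 = m.2.2) ∨ ∃ n P Q : ℕ, P = k₂ * n ∧ Q = k₁ * n ∧ 3 * n ≤ P ∧
      2 * n ≤ Q ∧ ((m.1.1 = m.2.1 + 1 + P + k₂ ∧ m.2.2 = m.1.2 + Q + k₁) ∨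
        (m.2.1 + 1 = m.1.1 + P + k₂ ∧ m.1.2 = m.2.2 + Q + k₁)) := by
  obtain ⟨⟨a, b⟩, ⟨c, d⟩⟩ := m
  simp only [mode] at h ⊢
  obtain ⟨j, h1, h2⟩ := eq_of_mul_sub_eq hk₁ hcop (a := (a : ℤ) - c - 1) (b := (b : ℤ) - d)
    (by linear_combination h)
  rcases eq_zero_or_succ j with rfl | ⟨n, hn⟩
  · left
    omega
  · right
    refine ⟨n, k₂ * n, k₁ * n, rfl, rfl, Nat.mul_le_mul_right n (by omega),
      Nat.mul_le_mul_right n hk₁, ?_⟩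
    generalize hP : k₂ * n = P
    generalize hQ : k₁ * n = Q
    have hP' : (k₂ : ℤ) * n = P := by exact_mod_cast hP
    have hQ' : (k₁ : ℤ) * n = Q := by exact_mod_cast hQ
    rcases hn with rfl | rfl
    · left
      rw [mul_add, hP'] at h1
      rw [mul_add, hQ'] at h2
      omega
    · right
      rw [mul_neg, mul_add, hP'] at h1
      rw [mul_neg, mul_add, hQ'] at h2
      omega

theorem mode_eq_snd_cases {k₁ k₂ : ℕ} (hk₁ : 2 ≤ k₁) (hk : k₁ < k₂) (hcop : Nat.Coprime k₁ k₂)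
    {m : Idx} (h : mode k₁ k₂ m = k₂) :
    (m.1.1 = m.2.1 ∧ m.1.2 = m.2.2 + 1) ∨ ∃ n P Q : ℕ, P = k₂ * n ∧ Q = k₁ * n ∧ 3 * n ≤ P ∧
      2 * n ≤ Q ∧ ((m.1.1 = m.2.1 + P + k₂ ∧ m.2.2 + 1 = m.1.2 + Q + k₁) ∨
        (m.2.1 = m.1.1 + P + k₂ ∧ m.1.2 = m.2.2 + 1 + Q + k₁)) := by
  obtain ⟨⟨a, b⟩, ⟨c, d⟩⟩ := m
  simp only [mode] at h ⊢
  obtain ⟨j, h1, h2⟩ := eq_of_mul_sub_eq hk₁ hcop (a := (a : ℤ) - c) (b := (b : ℤ) - d - 1)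
    (by linear_combination h)
  rcases eq_zero_or_succ j with rfl | ⟨n, hn⟩
  · left
    omega
  · right
    refine ⟨n, k₂ * n, k₁ * n, rfl, rfl, Nat.mul_le_mul_right n (by omega),
      Nat.mul_le_mul_right n hk₁, ?_⟩
    generalize hP : k₂ * n = P
    generalize hQ : k₁ * n = Q
    have hP' : (k₂ : ℤ) * n = P := by exact_mod_cast hP
    have hQ' : (k₁ : ℤ) * n = Q := by exact_mod_cast hQ
    rcases hn with rfl | rfl
    · left
      rw [mul_add, hP'] at h1
      rw [mul_add, hQ'] at h2
      omega
    · right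
      rw [mul_neg, mul_add, hP'] at h1
      rw [mul_neg, mul_add, hQ'] at h2
      omega

/-! ## Monomials -/

/-- The family of monomials `z ^ α * conj z ^ β`. -/
def mono (z : ℂ × ℂ) : Idx →ᵇ ℂ :=
  pull ℂ (fun m : Idx => m.1.1) (geo z.1) * pull ℂ (fun m : Idx => m.1.2) (geo z.2) *
    (pull ℂ (fun m : Idx => m.2.1) (geo (conj z.1)) *
      pull ℂ (fun m : Idx => m.2.2) (geo (conj z.2)))

theorem mono_apply {z : ℂ × ℂ} (h1 : ‖z.1‖ ≤ 1) (h2 : ‖z.2‖ ≤ 1) (m : Idx) : mono z m =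
    z.1 ^ m.1.1 * z.2 ^ m.1.2 * (conj z.1 ^ m.2.1 * conj z.2 ^ m.2.2) := by
  simp only [mono, BoundedContinuousFunction.mul_apply, pull_apply]
  rw [geo_apply h1, geo_apply h2, geo_apply (by simpa using h1), geo_apply (by simpa using h2)]

theorem mono_swap {z : ℂ × ℂ} (h1 : ‖z.1‖ ≤ 1) (h2 : ‖z.2‖ ≤ 1) (m : Idx) :
    mono z m.swap = conj (mono z m) := by
  rw [mono_apply h1 h2, mono_apply h1 h2]
  simp only [Prod.fst_swap, Prod.snd_swap, map_mul, map_pow, Complex.conj_conj]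
  ring

theorem mono_add {z : ℂ × ℂ} (h1 : ‖z.1‖ ≤ 1) (h2 : ‖z.2‖ ≤ 1) (m p : Idx) :
    mono z (m + p) = mono z m * mono z p := by
  rw [mono_apply h1 h2, mono_apply h1 h2, mono_apply h1 h2]
  simp only [Prod.fst_add, Prod.snd_add, pow_add]
  ring

theorem norm_mono_le {z : ℂ × ℂ} {R : ℝ} (hR : R ≤ 1) (h1 : ‖z.1‖ ≤ R) (h2 : ‖z.2‖ ≤ R)
    (m : Idx) : ‖mono z m‖ ≤ R ^ order m := by
  rw [mono_apply (h1.trans hR) (h2.trans hR), norm_mul, norm_mul, norm_mul, norm_pow, norm_pow,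
    norm_pow, norm_pow, RCLike.norm_conj, RCLike.norm_conj, order, pow_add, pow_add, pow_add]
  have hR0 : 0 ≤ R := (norm_nonneg _).trans h1
  gcongr

theorem analyticAt_geo_real {E : Type*} [NormedAddCommGroup E] [NormedSpace ℝ E] {f : E → ℂ}
    {x : E} (hf : AnalyticAt ℝ f x) (h : ‖f x‖ < 1) : AnalyticAt ℝ (fun x => geo (f x)) x :=
  AnalyticAt.fun_comp (f := f) ((analyticAt_geo h).restrictScalars (𝕜 := ℝ)) hf

theorem analyticAt_mono {E : Type*} [NormedAddCommGroup E] [NormedSpace ℝ E] {z : E → ℂ × ℂ}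
    {x : E} (hz1 : AnalyticAt ℝ (fun x => (z x).1) x) (hz2 : AnalyticAt ℝ (fun x => (z x).2) x)
    (h1 : ‖(z x).1‖ < 1) (h2 : ‖(z x).2‖ < 1) : AnalyticAt ℝ (fun x => mono (z x)) x := by
  have c1 : AnalyticAt ℝ (fun x => conj (z x).1) x :=
    analyticAt_lin (Complex.conjCLE : ℂ →L[ℝ] ℂ) hz1
  have c2 : AnalyticAt ℝ (fun x => conj (z x).2) x :=
    analyticAt_lin (Complex.conjCLE : ℂ →L[ℝ] ℂ) hz2
  have l : ∀ {g : E → ℕ →ᵇ ℂ} (N : Idx → ℕ), AnalyticAt ℝ g x →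
      AnalyticAt ℝ (fun x => pull ℂ N (g x)) x := fun N hg =>
    analyticAt_lin ((pull ℂ N).restrictScalars ℝ) hg
  exact ((l _ (analyticAt_geo_real hz1 h1)).mul (l _ (analyticAt_geo_real hz2 h2))).mul
    ((l _ (analyticAt_geo_real c1 (by simpa using h1))).mul
      (l _ (analyticAt_geo_real c2 (by simpa using h2))))

/-- The amplitude-phase pair `(ρ₁ e^{i φ₁}, ρ₂ e^{i φ₂})`. -/
def polar (ρ φ : ℝ × ℝ) : ℂ × ℂ :=
  ((ρ.1 : ℂ) * Complex.exp (φ.1 * Complex.I), (ρ.2 : ℂ) * Complex.exp (φ.2 * Complex.I))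

theorem norm_polar_fst (ρ φ : ℝ × ℝ) : ‖(polar ρ φ).1‖ = |ρ.1| := by
  simp [polar, Complex.norm_exp_ofReal_mul_I]

theorem norm_polar_snd (ρ φ : ℝ × ℝ) : ‖(polar ρ φ).2‖ = |ρ.2| := by
  simp [polar, Complex.norm_exp_ofReal_mul_I]

theorem pow_mul_conj_pow (ρ φ : ℝ) (a b : ℕ) :
    ((ρ : ℂ) * Complex.exp (φ * Complex.I)) ^ a *
      conj ((ρ : ℂ) * Complex.exp (φ * Complex.I)) ^ b =
      (ρ : ℂ) ^ (a + b) * Complex.exp (((a : ℝ) - b) * φ * Complex.I) := by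
  have h1 : conj (Complex.exp (φ * Complex.I)) = Complex.exp (-(φ * Complex.I)) := by
    rw [← Complex.exp_conj]
    simp
  rw [map_mul, h1, Complex.conj_ofReal, mul_pow, mul_pow, ← Complex.exp_nat_mul,
    ← Complex.exp_nat_mul, pow_add]
  have h2 : (((a : ℝ) : ℂ) - (b : ℂ)) * φ * Complex.I =
      a * (φ * Complex.I) + b * -(φ * Complex.I) := by
    push_cast
    ring
  rw [h2, Complex.exp_add]
  ring

theorem mono_polar {ρ φ : ℝ × ℝ} (h1 : |ρ.1| ≤ 1) (h2 : |ρ.2| ≤ 1) (m : Idx) :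
    mono (polar ρ φ) m = (ρ.1 ^ (m.1.1 + m.2.1) * ρ.2 ^ (m.1.2 + m.2.2) : ℝ) *
      Complex.exp ((((m.1.1 : ℝ) - m.2.1) * φ.1 + ((m.1.2 : ℝ) - m.2.2) * φ.2 : ℝ) *
        Complex.I) := by
  rw [mono_apply (by rwa [norm_polar_fst]) (by rwa [norm_polar_snd])]
  have e1 := pow_mul_conj_pow ρ.1 φ.1 m.1.1 m.2.1
  have e2 := pow_mul_conj_pow ρ.2 φ.2 m.1.2 m.2.2
  rw [mul_mul_mul_comm]
  simp only [polar]
  rw [e1, e2]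
  push_cast
  rw [add_mul, Complex.exp_add]
  ring

/-! ## The reduced equations -/

/-- The exponents in the real part of the equation in the mode `k₁`. -/
def expFst (k₁ : ℕ) (m : Idx) : ℕ × ℕ × ℕ :=
  (m.1.1 + m.2.1 - 1 - ((m.1.2 : ℤ) - m.2.2).natAbs / k₁, m.1.2 + m.2.2,
    ((m.1.2 : ℤ) - m.2.2).natAbs / k₁)

/-- The exponents in the real part of the equation in the mode `k₂`. -/
def expSnd (k₂ : ℕ) (m : Idx) : ℕ × ℕ × ℕ :=
  (m.1.1 + m.2.1 - ((m.1.1 : ℤ) - m.2.1).natAbs / k₂, m.1.2 + m.2.2 - 1,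
    ((m.1.1 : ℤ) - m.2.1).natAbs / k₂)

/-- The exponents in the imaginary part of the equation in the mode `k₁`. -/
def expIm (k₁ k₂ : ℕ) (m : Idx) : ℕ × ℕ × ℕ :=
  (m.1.1 + m.2.1 - (k₂ - 1) - (((m.1.2 : ℤ) - m.2.2).natAbs / k₁ - 1), m.1.2 + m.2.2 - k₁,
    ((m.1.2 : ℤ) - m.2.2).natAbs / k₁ - 1)

/-- The sign of `β₂ - α₂`. -/
def sgn (m : Idx) : ℝ := if m.1.2 < m.2.2 then 1 else if m.2.2 < m.1.2 then -1 else 0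

/-- The variables of the reduced equations. -/
def redVar (ρ : ℝ × ℝ) (ψ : ℝ) : ℝ × ℝ × ℝ := (ρ.1, ρ.2, ρ.1 * Real.cos ψ)

theorem norm_redVar_le (ρ : ℝ × ℝ) (ψ : ℝ) : ‖redVar ρ ψ‖ ≤ ‖ρ‖ := by
  have h1 : |ρ.1| ≤ ‖ρ‖ := norm_fst_le ρ
  have h2 : |ρ.2| ≤ ‖ρ‖ := norm_snd_le ρ
  refine norm_prod_le_iff.2 ⟨h1, norm_prod_le_iff.2 ⟨h2, ?_⟩⟩
  change |ρ.1 * Real.cos ψ| ≤ ‖ρ‖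
  rw [abs_mul]
  exact (mul_le_of_le_one_right (abs_nonneg _) (Real.abs_cos_le_one ψ)).trans h1

theorem chebMono_redVar_fst (N : Idx → ℕ × ℕ × ℕ) {ρ : ℝ × ℝ} (hρ : 3 * ‖ρ‖ ≤ 1) (ψ : ℝ) (m : Idx) :
    chebMono N 1 (redVar ρ ψ) m = ρ.1 ^ (N m).1 * ρ.2 ^ (N m).2.1 *
      (ρ.1 ^ (N m).2.2 * Real.cos ((N m).2.2 * ψ)) := by
  rw [chebMono_apply (by norm_num) (by linarith [norm_redVar_le ρ ψ]), redVar, chebSeq_eq_cos]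

theorem chebMono_redVar_snd (N : Idx → ℕ × ℕ × ℕ) {ρ : ℝ × ℝ} (hρ : 3 * ‖ρ‖ ≤ 1) (ψ : ℝ) (m : Idx) :
    chebMono N 2 (redVar ρ ψ) m * Real.sin ψ = ρ.1 ^ (N m).1 * ρ.2 ^ (N m).2.1 *
      (ρ.1 ^ (N m).2.2 * Real.sin (((N m).2.2 + 1) * ψ)) := by
  rw [chebMono_apply (by norm_num) (by linarith [norm_redVar_le ρ ψ]), redVar, mul_assoc,
    chebSeq_mul_sin]

section terms

variable {k₁ k₂ : ℕ} {m : Idx}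

/-- Relative to `φ₁` the angle of the monomial is `± Jψ` with `J = |α₂ - β₂| / k₁`. Its modulus
contains at least `J + 1` powers of `ρ₁`: one is factored out, and `J` of them combine with
`cos(Jψ)` into a Chebyshev polynomial in `ρ₁` and `ρ₁ cos ψ`. -/
theorem cos_term_fst (hk₁ : 2 ≤ k₁) (hk : k₁ < k₂) (hcop : Nat.Coprime k₁ k₂)
    (h : mode k₁ k₂ m = k₁) {ρ : ℝ × ℝ} (hρ : 3 * ‖ρ‖ ≤ 1) (φ : ℝ × ℝ) :
    ρ.1 ^ (m.1.1 + m.2.1) * ρ.2 ^ (m.1.2 + m.2.2) *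
        Real.cos (((m.1.1 : ℝ) - m.2.1) * φ.1 + ((m.1.2 : ℝ) - m.2.2) * φ.2 - φ.1) =
      ρ.1 * chebMono (expFst k₁) 1 (redVar ρ (k₂ * φ.1 - k₁ * φ.2)) m := by
  rw [chebMono_redVar_fst _ hρ]
  obtain ⟨⟨a, b⟩, ⟨c, d⟩⟩ := m
  rcases mode_eq_fst_cases hk₁ hk hcop h with ⟨h1, h2⟩ | ⟨n, P, Q, hP, hQ, hP3, hQ2, h3⟩
  · simp only at h1 h2
    subst h1 h2
    simp only [expFst, sub_self, Int.natAbs_zero, Nat.zero_div, Nat.cast_zero, zero_mul,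
      Real.cos_zero, pow_zero, mul_one]
    have e1 : c + 1 + c = (c + 1 + c - 1 - 0) + 1 := by omega
    have e2 : ((c + 1 : ℕ) - c : ℝ) * φ.1 + 0 - φ.1 = 0 := by
      push_cast
      ring
    rw [e2, Real.cos_zero]
    conv_lhs => rw [e1]
    ring
  · simp only at h3
    have hJ : (Q + k₁) / k₁ = n + 1 := by
      rw [hQ, ← Nat.mul_succ, Nat.mul_div_cancel_left _ (by omega)]
    have hPr : (P : ℝ) = k₂ * n := by exact_mod_cast hP
    have hQr : (Q : ℝ) = k₁ * n := by exact_mod_cast hQ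
    rcases h3 with ⟨h1, h2⟩ | ⟨h1, h2⟩
    · have hN : ((b : ℤ) - d).natAbs = Q + k₁ := by omega
      simp only [expFst, hN, hJ]
      obtain ⟨A, hA⟩ : ∃ A, a + c = A + 1 + (n + 1) := ⟨a + c - 1 - (n + 1), by omega⟩
      have e1 : a + c - 1 - (n + 1) = A := by omega
      have e2 : ((a : ℝ) - c) * φ.1 + ((b : ℝ) - d) * φ.2 - φ.1 =
          ((n + 1 : ℕ) : ℝ) * (k₂ * φ.1 - k₁ * φ.2) := by
        rw [h1, h2]
        push_cast
        rw [hPr, hQr]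
        ring
      rw [e1, e2, hA]
      ring
    · have hN : ((b : ℤ) - d).natAbs = Q + k₁ := by omega
      simp only [expFst, hN, hJ]
      obtain ⟨A, hA⟩ : ∃ A, a + c = A + 1 + (n + 1) := ⟨a + c - 1 - (n + 1), by omega⟩
      have e1 : a + c - 1 - (n + 1) = A := by omega
      have h1' : (c : ℝ) + 1 = a + P + k₂ := by exact_mod_cast h1
      have e2 : ((a : ℝ) - c) * φ.1 + ((b : ℝ) - d) * φ.2 - φ.1 =
          -(((n + 1 : ℕ) : ℝ) * (k₂ * φ.1 - k₁ * φ.2)) := by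
        rw [h2]
        push_cast
        rw [hQr]
        rw [hPr] at h1'
        linear_combination (-φ.1) * h1'
      rw [e1, e2, Real.cos_neg, hA]
      ring

/-- Only `J ≥ 1` contributes, and then the monomial contains `ρ₁^{k₂-1} ρ₂^{k₁}`. After this factor
enough powers of `ρ₁` remain for the quotient of `sin(Jψ)` by `sin ψ`, of Chebyshev degree `J - 1`;
`sgn` records the sign of the angle. -/
theorem sin_term_fst (hk₁ : 2 ≤ k₁) (hk : k₁ < k₂) (hcop : Nat.Coprime k₁ k₂)
    (h : mode k₁ k₂ m = k₁) {ρ : ℝ × ℝ} (hρ : 3 * ‖ρ‖ ≤ 1) (φ : ℝ × ℝ) :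
    ρ.1 ^ (m.1.1 + m.2.1) * ρ.2 ^ (m.1.2 + m.2.2) *
        Real.sin (((m.1.1 : ℝ) - m.2.1) * φ.1 + ((m.1.2 : ℝ) - m.2.2) * φ.2 - φ.1) =
      ρ.1 ^ (k₂ - 1) * ρ.2 ^ k₁ * Real.sin (k₂ * φ.1 - k₁ * φ.2) *
        (sgn m * chebMono (expIm k₁ k₂) 2 (redVar ρ (k₂ * φ.1 - k₁ * φ.2)) m) := by
  have hc := chebMono_redVar_snd (expIm k₁ k₂) hρ (k₂ * φ.1 - k₁ * φ.2) m
  rw [show ∀ x y z w v : ℝ, x * y * z * (w * v) = x * y * (w * (v * z)) by intros; ring, hc]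
  obtain ⟨⟨a, b⟩, ⟨c, d⟩⟩ := m
  rcases mode_eq_fst_cases hk₁ hk hcop h with ⟨h1, h2⟩ | ⟨n, P, Q, hP, hQ, hP3, hQ2, h3⟩
  · simp only at h1 h2
    subst h1 h2
    simp [sgn]
  · simp only at h3
    have hJ : (Q + k₁) / k₁ = n + 1 := by
      rw [hQ, ← Nat.mul_succ, Nat.mul_div_cancel_left _ (by omega)]
    have hPr : (P : ℝ) = k₂ * n := by exact_mod_cast hP
    have hQr : (Q : ℝ) = k₁ * n := by exact_mod_cast hQ
    have hN : ((b : ℤ) - d).natAbs = Q + k₁ := by omega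
    simp only [expIm, hN, hJ]
    obtain ⟨A, hA⟩ : ∃ A, a + c = (k₂ - 1) + A + n := ⟨a + c - (k₂ - 1) - n, by omega⟩
    obtain ⟨B, hB⟩ : ∃ B, b + d = k₁ + B := ⟨b + d - k₁, by omega⟩
    have e1 : a + c - (k₂ - 1) - (n + 1 - 1) = A := by omega
    have e3 : b + d - k₁ = B := by omega
    have e4 : n + 1 - 1 = n := by omega
    rw [e1, e3, e4, hA, hB]
    rcases h3 with ⟨h1, h2⟩ | ⟨h1, h2⟩
    · have e2 : ((a : ℝ) - c) * φ.1 + ((b : ℝ) - d) * φ.2 - φ.1 =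
          ((n : ℝ) + 1) * (k₂ * φ.1 - k₁ * φ.2) := by
        rw [h1, h2]
        push_cast
        rw [hPr, hQr]
        ring
      have e5 : sgn ((a, b), (c, d)) = 1 := by
        rw [sgn, if_pos (by simp only; omega)]
      rw [e2, e5]
      ring
    · have h1' : (c : ℝ) + 1 = a + P + k₂ := by exact_mod_cast h1
      have e2 : ((a : ℝ) - c) * φ.1 + ((b : ℝ) - d) * φ.2 - φ.1 =
          -(((n : ℝ) + 1) * (k₂ * φ.1 - k₁ * φ.2)) := by
        rw [h2]
        push_cast
        rw [hQr]
        rw [hPr] at h1'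
        linear_combination (-φ.1) * h1'
      have e5 : sgn ((a, b), (c, d)) = -1 := by
        rw [sgn, if_neg (by simp only; omega), if_pos (by simp only; omega)]
      rw [e2, e5, Real.sin_neg]
      ring

/-- In the mode `k₂` a factor `ρ₂` is removed by lowering its exponent, and `J = |α₁ - β₁| / k₂`
powers of `ρ₁` feed the Chebyshev polynomial. -/
theorem cos_term_snd (hk₁ : 2 ≤ k₁) (hk : k₁ < k₂) (hcop : Nat.Coprime k₁ k₂)
    (h : mode k₁ k₂ m = k₂) {ρ : ℝ × ℝ} (hρ : 3 * ‖ρ‖ ≤ 1) (φ : ℝ × ℝ) :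
    ρ.1 ^ (m.1.1 + m.2.1) * ρ.2 ^ (m.1.2 + m.2.2 - 1) *
        Real.cos (((m.1.1 : ℝ) - m.2.1) * φ.1 + ((m.1.2 : ℝ) - m.2.2) * φ.2 - φ.2) =
      chebMono (expSnd k₂) 1 (redVar ρ (k₂ * φ.1 - k₁ * φ.2)) m := by
  rw [chebMono_redVar_fst _ hρ]
  obtain ⟨⟨a, b⟩, ⟨c, d⟩⟩ := m
  rcases mode_eq_snd_cases hk₁ hk hcop h with ⟨h1, h2⟩ | ⟨n, P, Q, hP, hQ, hP3, hQ2, h3⟩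
  · simp only at h1 h2
    subst h1 h2
    simp only [expSnd, sub_self, Int.natAbs_zero, Nat.zero_div, Nat.cast_zero, zero_mul,
      Real.cos_zero, pow_zero, mul_one, Nat.sub_zero]
    have e2 : 0 + ((d + 1 : ℕ) - d : ℝ) * φ.2 - φ.2 = 0 := by
      push_cast
      ring
    rw [e2, Real.cos_zero, mul_one]
  · simp only at h3
    have hJ : (P + k₂) / k₂ = n + 1 := by
      rw [hP, ← Nat.mul_succ, Nat.mul_div_cancel_left _ (by omega)]
    have hPr : (P : ℝ) = k₂ * n := by exact_mod_cast hP
    have hQr : (Q : ℝ) = k₁ * n := by exact_mod_cast hQ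
    have hN : ((a : ℤ) - c).natAbs = P + k₂ := by omega
    simp only [expSnd, hN, hJ]
    obtain ⟨A, hA⟩ : ∃ A, a + c = A + (n + 1) := ⟨a + c - (n + 1), by omega⟩
    have e1 : a + c - (n + 1) = A := by omega
    rw [e1, hA]
    rcases h3 with ⟨h1, h2⟩ | ⟨h1, h2⟩
    · have h2' : (d : ℝ) + 1 = b + Q + k₁ := by exact_mod_cast h2
      have e2 : ((a : ℝ) - c) * φ.1 + ((b : ℝ) - d) * φ.2 - φ.2 =
          ((n + 1 : ℕ) : ℝ) * (k₂ * φ.1 - k₁ * φ.2) := by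
        rw [h1]
        push_cast
        rw [hPr]
        rw [hQr] at h2'
        linear_combination (-φ.2) * h2'
      rw [e2]
      ring
    · have e2 : ((a : ℝ) - c) * φ.1 + ((b : ℝ) - d) * φ.2 - φ.2 =
          -(((n + 1 : ℕ) : ℝ) * (k₂ * φ.1 - k₁ * φ.2)) := by
        rw [h1, h2]
        push_cast
        rw [hPr, hQr]
        ring
      rw [e2, Real.cos_neg]
      ring

/-- The exponents add up to the order minus one. Orders in the family `j = 0` are odd, and `j ≠ 0`
forces large orders, so only order one falls short. -/
theorem order_ge_of_mode_fst (hk₁ : 2 ≤ k₁) (hk : k₁ < k₂) (hcop : Nat.Coprime k₁ k₂)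
    (h : mode k₁ k₂ m = k₁) (h1 : order m ≠ 1) :
    2 ≤ (expFst k₁ m).1 + (expFst k₁ m).2.1 + (expFst k₁ m).2.2 := by
  obtain ⟨⟨a, b⟩, ⟨c, d⟩⟩ := m
  simp only [order, expFst] at h1 ⊢
  rcases mode_eq_fst_cases hk₁ hk hcop h with ⟨h2, h3⟩ | ⟨n, P, Q, hP, hQ, hP3, hQ2, h3⟩
  · simp only at h2 h3
    subst h2 h3
    simp only [sub_self, Int.natAbs_zero, Nat.zero_div]
    omega
  · simp only at h3
    have hJ : (Q + k₁) / k₁ = n + 1 := by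
      rw [hQ, ← Nat.mul_succ, Nat.mul_div_cancel_left _ (by omega)]
    have hN : ((b : ℤ) - d).natAbs = Q + k₁ := by omega
    rw [hN, hJ]
    omega

theorem order_ge_of_mode_snd (hk₁ : 2 ≤ k₁) (hk : k₁ < k₂) (hcop : Nat.Coprime k₁ k₂)
    (h : mode k₁ k₂ m = k₂) (h1 : order m ≠ 1) :
    2 ≤ (expSnd k₂ m).1 + (expSnd k₂ m).2.1 + (expSnd k₂ m).2.2 := by
  obtain ⟨⟨a, b⟩, ⟨c, d⟩⟩ := m
  simp only [order, expSnd] at h1 ⊢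
  rcases mode_eq_snd_cases hk₁ hk hcop h with ⟨h2, h3⟩ | ⟨n, P, Q, hP, hQ, hP3, hQ2, h3⟩
  · simp only at h2 h3
    subst h2 h3
    simp only [sub_self, Int.natAbs_zero, Nat.zero_div]
    omega
  · simp only at h3
    have hJ : (P + k₂) / k₂ = n + 1 := by
      rw [hP, ← Nat.mul_succ, Nat.mul_div_cancel_left _ (by omega)]
    have hN : ((a : ℤ) - c).natAbs = P + k₂ := by omega
    rw [hN, hJ]
    omega

/-- The exponents add up to the excess of the order over that of `critIdx`. For the smallest shift
on the side of `critIdx` this excess is `2α₁ + 2β₂`, so it is zero only at `critIdx` and at least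
two otherwise; all other shifts start higher. -/
theorem order_ge_of_mode_im (hk₁ : 2 ≤ k₁) (hk : k₁ < k₂) (hcop : Nat.Coprime k₁ k₂)
    (h : mode k₁ k₂ m = k₁) (h0 : m ≠ ((0, k₁), (k₂ - 1, 0))) (h1 : sgn m ≠ 0) :
    2 ≤ (expIm k₁ k₂ m).1 + (expIm k₁ k₂ m).2.1 + (expIm k₁ k₂ m).2.2 := by
  obtain ⟨⟨a, b⟩, ⟨c, d⟩⟩ := m
  simp only [expIm, ne_eq, Prod.mk.injEq] at h0 ⊢
  rcases mode_eq_fst_cases hk₁ hk hcop h with ⟨h2, h3⟩ | ⟨n, P, Q, hP, hQ, hP3, hQ2, h3⟩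
  · simp only at h2 h3
    exact (h1 (by simp [sgn, h3])).elim
  · simp only at h3
    have hJ : (Q + k₁) / k₁ = n + 1 := by
      rw [hQ, ← Nat.mul_succ, Nat.mul_div_cancel_left _ (by omega)]
    have hN : ((b : ℤ) - d).natAbs = Q + k₁ := by omega
    rw [hN, hJ]
    rcases Nat.eq_zero_or_pos n with rfl | hn
    · simp only [mul_zero] at hP hQ
      subst hP hQ
      omega
    · omega

end terms

/-- The index `(α, β) = ((0, k₁), (k₂ - 1, 0))`, of lowest order in the mode `k₁`. -/
def critIdx (k₁ k₂ : ℕ) : Idx := ((0, k₁), (k₂ - 1, 0))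

open Classical in
/-- The sign of the imaginary part on the mode `k₁`, without the lowest order. -/
def maskIm (k₁ k₂ : ℕ) : Idx →ᵇ ℝ :=
  bdd (fun m => if mode k₁ k₂ m = k₁ ∧ m ≠ critIdx k₁ k₂ then sgn m else 0) 1 fun m => by
    unfold sgn
    split_ifs <;> simp

/-- The nonlinear term of the real part of the equation in the mode `k₁`. -/
def redFst (k₁ k₂ : ℕ) : L1 Idx ℝ → ℝ × ℝ × ℝ → ℝ :=
  modeSum (ind ℝ {m | mode k₁ k₂ m = k₁ ∧ order m ≠ 1}) (expFst k₁) 1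

/-- The nonlinear term of the real part of the equation in the mode `k₂`. -/
def redSnd (k₁ k₂ : ℕ) : L1 Idx ℝ → ℝ × ℝ × ℝ → ℝ :=
  modeSum (ind ℝ {m | mode k₁ k₂ m = k₂ ∧ order m ≠ 1}) (expSnd k₂) 1

/-- The terms of higher order of the imaginary part of the equation in the mode `k₁`. -/
def redIm (k₁ k₂ : ℕ) : L1 Idx ℝ → ℝ × ℝ × ℝ → ℝ :=
  modeSum (maskIm k₁ k₂) (expIm k₁ k₂) 2

theorem abs_ind_le {α : Type*} [TopologicalSpace α] [DiscreteTopology α] (s : Set α) (x : α) :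
    |ind ℝ s x| ≤ 1 := by
  rw [ind_apply]
  split_ifs <;> simp

section bounds

variable {k₁ k₂ : ℕ}

theorem abs_redFst_le (hk₁ : 2 ≤ k₁) (hk : k₁ < k₂) (hcop : Nat.Coprime k₁ k₂) (V : L1 Idx ℝ)
    {y : ℝ × ℝ × ℝ} (hy : 3 * ‖y‖ ≤ 1) : |redFst k₁ k₂ V y| ≤ ‖V‖ * (3 * ‖y‖) ^ 2 := by
  refine abs_modeSum_le (by norm_num) (abs_ind_le _) (fun m h => ?_) V hy
  rw [ind_apply] at h
  split_ifs at h with h1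
  · exact order_ge_of_mode_fst hk₁ hk hcop h1.1 h1.2
  · exact (h rfl).elim

theorem abs_redSnd_le (hk₁ : 2 ≤ k₁) (hk : k₁ < k₂) (hcop : Nat.Coprime k₁ k₂) (V : L1 Idx ℝ)
    {y : ℝ × ℝ × ℝ} (hy : 3 * ‖y‖ ≤ 1) : |redSnd k₁ k₂ V y| ≤ ‖V‖ * (3 * ‖y‖) ^ 2 := by
  refine abs_modeSum_le (by norm_num) (abs_ind_le _) (fun m h => ?_) V hy
  rw [ind_apply] at h
  split_ifs at h with h1
  · exact order_ge_of_mode_snd hk₁ hk hcop h1.1 h1.2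
  · exact (h rfl).elim

theorem abs_redIm_le (hk₁ : 2 ≤ k₁) (hk : k₁ < k₂) (hcop : Nat.Coprime k₁ k₂) (V : L1 Idx ℝ)
    {y : ℝ × ℝ × ℝ} (hy : 3 * ‖y‖ ≤ 1) : |redIm k₁ k₂ V y| ≤ ‖V‖ * (3 * ‖y‖) ^ 2 := by
  refine abs_modeSum_le (by norm_num) (fun m => ?_) (fun m h => ?_) V hy
  · rw [maskIm, bdd_apply]
    unfold sgn
    split_ifs <;> simp
  · rw [maskIm, bdd_apply] at h
    split_ifs at h with h1
    · exact order_ge_of_mode_im hk₁ hk hcop h1.1 h1.2 h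
    · exact (h rfl).elim

end bounds

/-- The angle of the monomial with index `m`. -/
def angle (φ : ℝ × ℝ) (m : Idx) : ℝ := ((m.1.1 : ℝ) - m.2.1) * φ.1 + ((m.1.2 : ℝ) - m.2.2) * φ.2

theorem exp_mul_I_split (x y : ℝ) : Complex.exp (x * Complex.I) =
    Complex.exp (y * Complex.I) * (Real.cos (x - y) + Real.sin (x - y) * Complex.I) := by
  rw [Complex.ofReal_cos, Complex.ofReal_sin, ← Complex.exp_mul_I, ← Complex.exp_add]
  push_cast
  ring_nf

/-- All exponents vanish at this index, so it contributes a constant, without powers of `y`; that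
constant carries the value of `phi`. -/
theorem sum_critIdx {k₁ k₂ : ℕ} (hk₁ : 2 ≤ k₁) {ρ : ℝ × ℝ} (hρ : 3 * ‖ρ‖ ≤ 1) (ψ : ℝ) :
    sgn (critIdx k₁ k₂) * chebMono (expIm k₁ k₂) 2 (redVar ρ ψ) (critIdx k₁ k₂) = -1 := by
  have h1 : sgn (critIdx k₁ k₂) = -1 := by
    rw [sgn, critIdx, if_neg (by simp), if_pos (by simp only; omega)]
  have h2 : expIm k₁ k₂ (critIdx k₁ k₂) = (0, 0, 0) := by
    have h3 : k₁ / k₁ = 1 := Nat.div_self (by omega)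
    simp [expIm, critIdx, h3]
  rw [chebMono_apply (by norm_num) (by linarith [norm_redVar_le ρ ψ]), h1, h2]
  simp [chebSeq]

section sums

variable {k₁ k₂ : ℕ} {V : L1 Idx ℝ} {ρ φ : ℝ × ℝ}

open Classical in
theorem hasSum_redIm (hk₁ : 2 ≤ k₁) (hk : k₁ < k₂) (hρ : 3 * ‖ρ‖ ≤ 1) (ψ : ℝ) :
    HasSum (fun m => if mode k₁ k₂ m = k₁ then
      V m * (sgn m * chebMono (expIm k₁ k₂) 2 (redVar ρ ψ) m) else 0)
      (redIm k₁ k₂ V (redVar ρ ψ) - V (critIdx k₁ k₂)) := by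
  have h1 : HasSum (fun m => V m * (maskIm k₁ k₂ m * chebMono (expIm k₁ k₂) 2 (redVar ρ ψ) m))
      (redIm k₁ k₂ V (redVar ρ ψ)) := hasSum_modeSum _ _ _ _ _
  have h2 := h1.add (hasSum_ite_eq (critIdx k₁ k₂) (-V (critIdx k₁ k₂)))
  rw [sub_eq_add_neg]
  refine h2.congr_fun fun m => ?_
  have hmode : mode k₁ k₂ (critIdx k₁ k₂) = k₁ := by
    simp only [mode, critIdx]
    push_cast [show 1 ≤ k₂ by omega]
    ring
  rw [maskIm, bdd_apply]
  by_cases h3 : m = critIdx k₁ k₂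
  · subst h3
    rw [if_pos hmode, sum_critIdx hk₁ hρ]
    simp
  · by_cases h4 : mode k₁ k₂ m = k₁ <;> simp [h3, h4]

/-- Splitting off the phase `e^{iφ₁}` separates cosine and sine parts, both already divided by their
common factors. The coefficient at `critIdx` is the only part of the imaginary factor that survives
at `y = 0`. -/
theorem hasSum_mode_fst (hk₁ : 2 ≤ k₁) (hk : k₁ < k₂) (hcop : Nat.Coprime k₁ k₂)
    (hV : ∀ m, order m = 1 → V m = 0) (hρ : 3 * ‖ρ‖ ≤ 1) :
    HasSum (fun m => if mode k₁ k₂ m = k₁ then (V m : ℂ) * mono (polar ρ φ) m else 0)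
      (Complex.exp (φ.1 * Complex.I) *
        ((ρ.1 * redFst k₁ k₂ V (redVar ρ (k₂ * φ.1 - k₁ * φ.2)) : ℝ) +
          (ρ.1 ^ (k₂ - 1) * ρ.2 ^ k₁ * Real.sin (k₂ * φ.1 - k₁ * φ.2) *
            (redIm k₁ k₂ V (redVar ρ (k₂ * φ.1 - k₁ * φ.2)) - V (critIdx k₁ k₂)) : ℝ) *
            Complex.I)) := by
  set y := redVar ρ (k₂ * φ.1 - k₁ * φ.2) with hy
  have hn : ‖ρ‖ ≤ 1 := by linarith [norm_nonneg ρ]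
  have h1 : HasSum (fun m => V m * (ind ℝ {m | mode k₁ k₂ m = k₁ ∧ order m ≠ 1} m *
      chebMono (expFst k₁) 1 y m)) (redFst k₁ k₂ V y) := hasSum_modeSum _ _ _ _ _
  have h2 := Complex.hasSum_ofReal.2 (h1.mul_left ρ.1)
  have h3 := Complex.hasSum_ofReal.2 ((hasSum_redIm (V := V) hk₁ hk hρ
    (k₂ * φ.1 - k₁ * φ.2)).mul_left (ρ.1 ^ (k₂ - 1) * ρ.2 ^ k₁ * Real.sin (k₂ * φ.1 - k₁ * φ.2)))
  refine ((h2.add (h3.mul_right Complex.I)).mul_left (Complex.exp (φ.1 * Complex.I))).congr_fun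
    fun m => ?_
  rw [ind_apply]
  by_cases h4 : mode k₁ k₂ m = k₁
  · rw [if_pos h4, if_pos h4]
    by_cases h5 : order m = 1
    · simp [hV m h5]
    · rw [if_pos ⟨h4, h5⟩, one_mul, mono_polar ((norm_fst_le ρ).trans hn) ((norm_snd_le ρ).trans hn),
        exp_mul_I_split _ φ.1]
      have e1 := cos_term_fst hk₁ hk hcop h4 hρ φ
      have e2 := sin_term_fst hk₁ hk hcop h4 hρ φ
      rw [← hy] at e1 e2
      rw [mul_left_comm ρ.1, ← e1, mul_left_comm _ (V m), ← e2]
      push_cast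
      ring
  · rw [if_neg h4, if_neg h4, if_neg (fun h => h4 h.1)]
    simp

/-- Only the real part of `C` is identified: the imaginary part, a sum of sines, is never needed
because the corresponding equation is redundant. Lowering the exponent of `ρ₂` instead of dividing
by it covers `ρ₂ = 0`. -/
theorem exists_hasSum_mode_snd (hk₁ : 2 ≤ k₁) (hk : k₁ < k₂) (hcop : Nat.Coprime k₁ k₂)
    (hV : ∀ m, order m = 1 → V m = 0) (hρ : 3 * ‖ρ‖ ≤ 1) :
    ∃ C : ℂ, C.re = redSnd k₁ k₂ V (redVar ρ (k₂ * φ.1 - k₁ * φ.2)) ∧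
    HasSum (fun m => if mode k₁ k₂ m = k₂ then (V m : ℂ) * mono (polar ρ φ) m else 0)
      (Complex.exp (φ.2 * Complex.I) * ρ.2 * C) := by
  set y := redVar ρ (k₂ * φ.1 - k₁ * φ.2) with hy
  have hn : ‖ρ‖ ≤ 1 := by linarith [norm_nonneg ρ]
  have hn1 : |ρ.1| ≤ 1 := (norm_fst_le ρ).trans hn
  have hn2 : |ρ.2| ≤ 1 := (norm_snd_le ρ).trans hn
  have h1 : HasSum (fun m => V m * (ind ℝ {m | mode k₁ k₂ m = k₂ ∧ order m ≠ 1} m *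
      chebMono (expSnd k₂) 1 y m)) (redSnd k₁ k₂ V y) := hasSum_modeSum _ _ _ _ _
  let g : Idx → ℝ := fun m => if mode k₁ k₂ m = k₂ then V m * (ρ.1 ^ (m.1.1 + m.2.1) *
    ρ.2 ^ (m.1.2 + m.2.2 - 1) * Real.sin (angle φ m - φ.2)) else 0
  have hg : Summable g := by
    refine Summable.of_norm_bounded V.summable_norm fun m => ?_
    simp only [g]
    split_ifs
    · rw [norm_mul, Real.norm_eq_abs, Real.norm_eq_abs, abs_mul, abs_mul, abs_pow, abs_pow]
      refine mul_le_of_le_one_right (abs_nonneg _) ?_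
      refine mul_le_one₀ (mul_le_one₀ (pow_le_one₀ (abs_nonneg _) hn1) (by positivity)
        (pow_le_one₀ (abs_nonneg _) hn2)) (abs_nonneg _) (Real.abs_sin_le_one _)
    · simp
  refine ⟨(redSnd k₁ k₂ V y : ℝ) + ((∑' m, g m : ℝ) : ℂ) * Complex.I, by simp, ?_⟩
  have h2 := Complex.hasSum_ofReal.2 h1
  have h3 := Complex.hasSum_ofReal.2 hg.hasSum
  refine ((h2.add (h3.mul_right Complex.I)).mul_left
    (Complex.exp (φ.2 * Complex.I) * ρ.2)).congr_fun fun m => ?_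
  rw [ind_apply]
  by_cases h4 : mode k₁ k₂ m = k₂
  · simp only [g]
    rw [if_pos h4, if_pos h4]
    by_cases h5 : order m = 1
    · simp [hV m h5]
    · rw [if_pos ⟨h4, h5⟩, one_mul, mono_polar hn1 hn2, exp_mul_I_split _ φ.2]
      have e1 := cos_term_snd hk₁ hk hcop h4 hρ φ
      rw [← hy] at e1
      rw [← e1, angle]
      have e2 : m.1.2 + m.2.2 = (m.1.2 + m.2.2 - 1) + 1 := by
        obtain ⟨⟨a, b⟩, ⟨c, d⟩⟩ := m
        simp only
        rcases mode_eq_snd_cases hk₁ hk hcop h4 with ⟨h6, h7⟩ | ⟨n, P, Q, -, -, -, -, h6⟩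
        · simp only at h7
          omega
        · simp only at h6
          omega
      have e3 : ρ.2 ^ (m.1.2 + m.2.2) = ρ.2 * ρ.2 ^ (m.1.2 + m.2.2 - 1) := by
        conv_lhs => rw [e2]
        ring
      rw [e3]
      push_cast
      ring
  · simp only [g]
    rw [if_neg h4, if_neg h4, if_neg (fun h => h4 h.1)]
    simp

end sums

/-! ## Solutions from the reduced equations -/

/-- `U` is the weighted family of coefficients of the formal solution for the symbol `l`. -/
structure IsProfile (k₁ k₂ : ℕ) (τ : ℝ) (l : ℤ → ℝ) (U : L1 Idx ℝ) : Prop where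
  pos : 0 < τ
  even : ∀ n, l (-n) = l n
  eq : ∀ m, U m = uHat k₁ k₂ l m * τ ^ order m

/-- The coefficients of the solution with amplitudes and phases `z`. -/
def profile (U : L1 Idx ℝ) (z : ℂ × ℂ) (m : Idx) : ℂ := U m * mono z m

section

variable {k₁ k₂ : ℕ} {τ : ℝ} {l : ℤ → ℝ} {U : L1 Idx ℝ} {z : ℂ × ℂ}

theorem IsProfile.swap (hU : IsProfile k₁ k₂ τ l U) (m : Idx) : U m.swap = U m := by
  rw [hU.eq, hU.eq, order_swap, uHat_swap _ _ hU.even]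

theorem IsProfile.zero (hU : IsProfile k₁ k₂ τ l U) : U 0 = 0 := by
  rw [hU.eq, uHat_zero, zero_mul]

theorem IsProfile.of_order_eq_one (hU : IsProfile k₁ k₂ τ l U) {m : Idx} (h : order m = 1) :
    U m = τ / 2 := by
  rw [hU.eq, uHat_of_order_eq_one _ _ _ h, h]
  ring

theorem IsProfile.of_order_ne_one (hU : IsProfile k₁ k₂ τ l U) {m : Idx} (h : order m ≠ 1) :
    U m = l (mode k₁ k₂ m) * conv U U m := by
  rw [hU.eq, uHat_of_order_ne_one _ _ _ h, conv_eq_uSqHat hU.eq, mul_assoc]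

theorem conv_eq_zero {m : Idx} (h : order m = 1) : conv U U m = 0 := by
  rw [conv_apply, splits_eq_empty h.le, Finset.sum_empty]

theorem norm_profile_le (h1 : ‖z.1‖ ≤ 1 / 2) (h2 : ‖z.2‖ ≤ 1 / 2) (m : Idx) :
    ‖profile U z m‖ ≤ ‖U m‖ * (1 / 2) ^ order m := by
  rw [profile, norm_mul, Complex.norm_real]
  exact mul_le_mul_of_nonneg_left (norm_mono_le (by norm_num) h1 h2 m) (norm_nonneg _)

theorem summable_profile (h1 : ‖z.1‖ ≤ 1 / 2) (h2 : ‖z.2‖ ≤ 1 / 2) :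
    Summable fun m => ‖profile U z m‖ := by
  refine Summable.of_nonneg_of_le (fun _ => norm_nonneg _) (fun m => ?_) U.summable_norm
  exact (norm_profile_le h1 h2 m).trans
    (mul_le_of_le_one_right (norm_nonneg _) (pow_le_one₀ (by norm_num) (by norm_num)))

theorem summable_mode_profile (h1 : ‖z.1‖ ≤ 1 / 2) (h2 : ‖z.2‖ ≤ 1 / 2) :
    Summable fun m => ‖(mode k₁ k₂ m : ℂ) * profile U z m‖ := by
  refine Summable.of_nonneg_of_le (fun _ => norm_nonneg _) (fun m => ?_)
    (U.summable_norm.mul_left ((k₁ : ℝ) + k₂))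
  have e1 : ‖(mode k₁ k₂ m : ℂ)‖ = |(mode k₁ k₂ m : ℝ)| := by
    rw [← Complex.ofReal_intCast, Complex.norm_real, Real.norm_eq_abs]
  have e2 : (order m : ℝ) * (1 / 2) ^ order m ≤ 1 := by
    rw [one_div, inv_pow, mul_inv_le_iff₀ (by positivity), one_mul]
    exact_mod_cast (Nat.lt_two_pow_self (n := order m)).le
  rw [norm_mul, e1]
  calc |(mode k₁ k₂ m : ℝ)| * ‖profile U z m‖
      ≤ (((k₁ : ℝ) + k₂) * order m) * (‖U m‖ * (1 / 2) ^ order m) := by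
        gcongr
        · exact abs_mode_le k₁ k₂ m
        · exact norm_profile_le h1 h2 m
    _ = ((k₁ : ℝ) + k₂) * ‖U m‖ * (order m * (1 / 2) ^ order m) := by ring
    _ ≤ _ := mul_le_of_le_one_right (by positivity) e2

theorem profile_swap (hU : IsProfile k₁ k₂ τ l U) (h1 : ‖z.1‖ ≤ 1 / 2) (h2 : ‖z.2‖ ≤ 1 / 2)
    (m : Idx) : profile U z m.swap = conj (profile U z m) := by
  rw [profile, hU.swap, mono_swap (by linarith) (by linarith), profile, map_mul,
    Complex.conj_ofReal]

theorem conj_syn_profile (hU : IsProfile k₁ k₂ τ l U) (h1 : ‖z.1‖ ≤ 1 / 2) (h2 : ‖z.2‖ ≤ 1 / 2)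
    (x : Torus) : conj (syn (mode k₁ k₂) (profile U z) x) = syn (mode k₁ k₂) (profile U z) x :=
  conj_syn_of_swap (summable_profile h1 h2) (profile_swap hU h1 h2) x

theorem sum_splits_profile (h1 : ‖z.1‖ ≤ 1 / 2) (h2 : ‖z.2‖ ≤ 1 / 2) (m : Idx) :
    ∑ p ∈ splits m, profile U z p.1 * profile U z p.2 = (conv U U m : ℂ) * mono z m := by
  rw [conv_apply, Complex.ofReal_sum, Finset.sum_mul]
  refine Finset.sum_congr rfl fun p hp => ?_
  rw [profile, profile, ← (mem_splits.1 hp).1, mono_add (by linarith) (by linarith)]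
  push_cast
  ring

theorem hasSum_fc_profile_sq (hU : IsProfile k₁ k₂ τ l U) (h1 : ‖z.1‖ ≤ 1 / 2)
    (h2 : ‖z.2‖ ≤ 1 / 2) (n : ℤ) :
    HasSum (fun m => if mode k₁ k₂ m = n then (conv U U m : ℂ) * mono z m else 0)
      (fc n (syn (mode k₁ k₂) (profile U z) * syn (mode k₁ k₂) (profile U z))) := by
  have h3 := hasSum_fc_sq (k₁ := k₁) (k₂ := k₂) (summable_profile (U := U) h1 h2)
    (by rw [profile, hU.zero]; simp) n
  simpa only [sum_splits_profile h1 h2] using h3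

theorem mode_of_order_eq_one {m : Idx} (h : order m = 1) :
    (m = ((1, 0), (0, 0)) ∧ mode k₁ k₂ m = k₁) ∨ (m = ((0, 1), (0, 0)) ∧ mode k₁ k₂ m = k₂) ∨
      mode k₁ k₂ m = -k₁ ∨ mode k₁ k₂ m = -k₂ := by
  obtain ⟨⟨a, b⟩, ⟨c, d⟩⟩ := m
  simp only [order] at h
  have h1 : (a = 1 ∧ b = 0 ∧ c = 0 ∧ d = 0) ∨ (a = 0 ∧ b = 1 ∧ c = 0 ∧ d = 0) ∨
      (a = 0 ∧ b = 0 ∧ c = 1 ∧ d = 0) ∨ (a = 0 ∧ b = 0 ∧ c = 0 ∧ d = 1) := by omega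
  rcases h1 with ⟨rfl, rfl, rfl, rfl⟩ | ⟨rfl, rfl, rfl, rfl⟩ | ⟨rfl, rfl, rfl, rfl⟩ |
    ⟨rfl, rfl, rfl, rfl⟩ <;> simp [mode]

open Classical in
-- In a mode where `l` vanishes, every coefficient of order other than one carries the factor `l n =
-- 0`.
theorem fc_profile_single (hU : IsProfile k₁ k₂ τ l U) (h1 : ‖z.1‖ ≤ 1 / 2) (h2 : ‖z.2‖ ≤ 1 / 2)
    {n : ℤ} (hl : l n = 0) {m₀ : Idx} (hm₀ : order m₀ = 1)
    (hm : ∀ m : Idx, order m = 1 → (mode k₁ k₂ m = n ↔ m = m₀)) :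
    fc n (syn (mode k₁ k₂) (profile U z)) = (τ / 2 : ℝ) * mono z m₀ := by
  refine (hasSum_fc_syn (mode k₁ k₂) (summable_profile h1 h2) n).unique
    ((hasSum_ite_eq m₀ _).congr_fun fun m => ?_)
  by_cases h3 : order m = 1
  · simp only [hm m h3]
    split_ifs with h4
    · rw [h4, profile, hU.of_order_eq_one hm₀]
    · rfl
  · have h4 : m ≠ m₀ := fun h => h3 (h ▸ hm₀)
    rw [if_neg h4]
    split_ifs with h5
    · rw [profile, hU.of_order_ne_one h3, h5, hl]
      simp
    · rfl

theorem fc_profile_fst (hk₁ : 0 < k₁) (hk : k₁ < k₂) (hU : IsProfile k₁ k₂ τ l U)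
    (h1 : ‖z.1‖ ≤ 1 / 2) (h2 : ‖z.2‖ ≤ 1 / 2) (hl : l k₁ = 0) :
    fc k₁ (syn (mode k₁ k₂) (profile U z)) = (τ / 2 : ℝ) * z.1 := by
  rw [fc_profile_single hU h1 h2 hl (m₀ := ((1, 0), (0, 0))) rfl]
  · rw [mono_apply (by linarith) (by linarith)]
    simp
  · intro m hm
    constructor
    · intro h
      rcases mode_of_order_eq_one (k₁ := k₁) (k₂ := k₂) hm with h3 | h3 | h3 | h3
      · exact h3.1
      · have := h3.2
        omega
      · omega
      · omega
    · rintro rfl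
      simp [mode]

theorem fc_profile_snd (hk₁ : 0 < k₁) (hk : k₁ < k₂) (hU : IsProfile k₁ k₂ τ l U)
    (h1 : ‖z.1‖ ≤ 1 / 2) (h2 : ‖z.2‖ ≤ 1 / 2) (hl : l k₂ = 0) :
    fc k₂ (syn (mode k₁ k₂) (profile U z)) = (τ / 2 : ℝ) * z.2 := by
  rw [fc_profile_single hU h1 h2 hl (m₀ := ((0, 1), (0, 0))) rfl]
  · rw [mono_apply (by linarith) (by linarith)]
    simp
  · intro m hm
    constructor
    · intro h
      rcases mode_of_order_eq_one (k₁ := k₁) (k₂ := k₂) hm with h3 | h3 | h3 | h3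
      · have := h3.2
        omega
      · exact h3.1
      · omega
      · omega
    · rintro rfl
      simp [mode]

/-- The reduced equations imply the equation `σ(D) u = u²` in all modes. -/
theorem fc_profile_sq (hk₁ : 2 ≤ k₁) (hk : k₁ < k₂) (hcop : Nat.Coprime k₁ k₂)
    (hU : IsProfile k₁ k₂ τ l U) {ρ φ : ℝ × ℝ} (hρ : 3 * ‖ρ‖ ≤ 1) {σ : ℤ → ℝ}
    (hσ : ∀ n, σ (-n) = σ n) (hl1 : l k₁ = 0) (hl2 : l k₂ = 0)
    (hlσ : ∀ n : ℤ, n.natAbs ≠ k₁ → n.natAbs ≠ k₂ → σ n * l n = 1)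
    (hE1 : σ k₁ * (τ / 2) = redFst k₁ k₂ (conv U U) (redVar ρ (k₂ * φ.1 - k₁ * φ.2)))
    (hE2 : σ k₂ * (τ / 2) = redSnd k₁ k₂ (conv U U) (redVar ρ (k₂ * φ.1 - k₁ * φ.2)))
    (hE3 : redIm k₁ k₂ (conv U U) (redVar ρ (k₂ * φ.1 - k₁ * φ.2)) =
      conv U U (critIdx k₁ k₂)) (n : ℤ) :
    fc n (syn (mode k₁ k₂) (profile U (polar ρ φ)) * syn (mode k₁ k₂) (profile U (polar ρ φ))) =
      σ n * fc n (syn (mode k₁ k₂) (profile U (polar ρ φ))) := by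
  have h1 : ‖(polar ρ φ).1‖ ≤ 1 / 2 := by
    rw [norm_polar_fst]
    have : |ρ.1| ≤ ‖ρ‖ := norm_fst_le ρ
    linarith [norm_nonneg ρ]
  have h2 : ‖(polar ρ φ).2‖ ≤ 1 / 2 := by
    rw [norm_polar_snd]
    have : |ρ.2| ≤ ‖ρ‖ := norm_snd_le ρ
    linarith [norm_nonneg ρ]
  set u := syn (mode k₁ k₂) (profile U (polar ρ φ)) with hu
  have hreal : ∀ x, conj (u x) = u x := conj_syn_profile hU h1 h2
  have hreal2 : ∀ x, conj ((u * u) x) = (u * u) x := fun x => by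
    rw [ContinuousMap.mul_apply, map_mul, hreal]
  have hV : ∀ m, order m = 1 → conv U U m = 0 := fun m hm => conv_eq_zero hm
  have hA1 : fc k₁ u = (τ / 2 : ℝ) * (polar ρ φ).1 := fc_profile_fst (by omega) hk hU h1 h2 hl1
  have hA2 : fc k₂ u = (τ / 2 : ℝ) * (polar ρ φ).2 := fc_profile_snd (by omega) hk hU h1 h2 hl2
  have hB1 : fc k₁ (u * u) = σ k₁ * fc k₁ u := by
    rw [(hasSum_fc_profile_sq hU h1 h2 k₁).unique (hasSum_mode_fst hk₁ hk hcop hV hρ), hE3,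
      sub_self, ← hE1, hA1, polar]
    push_cast
    ring
  obtain ⟨C, hC, hB⟩ := exists_hasSum_mode_snd (φ := φ) hk₁ hk hcop hV hρ
  have hB2 := (hasSum_fc_profile_sq hU h1 h2 k₂).unique hB
  rw [← hu] at hB2
  have hk₂0 : (k₂ : ℤ) ≠ 0 := by omega
  -- Redundancy is used in the mode `k₂`: the mode `k₁` is settled by `hB1`, the nonresonant modes
  -- by the recursion, and in the mode `k₂` only the real part `hE2` is available. When the
  -- coefficient there is zero, so is `ρ₂`, and with it the right-hand side.
  refine fc_eq_of_modes (summable_profile h1 h2) (summable_mode_profile h1 h2) hreal hσ hk₂0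
    ?_ ?_ ?_ n
  · intro n hn1 hn2
    by_cases h3 : n = k₁
    · rw [h3]
      exact hB1
    · by_cases h4 : n = -k₁
      · rw [h4, fc_neg_of_real hreal, fc_neg_of_real hreal2, hσ, hB1, map_mul, Complex.conj_ofReal]
      · have h5 : n.natAbs ≠ k₁ := by omega
        have h6 : n.natAbs ≠ k₂ := by omega
        have h7 := (hasSum_fc_syn (mode k₁ k₂) (summable_profile (U := U) h1 h2) n).mul_left
          (σ n : ℂ)
        refine (hasSum_fc_profile_sq hU h1 h2 n).unique (h7.congr_fun fun m => ?_)
        split_ifs with h8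
        · have h9 : order m ≠ 1 := by
            intro h9
            rcases mode_of_order_eq_one (k₁ := k₁) (k₂ := k₂) h9 with h | h | h | h
            · have := h.2
              omega
            · have := h.2
              omega
            · omega
            · omega
          have h10 : (σ n : ℂ) * l n = 1 := by exact_mod_cast hlσ n h5 h6
          rw [profile, hU.of_order_ne_one h9, h8]
          push_cast
          linear_combination (-(conv U U m : ℂ) * mono (polar ρ φ) m) * h10
        · simp
  · rw [← hu, hB2, hA2, polar]
    have e1 : ∀ e : ℂ, ((σ k₂ : ℂ) * (((τ / 2 : ℝ) : ℂ) * ((ρ.2 : ℂ) * e)) - e * ρ.2 * C) *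
        conj (((τ / 2 : ℝ) : ℂ) * ((ρ.2 : ℂ) * e)) =
        ((ρ.2 * (τ / 2) * ρ.2 : ℝ) : ℂ) * (((σ k₂ * (τ / 2) : ℝ) : ℂ) - C) * (e * conj e) := by
      intro e
      rw [map_mul, map_mul, Complex.conj_ofReal, Complex.conj_ofReal]
      push_cast
      ring
    rw [e1, Complex.mul_conj, mul_right_comm, ← Complex.ofReal_mul, Complex.re_ofReal_mul,
      Complex.sub_re, Complex.ofReal_re, hC, hE2, sub_self, mul_zero]
  · intro h3
    rw [← hu, hA2, polar] at h3
    have h4 : (((τ / 2 : ℝ) : ℂ)) ≠ 0 := by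
      have := hU.pos
      exact_mod_cast (by positivity : (τ / 2 : ℝ) ≠ 0)
    have h5 := (mul_eq_zero.1 ((mul_eq_zero.1 h3).resolve_left h4)).resolve_right
      (Complex.exp_ne_zero _)
    rw [← hu, hB2, h5]
    ring

end

/-! ## The solution branch of the reduced equations -/

theorem exists_lipschitz {E : Type*} [NormedAddCommGroup E] [NormedSpace ℝ E] {F : Type*}
    [NormedAddCommGroup F] [NormedSpace ℝ F] [CompleteSpace F] {f : E → F} {x : E}
    (hf : AnalyticAt ℝ f x) :
    ∃ K : ℝ, 0 ≤ K ∧ ∀ᶠ z in 𝓝 (x, x), ‖f z.1 - f z.2‖ ≤ K * ‖z.1 - z.2‖ := by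
  have h1 := hf.hasStrictFDerivAt.isLittleO.def (c := 1) one_pos
  refine ⟨‖fderiv ℝ f x‖ + 1, by positivity, ?_⟩
  filter_upwards [h1] with z hz
  calc ‖f z.1 - f z.2‖ = ‖(f z.1 - f z.2 - fderiv ℝ f x (z.1 - z.2)) + fderiv ℝ f x (z.1 - z.2)‖ := by
        rw [sub_add_cancel]
    _ ≤ 1 * ‖z.1 - z.2‖ + ‖fderiv ℝ f x‖ * ‖z.1 - z.2‖ :=
        (norm_add_le _ _).trans (add_le_add hz ((fderiv ℝ f x).le_opNorm _))
    _ = _ := by ring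

/-- The function `R` of `(x, y)` is of order `‖y‖²` near `(x₀, 0)`. -/
def QuadAt {X E : Type*} [TopologicalSpace X] [NormedAddCommGroup E] (R : X × E → ℝ) (x₀ : X) :
    Prop := ∃ C : ℝ, 0 ≤ C ∧ ∀ᶠ z in 𝓝 (x₀, (0 : E)), |R z| ≤ C * ‖z.2‖ ^ 2

section quad

variable {E : Type*} [NormedAddCommGroup E]

theorem QuadAt.comp {X Y : Type*} [TopologicalSpace X] [TopologicalSpace Y] {R : X × E → ℝ}
    {x₀ : X} (h : QuadAt R x₀) {g : Y × E → X} {y₀ : Y} (hg : ContinuousAt g (y₀, 0))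
    (hg0 : g (y₀, 0) = x₀) : QuadAt (fun z : Y × E => R (g z, z.2)) y₀ := by
  obtain ⟨C, hC0, hC⟩ := h
  refine ⟨C, hC0, ?_⟩
  have h1 : Tendsto (fun z : Y × E => (g z, z.2)) (𝓝 (y₀, 0)) (𝓝 (x₀, 0)) := by
    have := (hg.prodMk continuousAt_snd).tendsto
    rwa [hg0] at this
  exact h1.eventually hC

theorem QuadAt.add {X : Type*} [TopologicalSpace X] {R S : X × E → ℝ} {x₀ : X} (hR : QuadAt R x₀)
    (hS : QuadAt S x₀) : QuadAt (fun z => R z + S z) x₀ := by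
  obtain ⟨C, hC0, hC⟩ := hR
  obtain ⟨D, hD0, hD⟩ := hS
  refine ⟨C + D, by positivity, ?_⟩
  filter_upwards [hC, hD] with z h1 h2
  calc |R z + S z| ≤ |R z| + |S z| := abs_add_le _ _
    _ ≤ _ := by linarith

theorem QuadAt.of_le {X : Type*} [TopologicalSpace X] {R S : X × E → ℝ} {x₀ : X} (hR : QuadAt R x₀)
    {K : ℝ} (hK : 0 ≤ K) (h : ∀ᶠ z in 𝓝 (x₀, (0 : E)), |S z| ≤ K * |R z|) : QuadAt S x₀ := by
  obtain ⟨C, hC0, hC⟩ := hR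
  refine ⟨K * C, by positivity, ?_⟩
  filter_upwards [hC, h] with z h1 h2
  calc |S z| ≤ K * |R z| := h2
    _ ≤ K * (C * ‖z.2‖ ^ 2) := by gcongr
    _ = _ := by ring

theorem QuadAt.abs {X : Type*} [TopologicalSpace X] {R : X × E → ℝ} {x₀ : X} (hR : QuadAt R x₀) :
    QuadAt (fun z => |R z|) x₀ := by
  obtain ⟨C, hC0, hC⟩ := hR
  exact ⟨C, hC0, hC.mono fun z h => by rwa [abs_abs]⟩

theorem QuadAt.eq_zero {X : Type*} [TopologicalSpace X] {R : X × E → ℝ} {x₀ : X}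
    (hR : QuadAt R x₀) : ∀ᶠ x in 𝓝 x₀, R (x, 0) = 0 := by
  obtain ⟨C, -, hC⟩ := hR
  have h1 : Tendsto (fun x : X => (x, (0 : E))) (𝓝 x₀) (𝓝 (x₀, 0)) :=
    (Continuous.prodMk_left (0 : E)).tendsto x₀
  filter_upwards [h1.eventually hC] with x hx
  simpa using hx

end quad

section branch

variable {E : Type*} [NormedAddCommGroup E] [NormedSpace ℝ E] [CompleteSpace E]

/-- Solving the equation `f(t, x, y) = 0` for `t`, near an approximate solution `a(x)`. -/
theorem exists_solve {X : Type*} [NormedAddCommGroup X] [NormedSpace ℝ X] [CompleteSpace X]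
    {f : ℝ × (X × E) → ℝ} {t₀ d : ℝ} {x₀ : X} {a : X → ℝ} (hf : AnalyticAt ℝ f (t₀, (x₀, 0)))
    (ha : ContinuousAt a x₀) (ha0 : a x₀ = t₀)
    (hd : HasDerivAt (fun t => f (t, (x₀, 0))) d t₀) (hd0 : d ≠ 0)
    (hq : QuadAt (fun z : X × E => f (a z.1, z)) x₀) :
    ∃ g : X × E → ℝ, AnalyticAt ℝ g (x₀, 0) ∧ g (x₀, 0) = t₀ ∧
      (∀ᶠ z in 𝓝 (x₀, 0), f (g z, z) = 0) ∧ QuadAt (fun z => g z - a z.1) x₀ := by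
  obtain ⟨C, hC0, hC⟩ := hq
  have hf0 : f (t₀, (x₀, 0)) = 0 := by
    have := hC.self_of_nhds
    simpa [ha0] using this
  obtain ⟨g, g1, g2, g3, K, hK⟩ := exists_analytic_implicit_scalar hf hf0 hd hd0
  refine ⟨g, g1, g2, g3, max K 0 * C, by positivity, ?_⟩
  have h1 : Tendsto (fun z : X × E => (a z.1, z)) (𝓝 (x₀, 0)) (𝓝 (t₀, (x₀, 0))) := by
    have h2 : ContinuousAt (fun z : X × E => a z.1) (x₀, 0) :=
      ContinuousAt.comp (f := Prod.fst) (x := (x₀, (0 : E))) ha continuousAt_fst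
    have := (h2.prodMk continuousAt_id).tendsto
    rwa [ha0] at this
  filter_upwards [h1.eventually hK, hC] with z hz hz2
  rw [abs_sub_comm]
  calc |a z.1 - g z| ≤ K * |f (a z.1, z)| := hz
    _ ≤ max K 0 * (C * ‖z.2‖ ^ 2) := by
        gcongr
        exact le_max_left _ _
    _ = _ := by ring

/-- The first two equations are solved for the first two parameters. -/
theorem exists_two_param {a b : ℝ × ℝ → ℝ} {R₁ R₂ : (ℝ × ℝ × ℝ) × E → ℝ} {c₀ κ₀ T₀ d : ℝ}
    (ha : AnalyticAt ℝ a (κ₀, T₀)) (hb : AnalyticAt ℝ b (κ₀, T₀)) (ha0 : a (κ₀, T₀) = c₀)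
    (hb0 : b (κ₀, T₀) = c₀) (hd : HasDerivAt (fun κ => a (κ, T₀) - b (κ, T₀)) d κ₀) (hd0 : d ≠ 0)
    (hR₁ : AnalyticAt ℝ R₁ ((c₀, κ₀, T₀), 0)) (hR₂ : AnalyticAt ℝ R₂ ((c₀, κ₀, T₀), 0))
    (hq₁ : QuadAt R₁ (c₀, κ₀, T₀)) (hq₂ : QuadAt R₂ (c₀, κ₀, T₀)) :
    ∃ (P : ℝ × E → ℝ × ℝ × ℝ) (P₀ : ℝ → ℝ × ℝ × ℝ), AnalyticAt ℝ P (T₀, 0) ∧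
      P (T₀, 0) = (c₀, κ₀, T₀) ∧ AnalyticAt ℝ P₀ T₀ ∧ P₀ T₀ = (c₀, κ₀, T₀) ∧
      (∀ z, (P z).2.2 = z.1) ∧ (∀ T, (P₀ T).2.2 = T) ∧
      (∀ᶠ z in 𝓝 (T₀, 0), (P z).1 = a (P z).2 + R₁ (P z, z.2) ∧
        (P z).1 = b (P z).2 + R₂ (P z, z.2)) ∧
      (∀ᶠ T in 𝓝 T₀, (P₀ T).1 = a (P₀ T).2 ∧ (P₀ T).1 = b (P₀ T).2) ∧
      QuadAt (fun z => ‖P z - P₀ z.1‖) T₀ := by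
  -- the approximate solution
  obtain ⟨K₀, k1, k2, k3, -⟩ := exists_analytic_implicit_scalar (f := fun z => a z - b z)
    (ha.sub hb) (by rw [ha0, hb0, sub_self]) hd hd0
  -- the first equation
  obtain ⟨C, c1, c2, c3, c4⟩ : ∃ C : (ℝ × ℝ) × E → ℝ, AnalyticAt ℝ C ((κ₀, T₀), 0) ∧
      C ((κ₀, T₀), 0) = c₀ ∧
      (∀ᶠ z in 𝓝 ((κ₀, T₀), 0), C z - a z.1 - R₁ ((C z, z.1), z.2) = 0) ∧
      QuadAt (fun z => C z - a z.1) (κ₀, T₀) := by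
    have hf : AnalyticAt ℝ (fun z : ℝ × ((ℝ × ℝ) × E) => z.1 - a z.2.1 - R₁ ((z.1, z.2.1), z.2.2))
        (c₀, ((κ₀, T₀), 0)) := by
      have e1 : AnalyticAt ℝ (fun z : ℝ × ((ℝ × ℝ) × E) => a z.2.1) (c₀, ((κ₀, T₀), 0)) :=
        AnalyticAt.fun_comp (f := fun z : ℝ × ((ℝ × ℝ) × E) => z.2.1) ha (by fun_prop)
      have e2 : AnalyticAt ℝ (fun z : ℝ × ((ℝ × ℝ) × E) => R₁ ((z.1, z.2.1), z.2.2))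
          (c₀, ((κ₀, T₀), 0)) :=
        AnalyticAt.fun_comp (f := fun z : ℝ × ((ℝ × ℝ) × E) => ((z.1, z.2.1), z.2.2)) hR₁
          (by fun_prop)
      exact (analyticAt_fst.sub e1).sub e2
    -- At `y = 0` the remainder vanishes identically in `c`, so the derivative in `c` is `1`.
    refine exists_solve (f := fun z => z.1 - a z.2.1 - R₁ ((z.1, z.2.1), z.2.2)) (d := 1) hf
      ha.continuousAt ha0 ?_ one_ne_zero ?_
    · have e1 : Tendsto (fun t : ℝ => (t, (κ₀, T₀))) (𝓝 c₀) (𝓝 (c₀, κ₀, T₀)) :=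
        Continuous.tendsto (by fun_prop) c₀
      have e2 := e1.eventually hq₁.eq_zero
      refine ((hasDerivAt_id c₀).sub_const (a (κ₀, T₀))).congr_of_eventuallyEq ?_
      filter_upwards [e2] with t ht
      simp [ht]
    · have e1 : QuadAt (fun z : (ℝ × ℝ) × E => R₁ ((a z.1, z.1), z.2)) (κ₀, T₀) :=
        hq₁.comp (g := fun z : (ℝ × ℝ) × E => (a z.1, z.1))
          ((ContinuousAt.comp (f := Prod.fst) (x := ((κ₀, T₀), (0 : E))) ha.continuousAt
            continuousAt_fst).prodMk continuousAt_fst) (by rw [ha0])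
      refine e1.of_le zero_le_one (Eventually.of_forall fun z => ?_)
      simp
  -- the second equation
  have hCa : AnalyticAt ℝ (fun z : ℝ × (ℝ × E) => C ((z.1, z.2.1), z.2.2)) (κ₀, (T₀, 0)) :=
    AnalyticAt.fun_comp (f := fun z : ℝ × (ℝ × E) => ((z.1, z.2.1), z.2.2)) c1 (by fun_prop)
  have hba : AnalyticAt ℝ (fun z : ℝ × (ℝ × E) => b (z.1, z.2.1)) (κ₀, (T₀, 0)) :=
    AnalyticAt.fun_comp (f := fun z : ℝ × (ℝ × E) => (z.1, z.2.1)) hb (by fun_prop)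
  have hRa : AnalyticAt ℝ (fun z : ℝ × (ℝ × E) =>
      R₂ ((C ((z.1, z.2.1), z.2.2), (z.1, z.2.1)), z.2.2)) (κ₀, (T₀, 0)) :=
    AnalyticAt.fun_comp (f := fun z : ℝ × (ℝ × E) =>
      ((C ((z.1, z.2.1), z.2.2), (z.1, z.2.1)), z.2.2)) (by rw [c2]; exact hR₂)
      ((hCa.prod (by fun_prop)).prod (by fun_prop))
  have hK₀c : ContinuousAt (fun z : ℝ × E => (K₀ z.1, z.1)) (T₀, 0) :=
    (ContinuousAt.comp (f := Prod.fst) (x := (T₀, (0 : E))) k1.continuousAt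
      continuousAt_fst).prodMk continuousAt_fst
  have hC0 : ∀ᶠ x in 𝓝 (κ₀, T₀), C (x, 0) = a x := c4.eq_zero.mono fun x hx => sub_eq_zero.1 hx
  have hq₂C : QuadAt (fun z : (ℝ × ℝ) × E => R₂ ((C z, z.1), z.2)) (κ₀, T₀) :=
    hq₂.comp (g := fun z : (ℝ × ℝ) × E => (C z, z.1)) (c1.continuousAt.prodMk continuousAt_fst)
      (by rw [c2])
  obtain ⟨K, K1, K2, K3, K4⟩ : ∃ K : ℝ × E → ℝ, AnalyticAt ℝ K (T₀, 0) ∧ K (T₀, 0) = κ₀ ∧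
      (∀ᶠ z in 𝓝 (T₀, 0), C ((K z, z.1), z.2) - b (K z, z.1) -
        R₂ ((C ((K z, z.1), z.2), (K z, z.1)), z.2) = 0) ∧
      QuadAt (fun z => K z - K₀ z.1) T₀ := by
    -- At `y = 0` one has `C = a` and no remainder, so the function reduces to `a - b`, whose
    -- derivative in `κ` is `d`.
    refine exists_solve (f := fun z => C ((z.1, z.2.1), z.2.2) - b (z.1, z.2.1) -
      R₂ ((C ((z.1, z.2.1), z.2.2), (z.1, z.2.1)), z.2.2)) (d := d) ((hCa.sub hba).sub hRa)
      k1.continuousAt k2 ?_ hd0 ?_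
    · have e1 : Tendsto (fun t : ℝ => (t, T₀)) (𝓝 κ₀) (𝓝 (κ₀, T₀)) :=
        Continuous.tendsto (by fun_prop) κ₀
      refine hd.congr_of_eventuallyEq ?_
      filter_upwards [e1.eventually hC0, e1.eventually hq₂C.eq_zero] with t ht1 ht2
      rw [ht2, ht1, sub_zero]
    · have e1 : QuadAt (fun z : ℝ × E => C ((K₀ z.1, z.1), z.2) - a (K₀ z.1, z.1)) T₀ :=
        c4.comp (g := fun z : ℝ × E => (K₀ z.1, z.1)) hK₀c (by rw [k2])
      have e2 : QuadAt (fun z : ℝ × E =>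
          R₂ ((C ((K₀ z.1, z.1), z.2), (K₀ z.1, z.1)), z.2)) T₀ :=
        hq₂C.comp (g := fun z : ℝ × E => (K₀ z.1, z.1)) hK₀c (by rw [k2])
      refine (e1.abs.add e2.abs).of_le zero_le_one ?_
      have e3 : ∀ᶠ z : ℝ × E in 𝓝 (T₀, 0), a (K₀ z.1, z.1) - b (K₀ z.1, z.1) = 0 :=
        (continuousAt_fst (p := (T₀, (0 : E)))).eventually k3
      filter_upwards [e3] with z hz
      rw [one_mul, abs_of_nonneg (by positivity : 0 ≤ |C ((K₀ z.1, z.1), z.2) - a (K₀ z.1, z.1)| +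
        |R₂ ((C ((K₀ z.1, z.1), z.2), (K₀ z.1, z.1)), z.2)|), ← sub_eq_zero.1 hz]
      exact abs_sub _ _
  -- the conclusion
  have hKc : ContinuousAt (fun z : ℝ × E => (K z, z.1)) (T₀, 0) :=
    K1.continuousAt.prodMk continuousAt_fst
  have hKa : AnalyticAt ℝ (fun z : ℝ × E => (K z, z.1)) (T₀, 0) := K1.prod analyticAt_fst
  have hK₀a : AnalyticAt ℝ (fun T => (K₀ T, T)) T₀ := k1.prod analyticAt_id
  have hCK : AnalyticAt ℝ (fun z : ℝ × E => C ((K z, z.1), z.2)) (T₀, 0) :=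
    AnalyticAt.fun_comp (f := fun z : ℝ × E => ((K z, z.1), z.2)) (by rw [K2]; exact c1)
      (hKa.prod analyticAt_snd)
  have haK : AnalyticAt ℝ (fun T => a (K₀ T, T)) T₀ :=
    AnalyticAt.fun_comp (f := fun T => (K₀ T, T)) (by rw [k2]; exact ha) hK₀a
  refine ⟨fun z => (C ((K z, z.1), z.2), (K z, z.1)), fun T => (a (K₀ T, T), (K₀ T, T)),
    hCK.prod hKa, by simp only [K2, c2], haK.prod hK₀a, by simp only [k2, ha0], fun z => rfl, fun T => rfl,
    ?_, ?_, ?_⟩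
  · have e1 : Tendsto (fun z : ℝ × E => ((K z, z.1), z.2)) (𝓝 (T₀, 0)) (𝓝 ((κ₀, T₀), 0)) := by
      have := (hKc.prodMk continuousAt_snd).tendsto
      simp only [K2] at this
      exact this
    filter_upwards [e1.eventually c3, K3] with z h1 h2
    exact ⟨by linarith, by linarith⟩
  · filter_upwards [k3] with T hT
    exact ⟨rfl, sub_eq_zero.1 hT⟩
  · obtain ⟨L, hL0, hL⟩ := exists_lipschitz ha
    have e1 : QuadAt (fun z : ℝ × E => C ((K z, z.1), z.2) - a (K z, z.1)) T₀ :=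
      c4.comp (g := fun z : ℝ × E => (K z, z.1)) hKc (by rw [K2])
    refine (e1.abs.add K4.abs).of_le (K := 1 + L) (by positivity) ?_
    have e2 : Tendsto (fun z : ℝ × E => ((K z, z.1), (K₀ z.1, z.1))) (𝓝 (T₀, 0))
        (𝓝 ((κ₀, T₀), (κ₀, T₀))) := by
      have := (hKc.prodMk hK₀c).tendsto
      simp only [K2, k2] at this
      exact this
    filter_upwards [e2.eventually hL] with z hz
    have e3 : ‖((K z, z.1) : ℝ × ℝ) - (K₀ z.1, z.1)‖ = |K z - K₀ z.1| := by
      simp [Prod.norm_def]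
    rw [e3, Real.norm_eq_abs] at hz
    rw [abs_norm, abs_of_nonneg (by positivity : 0 ≤ |C ((K z, z.1), z.2) - a (K z, z.1)| +
      |K z - K₀ z.1|)]
    have n1 := abs_nonneg (C ((K z, z.1), z.2) - a (K z, z.1))
    have n2 := abs_nonneg (K z - K₀ z.1)
    refine norm_prod_le_iff.2 ⟨?_, ?_⟩
    · change |C ((K z, z.1), z.2) - a (K₀ z.1, z.1)| ≤ _
      have := abs_sub_le (C ((K z, z.1), z.2)) (a (K z, z.1)) (a (K₀ z.1, z.1))
      nlinarith
    · change ‖((K z, z.1) : ℝ × ℝ) - (K₀ z.1, z.1)‖ ≤ _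
      rw [e3]
      nlinarith

end branch

/-! ### Solving the third equation for `T`. -/

/-- A function with a strictly monotone restriction to `y = 0` has zeros for all small `y`. -/
theorem exists_zero_of_strictMono {E : Type*} [NormedAddCommGroup E] {F : ℝ × E → ℝ} {φ : ℝ → ℝ}
    {T₀ : ℝ} (hF : ∀ᶠ z in 𝓝 (T₀, 0), ContinuousAt F z) (hφ : ∀ᶠ T in 𝓝 T₀, F (T, 0) = φ T)
    (hφ0 : φ T₀ = 0) {N : Set ℝ} (hN : N ∈ 𝓝 T₀) (hmono : StrictMonoOn φ N)
    {G : ℝ × E → Prop} (hG : ∀ᶠ z in 𝓝 (T₀, 0), G z) :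
    ∃ ρ : ℝ, 0 < ρ ∧ ∀ y : E, ‖y‖ < ρ → ∃ T, F (T, y) = 0 ∧ G (T, y) := by
  have h1 : ∀ᶠ z in 𝓝 T₀ ×ˢ 𝓝 (0 : E), ContinuousAt F z ∧ G z := by
    rw [← nhds_prod_eq]
    exact hF.and hG
  obtain ⟨pa, ha, pb, hb, hab⟩ := Filter.eventually_prod_iff.1 h1
  -- Working in the closed interval of radius `r / 2` leaves its endpoints inside the neighbourhood.
  -- The signs of `F` there at `y = 0` persist for small `y`.
  obtain ⟨r, hr, hrs⟩ := Metric.eventually_nhds_iff_ball.1 ((ha.and hφ).and hN)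
  have hmem : ∀ T, |T - T₀| ≤ r / 2 → (pa T ∧ F (T, 0) = φ T) ∧ T ∈ N := fun T hT =>
    hrs T (by
      rw [Metric.mem_ball, Real.dist_eq]
      linarith)
  have hl := hmem (T₀ - r / 2) (by simp [abs_of_pos (half_pos hr)])
  have hm := hmem T₀ (by simpa using (half_pos hr).le)
  have hu := hmem (T₀ + r / 2) (by simp [abs_of_pos (half_pos hr)])
  have hl0 : F (T₀ - r / 2, 0) < 0 := by
    rw [hl.1.2, ← hφ0]
    exact hmono hl.2 hm.2 (by linarith)
  have hu0 : 0 < F (T₀ + r / 2, 0) := by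
    rw [hu.1.2, ← hφ0]
    exact hmono hm.2 hu.2 (by linarith)
  have hc : ∀ T, ContinuousAt F (T, 0) → ContinuousAt (fun y : E => F (T, y)) 0 := fun T hT =>
    ContinuousAt.comp (f := fun y : E => (T, y)) hT (by fun_prop)
  have e1 := (hc _ (hab hl.1.1 hb.self_of_nhds).1).eventually (gt_mem_nhds hl0)
  have e2 := (hc _ (hab hu.1.1 hb.self_of_nhds).1).eventually (lt_mem_nhds hu0)
  obtain ⟨ρ, hρ, hρs⟩ := Metric.eventually_nhds_iff_ball.1 ((hb.and e1).and e2)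
  refine ⟨ρ, hρ, fun y hy => ?_⟩
  obtain ⟨⟨hy1, hy2⟩, hy3⟩ := hρs y (by simpa using hy)
  have hcont : ContinuousOn (fun T => F (T, y)) (Icc (T₀ - r / 2) (T₀ + r / 2)) := by
    intro T hT
    have h2 : |T - T₀| ≤ r / 2 := abs_le.2 ⟨by linarith [hT.1], by linarith [hT.2]⟩
    exact (ContinuousAt.comp (f := fun T : ℝ => (T, y)) (hab (hmem T h2).1.1 hy1).1
      (by fun_prop)).continuousWithinAt
  obtain ⟨T, hT, hT0⟩ := intermediate_value_Icc (by linarith) hcont ⟨hy2.le, hy3.le⟩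
  have h2 : |T - T₀| ≤ r / 2 := abs_le.2 ⟨by linarith [hT.1], by linarith [hT.2]⟩
  exact ⟨T, hT0, (hab (hmem T h2).1.1 hy1).2⟩

theorem exists_zero_of_strict {E : Type*} [NormedAddCommGroup E] {F : ℝ × E → ℝ} {φ : ℝ → ℝ}
    {T₀ : ℝ} (hF : ∀ᶠ z in 𝓝 (T₀, 0), ContinuousAt F z) (hφ : ∀ᶠ T in 𝓝 T₀, F (T, 0) = φ T)
    (hφ0 : φ T₀ = 0) (hmono : ∃ N ∈ 𝓝 T₀, StrictMonoOn φ N ∨ StrictAntiOn φ N)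
    {G : ℝ × E → Prop} (hG : ∀ᶠ z in 𝓝 (T₀, 0), G z) :
    ∃ ρ : ℝ, 0 < ρ ∧ ∀ y : E, ‖y‖ < ρ → ∃ T, F (T, y) = 0 ∧ G (T, y) := by
  obtain ⟨N, hN, h | h⟩ := hmono
  · exact exists_zero_of_strictMono hF hφ hφ0 hN h hG
  · obtain ⟨ρ, hρ, hy⟩ := exists_zero_of_strictMono (F := fun z => -F z) (φ := fun T => -φ T)
      (hF.mono fun z hz => hz.neg) (hφ.mono fun T hT => by rw [hT]) (by simp [hφ0]) hN
      (fun x hx y hy hxy => neg_lt_neg (h hx hy hxy)) hG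
    refine ⟨ρ, hρ, fun y h1 => ?_⟩
    obtain ⟨T, hT, hT2⟩ := hy y h1
    exact ⟨T, neg_eq_zero.1 hT, hT2⟩

/-- The branch of solutions of three equations for three parameters. -/
theorem exists_branch {E : Type*} [NormedAddCommGroup E] [NormedSpace ℝ E] [CompleteSpace E]
    {a b : ℝ × ℝ → ℝ} {g : ℝ × ℝ × ℝ → ℝ} {R₁ R₂ R₃ : (ℝ × ℝ × ℝ) × E → ℝ} {φ : ℝ → ℝ}
    {c₀ κ₀ T₀ d : ℝ}
    (ha : AnalyticAt ℝ a (κ₀, T₀)) (hb : AnalyticAt ℝ b (κ₀, T₀)) (ha0 : a (κ₀, T₀) = c₀)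
    (hb0 : b (κ₀, T₀) = c₀) (hd : HasDerivAt (fun κ => a (κ, T₀) - b (κ, T₀)) d κ₀) (hd0 : d ≠ 0)
    (hR₁ : AnalyticAt ℝ R₁ ((c₀, κ₀, T₀), 0)) (hR₂ : AnalyticAt ℝ R₂ ((c₀, κ₀, T₀), 0))
    (hq₁ : QuadAt R₁ (c₀, κ₀, T₀)) (hq₂ : QuadAt R₂ (c₀, κ₀, T₀))
    (hg : AnalyticAt ℝ g (c₀, κ₀, T₀)) (hR₃ : AnalyticAt ℝ R₃ ((c₀, κ₀, T₀), 0))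
    (hq₃ : QuadAt R₃ (c₀, κ₀, T₀))
    (hφ : ∀ᶠ p in 𝓝 (c₀, κ₀, T₀), p.1 = a p.2 → p.1 = b p.2 → g p = φ p.2.2)
    (hφ0 : φ T₀ = 0) (hmono : ∃ N ∈ 𝓝 T₀, StrictMonoOn φ N ∨ StrictAntiOn φ N)
    {G : ℝ × ℝ × ℝ → Prop} (hG : ∀ᶠ p in 𝓝 (c₀, κ₀, T₀), G p) :
    ∃ ρ : ℝ, 0 < ρ ∧ ∃ Q : E → ℝ × ℝ × ℝ,
      (∀ y, ‖y‖ < ρ → G (Q y) ∧ (Q y).1 = a (Q y).2 + R₁ (Q y, y) ∧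
        (Q y).1 = b (Q y).2 + R₂ (Q y, y) ∧ g (Q y) + R₃ (Q y, y) = 0) ∧
      (deriv φ T₀ ≠ 0 → (∀ y, ‖y‖ < ρ → AnalyticAt ℝ Q y) ∧
        ∃ C : ℝ, ∀ y, ‖y‖ < ρ → ‖Q y - (c₀, κ₀, T₀)‖ ≤ C * ‖y‖ ^ 2) := by
  obtain ⟨P, P₀, p1, p2, p3, p4, p5, p6, p7, p8, p9⟩ :=
    exists_two_param ha hb ha0 hb0 hd hd0 hR₁ hR₂ hq₁ hq₂
  let F : ℝ × E → ℝ := fun z => g (P z) + R₃ (P z, z.2)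
  have hFa : AnalyticAt ℝ F (T₀, 0) := by
    refine AnalyticAt.add ?_ ?_
    · exact AnalyticAt.fun_comp (f := P) (by rw [p2]; exact hg) p1
    · exact AnalyticAt.fun_comp (f := fun z : ℝ × E => (P z, z.2)) (by rw [p2]; exact hR₃)
        (p1.prod analyticAt_snd)
  have hq₃P : QuadAt (fun z : ℝ × E => R₃ (P z, z.2)) T₀ := hq₃.comp p1.continuousAt p2
  have hgP₀ : ∀ᶠ T in 𝓝 T₀, g (P₀ T) = φ T := by
    have h1 : Tendsto P₀ (𝓝 T₀) (𝓝 (c₀, κ₀, T₀)) := by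
      have := p3.continuousAt.tendsto
      rwa [p4] at this
    filter_upwards [h1.eventually hφ, p8] with T h2 h3
    rw [h2 h3.1 h3.2, p6]
  have hF0 : ∀ᶠ T in 𝓝 T₀, F (T, 0) = φ T := by
    filter_upwards [hgP₀, p9.eq_zero, hq₃P.eq_zero] with T h1 h2 h3
    have h4 : P (T, 0) = P₀ T := sub_eq_zero.1 (norm_eq_zero.1 h2)
    simp only [F]
    rw [h3, h4, h1, add_zero]
  have hPt : Tendsto P (𝓝 (T₀, 0)) (𝓝 (c₀, κ₀, T₀)) := by
    have := p1.continuousAt.tendsto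
    rwa [p2] at this
  have hgood := (hPt.eventually hG).and p7
  -- Without a nonzero derivative the root `T` is merely chosen for each `y`, with no continuity
  -- claimed.
  by_cases hdφ : deriv φ T₀ = 0
  · obtain ⟨ρ, hρ, hy⟩ := exists_zero_of_strict (hFa.eventually_analyticAt.mono
      fun z hz => hz.continuousAt) hF0 hφ0 hmono hgood
    choose! T hT hT2 using hy
    exact ⟨ρ, hρ, fun y => P (T y, y), fun y h1 => ⟨(hT2 y h1).1, (hT2 y h1).2.1, (hT2 y h1).2.2,
      hT y h1⟩, fun h => (h hdφ).elim⟩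
  -- A nonzero value of `deriv` certifies differentiability, since its default value is zero.
  · have hdF : HasDerivAt (fun T => F (T, 0)) (deriv φ T₀) T₀ :=
      (differentiableAt_of_deriv_ne_zero hdφ).hasDerivAt.congr_of_eventuallyEq hF0
    obtain ⟨T, t1, t2, t3, K, hK⟩ := exists_analytic_implicit_scalar hFa
      (hF0.self_of_nhds.trans hφ0) hdF hdφ
    have hTa : AnalyticAt ℝ (fun y : E => (T y, y)) 0 := t1.prod analyticAt_id
    have hTt : Tendsto (fun y : E => (T y, y)) (𝓝 0) (𝓝 (T₀, 0)) := by
      have := hTa.continuousAt.tendsto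
      rwa [t2] at this
    have hQa : AnalyticAt ℝ (fun y : E => P (T y, y)) 0 :=
      AnalyticAt.fun_comp (f := fun y : E => (T y, y)) (by rw [t2]; exact p1) hTa
    -- the quadratic bounds
    obtain ⟨C₁, hC₁0, hC₁⟩ := p9
    obtain ⟨C₂, hC₂0, hC₂⟩ := hq₃P
    obtain ⟨L, hL0, hL⟩ := exists_lipschitz hg
    obtain ⟨M, hM0, hM⟩ := exists_lipschitz p3
    have hc0 : Tendsto (fun y : E => (T₀, y)) (𝓝 0) (𝓝 (T₀, 0)) :=
      (Continuous.prodMk_right T₀).tendsto 0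
    have hLt : Tendsto (fun y : E => (P (T₀, y), (c₀, κ₀, T₀))) (𝓝 0)
        (𝓝 ((c₀, κ₀, T₀), (c₀, κ₀, T₀))) := (hPt.comp hc0).prodMk_nhds tendsto_const_nhds
    have hMt : Tendsto (fun y : E => (T y, T₀)) (𝓝 0) (𝓝 (T₀, T₀)) := by
      have := t1.continuousAt.tendsto
      rw [t2] at this
      exact this.prodMk_nhds tendsto_const_nhds
    have hg0 : g (c₀, κ₀, T₀) = 0 := by
      have := hgP₀.self_of_nhds
      rwa [p4, hφ0] at this
    -- Two errors add up: `P` differs from `P₀` by `O(‖y‖²)`, and `|T y - T₀|` is bounded by a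
    -- multiple of `|F(T₀, y)|`, itself `O(‖y‖²)` because `g` vanishes at the base point.
    have hbd : ∀ᶠ y in 𝓝 (0 : E), ‖P (T y, y) - (c₀, κ₀, T₀)‖ ≤
        (C₁ + M * (max K 0 * (L * C₁ + C₂))) * ‖y‖ ^ 2 := by
      filter_upwards [hTt.eventually hC₁, hc0.eventually hC₁, hc0.eventually hC₂,
        hLt.eventually hL, hMt.eventually hM, hc0.eventually hK] with y h1 h2 h3 h4 h5 h6
      simp only [abs_norm, p4] at h1 h2 h5 h6
      rw [Real.norm_eq_abs] at h4 h5
      have e1 : |F (T₀, y)| ≤ (L * C₁ + C₂) * ‖y‖ ^ 2 := by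
        calc |F (T₀, y)| ≤ |g (P (T₀, y))| + |R₃ (P (T₀, y), y)| := abs_add_le _ _
          _ ≤ L * (C₁ * ‖y‖ ^ 2) + C₂ * ‖y‖ ^ 2 := by
              refine add_le_add ?_ h3
              have h7 : |g (P (T₀, y)) - g (c₀, κ₀, T₀)| ≤ L * ‖P (T₀, y) - (c₀, κ₀, T₀)‖ := h4
              rw [hg0, sub_zero] at h7
              exact h7.trans (by gcongr)
          _ = _ := by ring
      have e2 : |T y - T₀| ≤ max K 0 * ((L * C₁ + C₂) * ‖y‖ ^ 2) := by
        rw [abs_sub_comm]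
        refine h6.trans ?_
        gcongr
        exact le_max_left _ _
      calc ‖P (T y, y) - (c₀, κ₀, T₀)‖
          ≤ ‖P (T y, y) - P₀ (T y)‖ + ‖P₀ (T y) - (c₀, κ₀, T₀)‖ := norm_sub_le_norm_sub_add_norm_sub _ _ _
        _ ≤ C₁ * ‖y‖ ^ 2 + M * (max K 0 * ((L * C₁ + C₂) * ‖y‖ ^ 2)) := by
            refine add_le_add h1 (h5.trans ?_)
            gcongr
        _ = _ := by ring
    obtain ⟨ρ, hρ, hall⟩ := Metric.eventually_nhds_iff_ball.1
      (((hTt.eventually hgood).and t3).and (hQa.eventually_analyticAt.and hbd))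
    have hall' : ∀ y : E, ‖y‖ < ρ → _ := fun y hy => hall y (by simpa using hy)
    refine ⟨ρ, hρ, fun y => P (T y, y), fun y hy => ?_, fun _ => 
      ⟨fun y hy => ?_, C₁ + M * (max K 0 * (L * C₁ + C₂)), fun y hy => ?_⟩⟩
    · obtain ⟨⟨⟨h1, h2⟩, h3⟩, -⟩ := hall' y hy
      exact ⟨h1, h2.1, h2.2, h3⟩
    · exact (hall' y hy).2.1
    · exact (hall' y hy).2.2

/-! ### The reduced equations near a symmetry breaking point. -/

/-- The parameters and coefficients `p = (c, κ, T)`, `U` solve the reduced equations with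
variables `y`. -/
structure IsReducedSolution (k₁ k₂ : ℕ) (τ : ℝ) (p : ℝ × ℝ × ℝ) (U : L1 Idx ℝ)
    (y : ℝ × ℝ × ℝ) : Prop where
  c_pos : 0 < p.1
  κ_pos : 0 < p.2.1
  T_mem : p.2.2 ∈ Ioo (0 : ℝ) (1 / 3)
  profile : IsProfile k₁ k₂ τ (ell k₁ k₂ p.1 p.2.1 p.2.2) U
  ne : ∀ n : ℤ, n.natAbs ≠ k₁ → n.natAbs ≠ k₂ → p.1 ≠ symbol p.2.2 (p.2.1 * n)
  fst : (p.1 - symbol p.2.2 (p.2.1 * k₁)) * (τ / 2) = redFst k₁ k₂ (conv U U) y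
  snd : (p.1 - symbol p.2.2 (p.2.1 * k₂)) * (τ / 2) = redSnd k₁ k₂ (conv U U) y
  im : redIm k₁ k₂ (conv U U) y = conv U U (critIdx k₁ k₂)

theorem quadAt_of_bound {P : Type*} [NormedAddCommGroup P] [NormedSpace ℝ P] {V : P → L1 Idx ℝ}
    {p : P} (hV : ContinuousAt V p) {R : L1 Idx ℝ → ℝ × ℝ × ℝ → ℝ}
    (hR : ∀ V y, 3 * ‖y‖ ≤ 1 → |R V y| ≤ ‖V‖ * (3 * ‖y‖) ^ 2) (K : ℝ) :
    QuadAt (fun z : P × (ℝ × ℝ × ℝ) => K * R (V z.1) z.2) p := by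
  refine ⟨|K| * ((‖V p‖ + 1) * 9), by positivity, ?_⟩
  have h1 : ∀ᶠ z : P × (ℝ × ℝ × ℝ) in 𝓝 (p, 0), ‖V z.1‖ < ‖V p‖ + 1 :=
    (continuousAt_fst (p := (p, (0 : ℝ × ℝ × ℝ)))).eventually
      (hV.norm.eventually (gt_mem_nhds (by linarith)))
  have h2 : ∀ᶠ z : P × (ℝ × ℝ × ℝ) in 𝓝 (p, 0), 3 * ‖z.2‖ < 1 := by
    have : Continuous fun z : P × (ℝ × ℝ × ℝ) => 3 * ‖z.2‖ := by fun_prop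
    exact this.continuousAt.eventually (gt_mem_nhds (by simp))
  filter_upwards [h1, h2] with z hz1 hz2
  rw [abs_mul, mul_assoc]
  refine mul_le_mul_of_nonneg_left ((hR _ _ hz2.le).trans ?_) (abs_nonneg K)
  rw [mul_pow, mul_assoc]
  norm_num
  gcongr

theorem IsDoubleBifurcationPoint.symbol_eq {k₁ k₂ : ℕ} {c κ T : ℝ}
    (h : IsDoubleBifurcationPoint k₁ k₂ c κ T) :
    c = symbol T (κ * k₁) ∧ c = symbol T (κ * k₂) ∧
      ∀ n : ℕ, 0 < n → n ≠ k₁ → n ≠ k₂ → c ≠ symbol T (κ * n) := by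
  obtain ⟨-, -, -, -, h⟩ := h
  have h1 : ∀ n : ℕ, (0 < n ∧ c = symbol T (κ * n)) ↔ n = k₁ ∨ n = k₂ := fun n => by
    have := Set.ext_iff.1 h n
    simpa using this
  exact ⟨((h1 k₁).2 (Or.inl rfl)).2, ((h1 k₂).2 (Or.inr rfl)).2,
    fun n h2 h3 h4 h5 => ((h1 n).1 ⟨h2, h5⟩).elim h3 h4⟩

/-- The branch of solutions of the reduced equations near a symmetry breaking point. -/
theorem exists_reduced_branch {k₁ k₂ : ℕ} (hk₁ : 2 ≤ k₁) (hk : k₁ < k₂) (hcop : Nat.Coprime k₁ k₂)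
    {c₀ κ₀ T₀ : ℝ} (hsb : IsSymmetryBreakingPoint k₁ k₂ c₀ κ₀ T₀) {δ : ℝ} (hδ : 0 < δ) :
    ∃ τ M ρ : ℝ, 0 < τ ∧ 0 < ρ ∧ ∃ (U : ℝ × ℝ × ℝ → L1 Idx ℝ) (Q : ℝ × ℝ × ℝ → ℝ × ℝ × ℝ),
      (∀ y, ‖y‖ < ρ → IsReducedSolution k₁ k₂ τ (Q y) (U (Q y)) y ∧ AnalyticAt ℝ U (Q y) ∧
        ‖U (Q y)‖ ≤ M ∧ ‖Q y - (c₀, κ₀, T₀)‖ < δ) ∧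
      (IsNondegenerate k₁ k₂ T₀ → (∀ y, ‖y‖ < ρ → AnalyticAt ℝ Q y) ∧
        ∃ C : ℝ, ∀ y, ‖y‖ < ρ → ‖Q y - (c₀, κ₀, T₀)‖ ≤ C * ‖y‖ ^ 2) := by
  obtain ⟨hbif, hφ0, hmono⟩ := hsb
  obtain ⟨hc₁, hc₂, hne⟩ := hbif.symbol_eq
  obtain ⟨hc, hκ, hT, -, -⟩ := hbif
  have hk₁0 : 0 < k₁ := by omega
  have hk₂0 : 0 < k₂ := by omega
  obtain ⟨hT3, hc1⟩ := bif_lt hk₁0 hk hκ hT (hc₁.symm.trans hc₂)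
  obtain ⟨L, hLa, hL⟩ := exists_analytic_ell hk₁0 hk₂0 hκ hT (by rw [hc₁]; exact hc1.ne) hne
  obtain ⟨τ, hτ, U', hU'a, hU'⟩ := exists_series k₁ k₂ (L (c₀, κ₀, T₀))
  obtain ⟨d, hd0, hd⟩ := exists_hasDerivAt_symbol_sub hk₁0 hk hκ hT (hc₁.symm.trans hc₂)
  let U : ℝ × ℝ × ℝ → L1 Idx ℝ := fun p => U' (L p)
  have hUa : AnalyticAt ℝ U (c₀, κ₀, T₀) := AnalyticAt.fun_comp (f := L) hU'a hLa
  have hU : ∀ᶠ p in 𝓝 (c₀, κ₀, T₀),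
      IsProfile k₁ k₂ τ (ell k₁ k₂ p.1 p.2.1 p.2.2) (U p) := by
    filter_upwards [hLa.continuousAt.eventually hU', hL] with p h1 h2
    refine ⟨hτ, ell_neg _ _ _ _ _, fun m => ?_⟩
    have h3 : (L p : ℤ → ℝ) = ell k₁ k₂ p.1 p.2.1 p.2.2 := funext fun n => (h2 n).1
    rw [h1, h3]
  let V : ℝ × ℝ × ℝ → L1 Idx ℝ := fun p => conv (U p) (U p)
  have hVa : AnalyticAt ℝ V (c₀, κ₀, T₀) := analyticAt_bilin conv hUa hUa
  let N := order (critIdx k₁ k₂)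
  have hτN : (τ ^ N) ≠ 0 := pow_ne_zero _ hτ.ne'
  have hpos : ∀ᶠ p : ℝ × ℝ × ℝ in 𝓝 (c₀, κ₀, T₀), 0 < p.1 ∧ 0 < p.2.1 ∧ 0 < p.2.2 ∧ p.2.2 < 1 / 3 := by
    have e1 : Continuous fun p : ℝ × ℝ × ℝ => p.1 := by fun_prop
    have e2 : Continuous fun p : ℝ × ℝ × ℝ => p.2.1 := by fun_prop
    have e3 : Continuous fun p : ℝ × ℝ × ℝ => p.2.2 := by fun_prop
    exact (e1.continuousAt.eventually (lt_mem_nhds hc)).and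
      ((e2.continuousAt.eventually (lt_mem_nhds hκ)).and
        ((e3.continuousAt.eventually (lt_mem_nhds hT)).and
          (e3.continuousAt.eventually (gt_mem_nhds hT3))))
  have hφ : ∀ᶠ p : ℝ × ℝ × ℝ in 𝓝 (c₀, κ₀, T₀), p.1 = symbol p.2.2 (p.2.1 * k₁) →
      p.1 = symbol p.2.2 (p.2.1 * k₂) → (τ ^ N)⁻¹ * V p (critIdx k₁ k₂) = phi k₁ k₂ p.2.2 := by
    filter_upwards [hU, hpos] with p h1 h2 h3 h4
    have h5 := bifPair_eq hk₁0 hk h2.1 h2.2.1 h2.2.2.1 h3.symm h4.symm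
    -- The index defining `phi` is the conjugate of `critIdx`, and both have the same coefficient.
    -- Removing the weight `τ ^ N` then identifies the third equation at a crossing with `phi`.
    have h6 : Prod.swap (critIdx k₁ k₂) = ((k₂ - 1, 0), (0, k₁)) := rfl
    rw [phi, h5, conv_eq_uSqHat h1.eq, ← uSqHat_swap _ _ h1.even, h6, mul_comm (uSqHat _ _ _ _),
      inv_mul_cancel_left₀ hτN]
  have hdist : ∀ᶠ p in 𝓝 (c₀, κ₀, T₀), ‖p - (c₀, κ₀, T₀)‖ < δ := by
    filter_upwards [Metric.ball_mem_nhds (c₀, κ₀, T₀) hδ] with p hp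
    rwa [Metric.mem_ball, dist_eq_norm] at hp
  have hM : ∀ᶠ p in 𝓝 (c₀, κ₀, T₀), ‖U p‖ < ‖U (c₀, κ₀, T₀)‖ + 1 :=
    hUa.continuousAt.norm.eventually (gt_mem_nhds (by linarith))
  have hR : ∀ {R : L1 Idx ℝ → ℝ × ℝ × ℝ → ℝ} (K : ℝ),
      AnalyticAt ℝ (fun z : (ℝ × ℝ × ℝ) × (ℝ × ℝ × ℝ) => R (V z.1) z.2) ((c₀, κ₀, T₀), 0) →
      AnalyticAt ℝ (fun z : (ℝ × ℝ × ℝ) × (ℝ × ℝ × ℝ) => K * R (V z.1) z.2) ((c₀, κ₀, T₀), 0) :=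
    fun K h => analyticAt_const.mul h
  obtain ⟨ρ, hρ, Q, hQ, hQ2⟩ := exists_branch (φ := phi k₁ k₂)
    (a := fun z : ℝ × ℝ => symbol z.2 (z.1 * k₁)) (b := fun z : ℝ × ℝ => symbol z.2 (z.1 * k₂))
    (g := fun p => (τ ^ N)⁻¹ * V p (critIdx k₁ k₂))
    (R₁ := fun z => 2 / τ * redFst k₁ k₂ (V z.1) z.2)
    (R₂ := fun z => 2 / τ * redSnd k₁ k₂ (V z.1) z.2)
    (R₃ := fun z => -(τ ^ N)⁻¹ * redIm k₁ k₂ (V z.1) z.2)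
    (analyticAt_symbol hκ hT hk₁0) (analyticAt_symbol hκ hT hk₂0) hc₁.symm hc₂.symm hd hd0
    (hR _ (analyticAt_modeSum _ _ (by norm_num) hVa))
    (hR _ (analyticAt_modeSum _ _ (by norm_num) hVa))
    (quadAt_of_bound hVa.continuousAt (fun V y hy => abs_redFst_le hk₁ hk hcop V hy) _)
    (quadAt_of_bound hVa.continuousAt (fun V y hy => abs_redSnd_le hk₁ hk hcop V hy) _)
    (analyticAt_const.mul (analyticAt_lin (lp.evalCLM ℝ (fun _ : Idx => ℝ) 1 (critIdx k₁ k₂)) hVa))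
    (hR _ (analyticAt_modeSum _ _ (by norm_num) hVa))
    (quadAt_of_bound hVa.continuousAt (fun V y hy => abs_redIm_le hk₁ hk hcop V hy) _)
    hφ hφ0 hmono (hpos.and (hU.and (hL.and (hdist.and (hM.and hUa.eventually_analyticAt)))))
  refine ⟨τ, ‖U (c₀, κ₀, T₀)‖ + 1, ρ, hτ, hρ, U, Q, fun y hy => ?_, hQ2⟩
  obtain ⟨⟨h1, h2, h3, h4, h5, h6⟩, h7, h8, h9⟩ := hQ y hy
  refine ⟨⟨h1.1, h1.2.1, h1.2.2, h2, fun n => (h3 n).2, ?_, ?_, ?_⟩, h6, h5.le, h4⟩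
  · simp only at h7
    rw [h7, add_sub_cancel_left]
    field_simp
    rfl
  · simp only at h8
    rw [h8, add_sub_cancel_left]
    field_simp
    rfl
  · simp only at h9
    have h10 : (τ ^ N)⁻¹ * (V (Q y) (critIdx k₁ k₂) - redIm k₁ k₂ (V (Q y)) y) = 0 := by
      linear_combination h9
    exact (sub_eq_zero.1 ((mul_eq_zero.1 h10).resolve_left (inv_ne_zero hτN))).symm

/-! ## The solution as a function -/

/-- The map into the Zygmund space carries weights `2^{-|m|}`; evaluating the monomials at doubled
amplitudes compensates for them. -/
theorem mono_two_smul_polar {ρ : ℝ × ℝ} (h : 2 * ‖ρ‖ ≤ 1) (φ : ℝ × ℝ) (m : Idx) :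
    mono (polar (2 • ρ) φ) m * (1 / 2) ^ order m = mono (polar ρ φ) m := by
  have h1 : |ρ.1| ≤ ‖ρ‖ := norm_fst_le ρ
  have h2 : |ρ.2| ≤ ‖ρ‖ := norm_snd_le ρ
  have e1 : (2 • ρ).1 = 2 * ρ.1 := by simp
  have e2 : (2 • ρ).2 = 2 * ρ.2 := by simp
  have a1 : |2 * ρ.1| ≤ 1 := by
    rw [abs_mul, abs_two]
    linarith
  have a2 : |2 * ρ.2| ≤ 1 := by
    rw [abs_mul, abs_two]
    linarith
  rw [mono_polar (by rwa [e1]) (by rwa [e2]), mono_polar (by linarith [norm_nonneg ρ])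
    (by linarith [norm_nonneg ρ]), e1, e2]
  have e3 : ((2 : ℂ)) ^ (m.1.1 + m.2.1) * 2 ^ (m.1.2 + m.2.2) * (1 / 2) ^ order m = 1 := by
    have e4 : m.1.1 + m.2.1 + (m.1.2 + m.2.2) = order m := by
      rw [order]
      ring
    rw [← pow_add, e4, ← mul_pow]
    norm_num
  push_cast
  rw [mul_pow, mul_pow]
  linear_combination (((ρ.1 : ℂ) ^ (m.1.1 + m.2.1) * (ρ.2 : ℂ) ^ (m.1.2 + m.2.2)) *
    Complex.exp ((((m.1.1 : ℂ) - m.2.1) * φ.1 + ((m.1.2 : ℂ) - m.2.2) * φ.2) * Complex.I)) * e3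

theorem fourier_coe_eq_exp (n : ℤ) (x : ℝ) :
    (fourier n (x : Torus) : ℂ) = Complex.exp ((n * x : ℝ) * Complex.I) := by
  rw [fourier_coe_apply]
  congr 1
  have : (Real.pi : ℂ) ≠ 0 := by exact_mod_cast Real.pi_ne_zero
  push_cast
  field_simp

theorem mono_polar_mul_fourier {k₁ k₂ : ℕ} {ρ : ℝ × ℝ} (h : ‖ρ‖ ≤ 1) (φ : ℝ × ℝ) (m : Idx)
    (x : ℝ) : mono (polar ρ φ) m * (fourier (mode k₁ k₂ m) (x : Torus) : ℂ) =
      mono (polar ρ (φ.1 + k₁ * x, φ.2 + k₂ * x)) m := by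
  have h1 : |ρ.1| ≤ 1 := (norm_fst_le ρ).trans h
  have h2 : |ρ.2| ≤ 1 := (norm_snd_le ρ).trans h
  rw [mono_polar h1 h2, mono_polar h1 h2, fourier_coe_eq_exp, mul_assoc, ← Complex.exp_add, mode]
  congr 2
  push_cast
  ring

/-- The hypotheses say that `ρ_j e^{iψ_j}` is real, so the angles `ψ - t` and `ψ + t` give conjugate
points, and monomials respect conjugation. -/
theorem mono_polar_neg {ρ : ℝ × ℝ} (h : ‖ρ‖ ≤ 1) {ψ : ℝ × ℝ} (h1 : ρ.1 * Real.sin ψ.1 = 0)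
    (h2 : ρ.2 * Real.sin ψ.2 = 0) (t : ℝ × ℝ) (m : Idx) :
    mono (polar ρ (ψ - t)) m = conj (mono (polar ρ (ψ + t)) m) := by
  have key : ∀ r x s : ℝ, r * Real.sin x = 0 → (r : ℂ) * Complex.exp ((x - s : ℝ) * Complex.I) =
      conj ((r : ℂ) * Complex.exp ((x + s : ℝ) * Complex.I)) := by
    intro r x s hr
    have e1 : ∀ y : ℝ, Complex.exp (y * Complex.I) = (Real.cos y : ℂ) + Real.sin y * Complex.I := by
      intro y
      rw [Complex.exp_mul_I, Complex.ofReal_cos, Complex.ofReal_sin]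
    have e2 : r * Real.cos (x - s) = r * Real.cos (x + s) := by
      rw [Real.cos_sub, Real.cos_add]
      linear_combination (2 * Real.sin s) * hr
    have e3 : r * Real.sin (x - s) = -(r * Real.sin (x + s)) := by
      rw [Real.sin_sub, Real.sin_add]
      linear_combination (2 * Real.cos s) * hr
    have e2' : (r : ℂ) * (Real.cos (x - s) : ℝ) = r * (Real.cos (x + s) : ℝ) := by
      exact_mod_cast e2
    have e3' : (r : ℂ) * (Real.sin (x - s) : ℝ) = -(r * (Real.sin (x + s) : ℝ)) := by
      exact_mod_cast e3
    rw [e1, e1]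
    simp only [map_mul, map_add, Complex.conj_ofReal, Complex.conj_I]
    linear_combination e2' + Complex.I * e3'
  have a1 : |ρ.1| ≤ 1 := (norm_fst_le ρ).trans h
  have a2 : |ρ.2| ≤ 1 := (norm_snd_le ρ).trans h
  rw [mono_apply (by rwa [norm_polar_fst]) (by rwa [norm_polar_snd]),
    mono_apply (by rwa [norm_polar_fst]) (by rwa [norm_polar_snd])]
  have p1 : (polar ρ (ψ - t)).1 = conj (polar ρ (ψ + t)).1 := key _ _ _ h1
  have p2 : (polar ρ (ψ - t)).2 = conj (polar ρ (ψ + t)).2 := key _ _ _ h2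
  rw [p1, p2]
  simp only [map_mul, map_pow, Complex.conj_conj]

theorem norm_polar_le {ρ φ : ℝ × ℝ} {R : ℝ} (h : ‖ρ‖ ≤ R) :
    ‖(polar ρ φ).1‖ ≤ R ∧ ‖(polar ρ φ).2‖ ≤ R := by
  rw [norm_polar_fst, norm_polar_snd]
  exact ⟨(norm_fst_le ρ).trans h, (norm_snd_le ρ).trans h⟩

open Classical in
/-- The norm of a tail of the family of monomials. -/
theorem norm_ind_mul_mono_le {ρ : ℝ × ℝ} (h : ‖ρ‖ ≤ 1) (φ : ℝ × ℝ) (N : ℕ) :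
    ‖ind ℂ {m : Idx | N ≤ order m} * mono (polar ρ φ)‖ ≤ ‖ρ‖ ^ N := by
  refine (BoundedContinuousFunction.norm_le (by positivity)).2 fun m => ?_
  rw [BoundedContinuousFunction.mul_apply, ind_apply]
  split_ifs with h1
  · rw [one_mul]
    have h2 := norm_polar_le (φ := φ) (le_refl ‖ρ‖)
    exact (norm_mono_le h h2.1 h2.2 m).trans (pow_le_pow_of_le_one (norm_nonneg _) h h1)
  · rw [zero_mul, norm_zero]
    positivity

section solution

variable {k₁ k₂ : ℕ} {s : ℝ} {Z : L1 Idx ℂ →L[ℝ] Zygmund s} {τ : ℝ} {l : ℤ → ℝ} {U : L1 Idx ℝ}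
  {ρ : ℝ × ℝ}

/-- The solution with amplitudes `ρ` and phases `φ`. -/
def wave (Z : L1 Idx ℂ →L[ℝ] Zygmund s) (U : L1 Idx ℝ) (ρ φ : ℝ × ℝ) : Zygmund s :=
  Z (mulL Idx ℂ U (mono (polar (2 • ρ) φ)))

/-- The nonlinear part of the solution. -/
def waveRem (Z : L1 Idx ℂ →L[ℝ] Zygmund s) (U : L1 Idx ℝ) (ρ φ : ℝ × ℝ) : Zygmund s :=
  Z (mulL Idx ℂ U (ind ℂ {m : Idx | 2 ≤ order m} * mono (polar (2 • ρ) φ)))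

open Classical in
/-- The coefficients of the nonlinear part of the solution. -/
def profileRem (U : L1 Idx ℝ) (z : ℂ × ℂ) (m : Idx) : ℂ :=
  if 2 ≤ order m then profile U z m else 0

theorem wave_toCont
    (hZ : ∀ a, (Z a).toCont = reSyn (mode k₁ k₂) fun m => a m * (1 / 2) ^ order m)
    (h : 2 * ‖ρ‖ ≤ 1) (φ : ℝ × ℝ) :
    (wave Z U ρ φ).toCont = reSyn (mode k₁ k₂) (profile U (polar ρ φ)) := by
  rw [wave, hZ]
  congr 1
  funext m
  rw [mulL_apply, profile, ← mono_two_smul_polar h, Complex.real_smul]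
  ring

theorem waveRem_toCont
    (hZ : ∀ a, (Z a).toCont = reSyn (mode k₁ k₂) fun m => a m * (1 / 2) ^ order m)
    (h : 2 * ‖ρ‖ ≤ 1) (φ : ℝ × ℝ) :
    (waveRem Z U ρ φ).toCont = reSyn (mode k₁ k₂) (profileRem U (polar ρ φ)) := by
  rw [waveRem, hZ]
  congr 1
  funext m
  rw [mulL_apply, profileRem, profile, ← mono_two_smul_polar h, Complex.real_smul,
    BoundedContinuousFunction.mul_apply, ind_apply, mem_ofPred_eq]
  split_ifs <;> ring

theorem summable_profileRem {z : ℂ × ℂ} (h1 : ‖z.1‖ ≤ 1 / 2) (h2 : ‖z.2‖ ≤ 1 / 2) :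
    Summable fun m => ‖profileRem U z m‖ := by
  refine Summable.of_nonneg_of_le (fun _ => norm_nonneg _) (fun m => ?_)
    (summable_profile (U := U) h1 h2)
  rw [profileRem]
  split_ifs <;> simp

theorem norm_two_smul_le (ρ : ℝ × ℝ) : ‖2 • ρ‖ ≤ 2 * ‖ρ‖ := by
  have := norm_nsmul_le (n := 2) (a := ρ)
  simpa using this

theorem norm_waveRem_le (h : 2 * ‖ρ‖ ≤ 1) (φ : ℝ × ℝ) :
    ‖waveRem Z U ρ φ‖ ≤ ‖Z‖ * (‖U‖ * (2 * ‖ρ‖) ^ 2) := by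
  have h1 := norm_two_smul_le ρ
  refine (Z.le_opNorm _).trans (mul_le_mul_of_nonneg_left ?_ (norm_nonneg _))
  refine (norm_mulL_le _ _).trans (mul_le_mul_of_nonneg_left ?_ (norm_nonneg _))
  refine (norm_ind_mul_mono_le (h1.trans h) φ 2).trans ?_
  gcongr

theorem norm_wave_le (hU : IsProfile k₁ k₂ τ l U) (h : 2 * ‖ρ‖ ≤ 1) (φ : ℝ × ℝ) :
    ‖wave Z U ρ φ‖ ≤ ‖Z‖ * (‖U‖ * (2 * ‖ρ‖)) := by
  classical
  have h1 := norm_two_smul_le ρ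
  have h2 : mulL Idx ℂ U (mono (polar (2 • ρ) φ)) =
      mulL Idx ℂ U (ind ℂ {m : Idx | 1 ≤ order m} * mono (polar (2 • ρ) φ)) := by
    refine lp.ext (funext fun m => ?_)
    rw [mulL_apply, mulL_apply, BoundedContinuousFunction.mul_apply, ind_apply, mem_ofPred_eq]
    split_ifs with h3
    · rw [one_mul]
    · have h4 : m = 0 := order_eq_zero.1 (by omega)
      rw [h4, hU.zero, zero_smul, zero_smul]
  rw [wave, h2]
  refine (Z.le_opNorm _).trans (mul_le_mul_of_nonneg_left ?_ (norm_nonneg _))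
  refine (norm_mulL_le _ _).trans (mul_le_mul_of_nonneg_left ?_ (norm_nonneg _))
  refine (norm_ind_mul_mono_le (h1.trans h) φ 1).trans ?_
  rwa [pow_one]

theorem norm_polar_le_half (h : 2 * ‖ρ‖ ≤ 1) (φ : ℝ × ℝ) :
    ‖(polar ρ φ).1‖ ≤ 1 / 2 ∧ ‖(polar ρ φ).2‖ ≤ 1 / 2 :=
  norm_polar_le (by linarith)

theorem hasSum_wave_eval
    (hZ : ∀ a, (Z a).toCont = reSyn (mode k₁ k₂) fun m => a m * (1 / 2) ^ order m)
    (h : 2 * ‖ρ‖ ≤ 1) (φ : ℝ × ℝ) (x : ℝ) :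
    HasSum (fun m => (profile U (polar ρ (φ.1 + k₁ * x, φ.2 + k₂ * x)) m).re)
      ((wave Z U ρ φ).eval x) := by
  obtain ⟨h1, h2⟩ := norm_polar_le_half h φ
  have h3 : (wave Z U ρ φ).eval x = (syn (mode k₁ k₂) (profile U (polar ρ φ)) x).re := by
    rw [Zygmund.eval, wave_toCont hZ h]
    rfl
  rw [h3]
  refine (Complex.hasSum_re (hasSum_syn_apply (mode k₁ k₂) (summable_profile h1 h2) x)).congr_fun
    fun m => ?_
  rw [profile, profile, mul_assoc, mono_polar_mul_fourier (by linarith [norm_nonneg ρ])]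

theorem hasSum_waveRem_eval
    (hZ : ∀ a, (Z a).toCont = reSyn (mode k₁ k₂) fun m => a m * (1 / 2) ^ order m)
    (h : 2 * ‖ρ‖ ≤ 1) (φ : ℝ × ℝ) (x : ℝ) :
    HasSum (fun m => (profileRem U (polar ρ (φ.1 + k₁ * x, φ.2 + k₂ * x)) m).re)
      ((waveRem Z U ρ φ).eval x) := by
  obtain ⟨h1, h2⟩ := norm_polar_le_half h φ
  have h3 : (waveRem Z U ρ φ).eval x = (syn (mode k₁ k₂) (profileRem U (polar ρ φ)) x).re := by
    rw [Zygmund.eval, waveRem_toCont hZ h]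
    rfl
  rw [h3]
  refine (Complex.hasSum_re
    (hasSum_syn_apply (mode k₁ k₂) (summable_profileRem h1 h2) x)).congr_fun fun m => ?_
  rw [profileRem, profileRem]
  split_ifs
  · rw [profile, profile, mul_assoc, mono_polar_mul_fourier (by linarith [norm_nonneg ρ])]
  · rw [zero_mul]

theorem profile_sub_profileRem {z : ℂ × ℂ} (hU : IsProfile k₁ k₂ τ l U) (h1 : ‖z.1‖ ≤ 1)
    (h2 : ‖z.2‖ ≤ 1) : HasSum (fun m => (profile U z m).re - (profileRem U z m).re)
      (τ * z.1.re + τ * z.2.re) := by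
  let F : Finset Idx := {((1, 0), (0, 0)), ((0, 1), (0, 0)), ((0, 0), (1, 0)), ((0, 0), (0, 1))}
  have h3 : HasSum (fun m => (profile U z m).re - (profileRem U z m).re)
      (∑ m ∈ F, ((profile U z m).re - (profileRem U z m).re)) := by
    refine hasSum_sum_of_ne_finset_zero fun m hm => ?_
    by_cases h4 : 2 ≤ order m
    · rw [profileRem, if_pos h4, sub_self]
    · have h5 : m = 0 := by
        obtain ⟨⟨a, b⟩, ⟨c, d⟩⟩ := m
        simp only [F, Finset.mem_insert, Finset.mem_singleton, Prod.mk.injEq] at hm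
        simp only [order] at h4
        simp only [Prod.mk_eq_zero]
        omega
      rw [h5, profileRem, if_neg (by simp [order]), profile, hU.zero]
      simp
  have h6 : ∀ m : Idx, order m = 1 → (profile U z m).re - (profileRem U z m).re =
      τ / 2 * (mono z m).re := by
    intro m hm
    rw [profileRem, if_neg (by omega), Complex.zero_re, sub_zero, profile, hU.of_order_eq_one hm,
      Complex.re_ofReal_mul]
  have h7 : ∑ m ∈ F, ((profile U z m).re - (profileRem U z m).re) = τ * z.1.re + τ * z.2.re := by
    simp only [F]
    rw [Finset.sum_insert (by decide), Finset.sum_insert (by decide),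
      Finset.sum_insert (by decide), Finset.sum_singleton, h6 _ rfl, h6 _ rfl, h6 _ rfl, h6 _ rfl]
    simp only [mono_apply h1 h2, pow_zero, pow_one, mul_one, one_mul, Complex.conj_re]
    ring
  rwa [h7] at h3

theorem wave_eval_eq
    (hZ : ∀ a, (Z a).toCont = reSyn (mode k₁ k₂) fun m => a m * (1 / 2) ^ order m)
    (hU : IsProfile k₁ k₂ τ l U) (h : 2 * ‖ρ‖ ≤ 1) (φ : ℝ × ℝ) (x : ℝ) :
    (wave Z U ρ φ).eval x = τ * ρ.1 * Real.cos (φ.1 + k₁ * x) +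
      τ * ρ.2 * Real.cos (φ.2 + k₂ * x) + (waveRem Z U ρ φ).eval x := by
  obtain ⟨h1, h2⟩ := norm_polar_le_half h (φ.1 + k₁ * x, φ.2 + k₂ * x)
  have h3 := (hasSum_wave_eval (U := U) hZ h φ x).sub (hasSum_waveRem_eval (U := U) hZ h φ x)
  have h4 := h3.unique (profile_sub_profileRem hU (by linarith) (by linarith))
  have h5 : ∀ r y : ℝ, ((r : ℂ) * Complex.exp (y * Complex.I)).re = r * Real.cos y := by
    intro r y
    rw [Complex.re_ofReal_mul, Complex.exp_ofReal_mul_I_re]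
  simp only [polar, h5] at h4
  linarith

end solution

/-! ## Orthogonality and symmetry -/

theorem integral_eq_zero_of_coeff {f : C(Torus, ℝ)} {k : ℕ} (h : coeff f k = 0) :
    (∫ x in (0 : ℝ)..(2 * Real.pi), f x * Real.cos (k * x)) = 0 ∧
      (∫ x in (0 : ℝ)..(2 * Real.pi), f x * Real.sin (k * x)) = 0 := by
  have hf : Continuous fun x : ℝ => f (x : Torus) :=
    f.continuous.comp (AddCircle.continuous_mk' _)
  have h1 : (∫ x in (0 : ℝ)..(2 * Real.pi),
      Complex.exp (-(k * x : ℝ) * Complex.I) * (f (x : Torus) : ℂ)) = 0 := by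
    rw [coeff, fourierCoeff_eq_intervalIntegral _ _ 0, zero_add, smul_eq_zero] at h
    have h2 := h.resolve_left (one_div_ne_zero Real.two_pi_pos.ne')
    rw [← h2]
    refine intervalIntegral.integral_congr fun x _ => ?_
    change _ = (fourier (-(k : ℤ)) (x : Torus) : ℂ) • (f (x : Torus) : ℂ)
    rw [fourier_coe_eq_exp, smul_eq_mul]
    push_cast
    ring_nf
  have hi : IntervalIntegrable (fun x : ℝ =>
      Complex.exp (-(k * x : ℝ) * Complex.I) * (f (x : Torus) : ℂ)) volume 0 (2 * Real.pi) := by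
    refine Continuous.intervalIntegrable ?_ _ _
    exact (by fun_prop : Continuous fun x : ℝ => Complex.exp (-(k * x : ℝ) * Complex.I)).mul
      (Complex.continuous_ofReal.comp hf)
  have e : ∀ x : ℝ, Complex.exp (-(k * x : ℝ) * Complex.I) =
      (Real.cos (k * x) : ℂ) - Real.sin (k * x) * Complex.I := by
    intro x
    rw [Complex.exp_mul_I, Complex.cos_neg, Complex.sin_neg, Complex.ofReal_cos,
      Complex.ofReal_sin]
    ring
  constructor
  · have h2 : (∫ x in (0 : ℝ)..(2 * Real.pi), (Complex.exp (-(k * x : ℝ) * Complex.I) *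
        (f (x : Torus) : ℂ)).re) = (∫ x in (0 : ℝ)..(2 * Real.pi),
        Complex.exp (-(k * x : ℝ) * Complex.I) * (f (x : Torus) : ℂ)).re :=
      Complex.reCLM.intervalIntegral_comp_comm hi
    rw [h1, Complex.zero_re] at h2
    refine Eq.trans ?_ h2
    refine intervalIntegral.integral_congr fun x _ => ?_
    rw [Complex.re_mul_ofReal, e]
    simp [mul_comm, -Complex.ofReal_natCast, -Complex.ofReal_mul, -Complex.ofReal_cos,
      -Complex.ofReal_sin]
  · have h2 : (∫ x in (0 : ℝ)..(2 * Real.pi), (Complex.exp (-(k * x : ℝ) * Complex.I) *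
        (f (x : Torus) : ℂ)).im) = (∫ x in (0 : ℝ)..(2 * Real.pi),
        Complex.exp (-(k * x : ℝ) * Complex.I) * (f (x : Torus) : ℂ)).im :=
      Complex.imCLM.intervalIntegral_comp_comm hi
    rw [h1, Complex.zero_im] at h2
    rw [← neg_eq_zero, ← intervalIntegral.integral_neg]
    refine Eq.trans ?_ h2
    refine intervalIntegral.integral_congr fun x _ => ?_
    rw [Complex.im_mul_ofReal, e]
    simp [mul_comm, -Complex.ofReal_natCast, -Complex.ofReal_mul, -Complex.ofReal_cos,
      -Complex.ofReal_sin]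

/-- The Fourier coefficients of a function that is symmetric about `a`. -/
theorem coeff_of_symmetric {f : C(Torus, ℝ)} {a : ℝ}
    (h : ∀ x : ℝ, f ((-x + a : ℝ) : Torus) = f ((x + a : ℝ) : Torus)) (n : ℤ) :
    coeff f n = (fourier (-n) ((2 * a : ℝ) : Torus) : ℂ) * coeff f (-n) := by
  have h1 : ∀ t : Torus, f (((2 * a : ℝ) : Torus) - t) = f t := by
    intro t
    induction t using QuotientAddGroup.induction_on with
    | H x =>
      have := h (x - a)
      rw [sub_add_cancel] at this
      rw [← this, show -(x - a) + a = 2 * a - x by ring]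
      rfl
  rw [coeff, coeff, fourierCoeff, fourierCoeff, ← integral_sub_left_eq_self _ _
    (((2 * a : ℝ) : Torus)), ← integral_const_mul]
  congr 1
  funext t
  rw [h1, smul_eq_mul, smul_eq_mul, ← mul_assoc]
  congr 1
  simp only [fourier_apply, sub_eq_add_neg, smul_add, AddCircle.toCircle_add, Circle.coe_mul, neg_neg, neg_smul, smul_neg]

/-- Symmetry about `a` combined with reality gives `f̂(k) = e^{-2ika} conj f̂(k)`; equivalently, `r
e^{i(φ + ka)}` is real. -/
theorem mul_sin_eq_zero_of_symmetric {f : C(Torus, ℝ)} {a : ℝ}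
    (h : ∀ x : ℝ, f ((-x + a : ℝ) : Torus) = f ((x + a : ℝ) : Torus)) {k : ℕ} {r φ : ℝ}
    (hk : coeff f k = (r : ℂ) * Complex.exp (φ * Complex.I)) : r * Real.sin (φ + k * a) = 0 := by
  have h1 := coeff_of_symmetric h k
  have h2 : coeff f (-k) = conj (coeff f k) :=
    fc_neg_of_real (v := ⟨fun x => (f x : ℂ), Complex.continuous_ofReal.comp f.continuous⟩)
      (fun x => Complex.conj_ofReal _) k
  rw [h2, hk, fourier_coe_eq_exp, map_mul, Complex.conj_ofReal, ← Complex.exp_conj, map_mul,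
    Complex.conj_ofReal, Complex.conj_I] at h1
  have h3 : (r : ℂ) * Complex.exp ((φ + k * a : ℝ) * Complex.I) =
      r * Complex.exp (-(φ + k * a : ℝ) * Complex.I) := by
    have e1 : Complex.exp ((φ + k * a : ℝ) * Complex.I) =
        Complex.exp (φ * Complex.I) * Complex.exp ((k * a : ℝ) * Complex.I) := by
      rw [← Complex.exp_add]
      push_cast
      ring_nf
    have e2 : Complex.exp (((-(k : ℤ) : ℤ) * (2 * a) : ℝ) * Complex.I) *
        Complex.exp (φ * -Complex.I) * Complex.exp ((k * a : ℝ) * Complex.I) =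
        Complex.exp (-(φ + k * a : ℝ) * Complex.I) := by
      rw [← Complex.exp_add, ← Complex.exp_add]
      push_cast
      ring_nf
    rw [e1, ← e2]
    linear_combination (Complex.exp ((k * a : ℝ) * Complex.I)) * h1
  have h4 := congrArg Complex.im h3
  rw [Complex.im_ofReal_mul, Complex.im_ofReal_mul, Complex.exp_ofReal_mul_I_im,
    ← Complex.ofReal_neg, Complex.exp_ofReal_mul_I_im, Real.sin_neg] at h4
  linarith

/-- The arithmetic of the symmetry condition. -/
theorem exists_sin_iff {k₁ k₂ : ℕ} (hk₁ : 0 < k₁) (hk₂ : 0 < k₂) (hcop : Nat.Coprime k₁ k₂)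
    (r θ : ℝ × ℝ) :
    (∃ a : ℝ, r.1 * Real.sin (k₁ * θ.1 + k₁ * a) = 0 ∧ r.2 * Real.sin (k₂ * θ.2 + k₂ * a) = 0) ↔
      ¬(r.1 * r.2 ≠ 0 ∧ ∀ n : ℤ, θ.1 - θ.2 ≠ n * (Real.pi / (k₁ * k₂))) := by
  have c₁ : (k₁ : ℝ) ≠ 0 := by positivity
  have c₂ : (k₂ : ℝ) ≠ 0 := by positivity
  constructor
  · rintro ⟨a, h1, h2⟩ ⟨h3, h4⟩
    obtain ⟨n₁, hn₁⟩ := Real.sin_eq_zero_iff.1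
      ((mul_eq_zero.1 h1).resolve_left (left_ne_zero_of_mul h3))
    obtain ⟨n₂, hn₂⟩ := Real.sin_eq_zero_iff.1
      ((mul_eq_zero.1 h2).resolve_left (right_ne_zero_of_mul h3))
    refine h4 (n₁ * k₂ - n₂ * k₁) ?_
    field_simp
    push_cast
    linear_combination -(k₂ : ℝ) * hn₁ + k₁ * hn₂
  · intro h
    by_cases h1 : r.1 = 0
    · refine ⟨-θ.2, by rw [h1, zero_mul], ?_⟩
      rw [show (k₂ : ℝ) * θ.2 + k₂ * -θ.2 = 0 by ring, Real.sin_zero, mul_zero]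
    by_cases h2 : r.2 = 0
    · refine ⟨-θ.1, ?_, by rw [h2, zero_mul]⟩
      rw [show (k₁ : ℝ) * θ.1 + k₁ * -θ.1 = 0 by ring, Real.sin_zero, mul_zero]
    push Not at h
    obtain ⟨n, hn⟩ := h (mul_ne_zero h1 h2)
    have hb := Nat.gcd_eq_gcd_ab k₁ k₂
    rw [hcop.gcd_eq_one] at hb
    have hb' : (1 : ℝ) = k₁ * Nat.gcdA k₁ k₂ + k₂ * Nat.gcdB k₁ k₂ := by exact_mod_cast hb
    have hn' : (θ.1 - θ.2) * (k₁ * k₂) = n * Real.pi := by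
      rw [hn]
      field_simp
    -- This `a` makes the first angle `n · gcdB · π`. By Bézout's identity the second is then `-n ·
    -- gcdA · π`.
    refine ⟨n * Nat.gcdB k₁ k₂ * Real.pi / k₁ - θ.1, ?_, ?_⟩
    · rw [show (k₁ : ℝ) * θ.1 + k₁ * (n * Nat.gcdB k₁ k₂ * Real.pi / k₁ - θ.1) =
        ((n * Nat.gcdB k₁ k₂ : ℤ) : ℝ) * Real.pi by
          push_cast
          field_simp
          ring, Real.sin_int_mul_pi, mul_zero]
    · rw [show (k₂ : ℝ) * θ.2 + k₂ * (n * Nat.gcdB k₁ k₂ * Real.pi / k₁ - θ.1) =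
        ((-(n * Nat.gcdA k₁ k₂) : ℤ) : ℝ) * Real.pi by
          push_cast
          field_simp
          linear_combination -hn' + (-n * Real.pi) * hb', Real.sin_int_mul_pi, mul_zero]

section solution

variable {k₁ k₂ : ℕ} {s : ℝ} {Z : L1 Idx ℂ →L[ℝ] Zygmund s} {τ : ℝ} {l : ℤ → ℝ} {U : L1 Idx ℝ}
  {ρ : ℝ × ℝ}

/-- Terms of order at least two in the modes `± n` carry the factor `l (± n) = 0`. This gives the
orthogonality to the kernel. -/
theorem coeff_waveRem
    (hZ : ∀ a, (Z a).toCont = reSyn (mode k₁ k₂) fun m => a m * (1 / 2) ^ order m)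
    (hU : IsProfile k₁ k₂ τ l U) (h : 2 * ‖ρ‖ ≤ 1) (φ : ℝ × ℝ) {n : ℤ} (hl : l n = 0) :
    coeff (waveRem Z U ρ φ).toCont n = 0 := by
  obtain ⟨h1, h2⟩ := norm_polar_le_half h φ
  rw [waveRem_toCont hZ h]
  refine (hasSum_coeff_reSyn (mode k₁ k₂) (summable_profileRem h1 h2) n).unique
    (hasSum_zero.congr_fun fun m => ?_)
  have key : ∀ j, mode k₁ k₂ m = j → l j = 0 → profileRem U (polar ρ φ) m = 0 := by
    intro j hj hlj
    rw [profileRem]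
    split_ifs with h3
    · rw [profile, hU.of_order_ne_one (by omega), hj, hlj, zero_mul, Complex.ofReal_zero, zero_mul]
    · rfl
  have e1 : (if mode k₁ k₂ m = n then profileRem U (polar ρ φ) m else 0) = 0 := by
    split_ifs with h3
    · exact key n h3 hl
    · rfl
  have e2 : (if -mode k₁ k₂ m = n then conj (profileRem U (polar ρ φ) m) else 0) = 0 := by
    split_ifs with h3
    · rw [key (-n) (by omega) (by rw [hU.even, hl]), map_zero]
    · rfl
  rw [e1, e2]
  simp

/-- Necessity comes from the Fourier coefficients in the modes `k₁` and `k₂`, which are `τ/2` times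
`ρ_j e^{iφ_j}`. Conversely, if both translated amplitudes are real, reflection conjugates every
monomial, and the real coefficients `U` leave the real part unchanged. -/
theorem isSymmetric_wave_iff
    (hZ : ∀ a, (Z a).toCont = reSyn (mode k₁ k₂) fun m => a m * (1 / 2) ^ order m)
    (hk₁ : 0 < k₁) (hk : k₁ < k₂) (hU : IsProfile k₁ k₂ τ l U) (h : 2 * ‖ρ‖ ≤ 1) (φ : ℝ × ℝ)
    (hl1 : l k₁ = 0) (hl2 : l k₂ = 0) :
    IsSymmetric (wave Z U ρ φ).eval ↔
      ∃ a : ℝ, ρ.1 * Real.sin (φ.1 + k₁ * a) = 0 ∧ ρ.2 * Real.sin (φ.2 + k₂ * a) = 0 := by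
  obtain ⟨h1, h2⟩ := norm_polar_le_half h φ
  have hτ : τ / 2 ≠ 0 := (half_pos hU.pos).ne'
  constructor
  · rintro ⟨a, ha⟩
    refine ⟨a, ?_⟩
    have hreal := conj_syn_profile (k₁ := k₁) (k₂ := k₂) hU h1 h2
    have hs : ∀ x : ℝ, (wave Z U ρ φ).toCont ((-x + a : ℝ) : Torus) =
        (wave Z U ρ φ).toCont ((x + a : ℝ) : Torus) := fun x => ha x
    have e1 : coeff (wave Z U ρ φ).toCont k₁ =
        ((τ / 2 * ρ.1 : ℝ) : ℂ) * Complex.exp (φ.1 * Complex.I) := by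
      rw [wave_toCont hZ h, coeff_reSyn_of_real hreal, fc_profile_fst hk₁ hk hU h1 h2 hl1, polar]
      push_cast
      ring
    have e2 : coeff (wave Z U ρ φ).toCont k₂ =
        ((τ / 2 * ρ.2 : ℝ) : ℂ) * Complex.exp (φ.2 * Complex.I) := by
      rw [wave_toCont hZ h, coeff_reSyn_of_real hreal, fc_profile_snd hk₁ hk hU h1 h2 hl2, polar]
      push_cast
      ring
    have f1 := mul_sin_eq_zero_of_symmetric hs e1
    have f2 := mul_sin_eq_zero_of_symmetric hs e2
    rw [mul_assoc] at f1 f2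
    exact ⟨(mul_eq_zero.1 f1).resolve_left hτ, (mul_eq_zero.1 f2).resolve_left hτ⟩
  · rintro ⟨a, ha1, ha2⟩
    refine ⟨a, fun x => ?_⟩
    refine (hasSum_wave_eval (U := U) hZ h φ (-x + a)).unique
      ((hasSum_wave_eval (U := U) hZ h φ (x + a)).congr_fun fun m => ?_)
    have e1 : ((φ.1 + k₁ * (-x + a), φ.2 + k₂ * (-x + a)) : ℝ × ℝ) =
        (φ.1 + k₁ * a, φ.2 + k₂ * a) - (k₁ * x, k₂ * x) := by
      ext <;> simp <;> ring
    have e2 : ((φ.1 + k₁ * (x + a), φ.2 + k₂ * (x + a)) : ℝ × ℝ) =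
        (φ.1 + k₁ * a, φ.2 + k₂ * a) + (k₁ * x, k₂ * x) := by
      ext <;> simp <;> ring
    have hρ : ‖ρ‖ ≤ 1 := by linarith [norm_nonneg ρ]
    rw [e1, e2, profile, profile,
      mono_polar_neg hρ (ψ := (φ.1 + k₁ * a, φ.2 + k₂ * a)) ha1 ha2 (k₁ * x, k₂ * x) m,
      Complex.re_ofReal_mul, Complex.re_ofReal_mul, Complex.conj_re]

theorem isSolution_wave
    (hZ : ∀ a, (Z a).toCont = reSyn (mode k₁ k₂) fun m => a m * (1 / 2) ^ order m)
    (hk₁ : 2 ≤ k₁) (hk : k₁ < k₂) (hcop : Nat.Coprime k₁ k₂) {p : ℝ × ℝ × ℝ} {φ : ℝ × ℝ}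
    (h : IsReducedSolution k₁ k₂ τ p U (redVar ρ (k₂ * φ.1 - k₁ * φ.2))) (hρ : 3 * ‖ρ‖ ≤ 1) :
    IsSolution (wave Z U ρ φ) p.1 p.2.1 p.2.2 := by
  have hρ2 : 2 * ‖ρ‖ ≤ 1 := by linarith [norm_nonneg ρ]
  obtain ⟨h1, h2⟩ := norm_polar_le_half hρ2 φ
  refine isSolution_of_fc (conj_syn_profile h.profile h1 h2) (wave_toCont hZ hρ2 φ) ?_
  refine fc_profile_sq (σ := fun n => p.1 - symbol p.2.2 (p.2.1 * n)) hk₁ hk hcop h.profile hρ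
    (fun n => ?_) (by simp [ell]) (by simp [ell]) (fun n hn1 hn2 => ?_) ?_ ?_ h.im
  · rw [Int.cast_neg, mul_neg, symbol_neg]
  · rw [ell, if_neg (by tauto)]
    exact mul_inv_cancel₀ (sub_ne_zero.2 (h.ne n hn1 hn2))
  · exact h.fst
  · exact h.snd

end solution

/-! ## Phases -/

theorem phase_surjective (k₁ k₂ : ℕ) : Function.Surjective (phase k₁ k₂) := by
  rintro ⟨a, b⟩
  obtain ⟨x, rfl⟩ := QuotientAddGroup.mk_surjective a
  obtain ⟨y, rfl⟩ := QuotientAddGroup.mk_surjective b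
  exact ⟨(x, y), rfl⟩

/-- The phases `(k₁ θ₁, k₂ θ₂)`. -/
def scaled (k₁ k₂ : ℕ) (θ : ℝ × ℝ) : ℝ × ℝ := (k₁ * θ.1, k₂ * θ.2)

theorem exists_int_of_phase_eq {k : ℕ} (hk : 0 < k) {x y : ℝ}
    (h : (x : AddCircle (2 * Real.pi / k)) = y) : ∃ n : ℤ, k * x = k * y + n * (2 * Real.pi) := by
  have h1 : ((x - y : ℝ) : AddCircle (2 * Real.pi / k)) = 0 := by
    rw [AddCircle.coe_sub, h, sub_self]
  obtain ⟨n, hn⟩ := (AddCircle.coe_eq_zero_iff _).1 h1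
  refine ⟨n, ?_⟩
  have hk' : (k : ℝ) ≠ 0 := by positivity
  rw [zsmul_eq_mul] at hn
  field_simp at hn
  linear_combination -hn

/-- Representatives of one phase shift `k_jθ_j` by multiples of `2π`, and hence `ψ` as well, because
its coefficients `k₂` and `k₁` are integers. The constructed quantities therefore descend to `Θ`. -/
theorem polar_of_phase_eq {k₁ k₂ : ℕ} (hk₁ : 0 < k₁) (hk₂ : 0 < k₂) {θ θ' : ℝ × ℝ}
    (h : phase k₁ k₂ θ = phase k₁ k₂ θ') (ρ : ℝ × ℝ) :
    polar ρ (scaled k₁ k₂ θ) = polar ρ (scaled k₁ k₂ θ') ∧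
      redVar ρ (k₂ * (scaled k₁ k₂ θ).1 - k₁ * (scaled k₁ k₂ θ).2) =
        redVar ρ (k₂ * (scaled k₁ k₂ θ').1 - k₁ * (scaled k₁ k₂ θ').2) := by
  obtain ⟨n, hn⟩ := exists_int_of_phase_eq hk₁ (congrArg Prod.fst h)
  obtain ⟨m, hm⟩ := exists_int_of_phase_eq hk₂ (congrArg Prod.snd h)
  have key : ∀ (j : ℤ) (x : ℝ), Complex.exp (((x + j * (2 * Real.pi) : ℝ) : ℂ) * Complex.I) =
      Complex.exp (x * Complex.I) := by
    intro j x
    have : ((x + j * (2 * Real.pi) : ℝ) : ℂ) * Complex.I =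
        x * Complex.I + j * (2 * Real.pi * Complex.I) := by
      push_cast
      ring
    rw [this, Complex.exp_add, Complex.exp_int_mul_two_pi_mul_I, mul_one]
  constructor
  · simp only [polar, scaled]
    rw [hn, hm, key, key]
  · simp only [redVar, scaled]
    rw [hn, hm]
    congr 3
    rw [← Real.cos_add_int_mul_two_pi (k₂ * (k₁ * θ'.1) - k₁ * (k₂ * θ'.2)) (k₂ * n - k₁ * m)]
    congr 1
    push_cast
    ring

/-! ## Analytic dependence -/

section analytic

variable {E : Type*} [NormedAddCommGroup E] [NormedSpace ℝ E] {x : E}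

theorem analyticAt_ofReal_mul_exp {f g : E → ℝ} (hf : AnalyticAt ℝ f x) (hg : AnalyticAt ℝ g x) :
    AnalyticAt ℝ (fun x => (f x : ℂ) * Complex.exp (g x * Complex.I)) x := by
  have h1 : ∀ {f : E → ℝ}, AnalyticAt ℝ f x → AnalyticAt ℝ (fun x => (f x : ℂ)) x :=
    fun hf => analyticAt_lin Complex.ofRealCLM hf
  refine (h1 hf).mul ?_
  exact AnalyticAt.fun_comp (f := fun x => (g x : ℂ) * Complex.I)
    (analyticAt_cexp.restrictScalars (𝕜 := ℝ)) ((h1 hg).mul analyticAt_const)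

theorem analyticAt_wave {s : ℝ} (Z : L1 Idx ℂ →L[ℝ] Zygmund s) {U : E → L1 Idx ℝ}
    {ρ φ : E → ℝ × ℝ} (hU : AnalyticAt ℝ U x) (hρ : AnalyticAt ℝ ρ x) (hφ : AnalyticAt ℝ φ x)
    (h : 2 * ‖ρ x‖ < 1) : AnalyticAt ℝ (fun x => wave Z (U x) (ρ x) (φ x)) x := by
  have h0 : ‖2 • ρ x‖ < 1 := (norm_two_smul_le (ρ x)).trans_lt h
  have hρ2 : AnalyticAt ℝ (fun x => 2 • ρ x) x := by
    simp only [two_smul]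
    exact hρ.add hρ
  have hm : AnalyticAt ℝ (fun x => mono (polar (2 • ρ x) (φ x))) x := by
    refine analyticAt_mono (z := fun x => polar (2 • ρ x) (φ x)) ?_ ?_ ?_ ?_
    · exact analyticAt_ofReal_mul_exp (AnalyticAt.fun_comp (f := fun x => 2 • ρ x) analyticAt_fst hρ2)
        (AnalyticAt.fun_comp (f := φ) analyticAt_fst hφ)
    · exact analyticAt_ofReal_mul_exp (AnalyticAt.fun_comp (f := fun x => 2 • ρ x) analyticAt_snd hρ2)
        (AnalyticAt.fun_comp (f := φ) analyticAt_snd hφ)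
    · rw [norm_polar_fst]
      exact (norm_fst_le _).trans_lt h0
    · rw [norm_polar_snd]
      exact (norm_snd_le _).trans_lt h0
  exact analyticAt_lin Z (analyticAt_bilin (mulL Idx ℂ) hU hm)

end analytic

end

end Whitham

/-! ### Assembly of the solution family. -/

theorem mainTheorem2 (s : ℝ) (hs : 1 < s) (k₁ k₂ : ℕ) (hk₁ : 2 ≤ k₁) (hk : k₁ < k₂)
    (hcop : Nat.Coprime k₁ k₂) (c₀ κ₀ T₀ : ℝ)
    (hsb : Whitham.IsSymmetryBreakingPoint k₁ k₂ c₀ κ₀ T₀) (δ : ℝ) (hδ : 0 < δ) :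
    ∃ ε : ℝ, 0 < ε ∧
    ∃ (u : ℝ × ℝ → Whitham.Phases k₁ k₂ → Whitham.Zygmund s)
      (c κ T : ℝ × ℝ → Whitham.Phases k₁ k₂ → ℝ),
      -- the values are solutions near the bifurcation point
      (∀ r ∈ Whitham.amplitudes ε, ∀ θ : Whitham.Phases k₁ k₂,
        0 < c r θ ∧ 0 < κ r θ ∧ T r θ ∈ Set.Ioo (0 : ℝ) (1 / 3) ∧
        Whitham.IsSolution (u r θ) (c r θ) (κ r θ) (T r θ) ∧
        ‖u r θ‖ < δ ∧ |c r θ - c₀| < δ ∧ |κ r θ - κ₀| < δ ∧ |T r θ - T₀| < δ) ∧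
      -- the component of the solution in the kernel
      (∀ r ∈ Whitham.amplitudes ε, ∀ θ : ℝ × ℝ,
        Whitham.IsOrthogonalToV k₁ k₂ fun x =>
          (u r (Whitham.phase k₁ k₂ θ)).eval x - Whitham.bimodal k₁ k₂ r θ x) ∧
      -- the asymmetry condition
      (∀ r ∈ Whitham.amplitudes ε, ∀ θ : ℝ × ℝ,
        Whitham.IsAsymmetric (u r (Whitham.phase k₁ k₂ θ)).eval ↔
          r.1 * r.2 ≠ 0 ∧ ∀ n : ℤ, θ.1 - θ.2 ≠ n * (Real.pi / (k₁ * k₂))) ∧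
      -- the nondegenerate case
      (Whitham.IsNondegenerate k₁ k₂ T₀ →
        AnalyticOn ℝ (fun p : (ℝ × ℝ) × (ℝ × ℝ) => u p.1 (Whitham.phase k₁ k₂ p.2))
          (Whitham.amplitudes ε ×ˢ Set.univ) ∧
        AnalyticOn ℝ (fun p : (ℝ × ℝ) × (ℝ × ℝ) => c p.1 (Whitham.phase k₁ k₂ p.2))
          (Whitham.amplitudes ε ×ˢ Set.univ) ∧
        AnalyticOn ℝ (fun p : (ℝ × ℝ) × (ℝ × ℝ) => κ p.1 (Whitham.phase k₁ k₂ p.2))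
          (Whitham.amplitudes ε ×ˢ Set.univ) ∧
        AnalyticOn ℝ (fun p : (ℝ × ℝ) × (ℝ × ℝ) => T p.1 (Whitham.phase k₁ k₂ p.2))
          (Whitham.amplitudes ε ×ˢ Set.univ) ∧
        ∃ C : ℝ, ∀ r ∈ Whitham.amplitudes ε, ∀ θ : ℝ × ℝ,
          (∃ w : Whitham.Zygmund s,
            (∀ x : ℝ, (u r (Whitham.phase k₁ k₂ θ)).eval x =
              Whitham.bimodal k₁ k₂ r θ x + w.eval x) ∧
            ‖w‖ ≤ C * (r.1 ^ 2 + r.2 ^ 2)) ∧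
          |c r (Whitham.phase k₁ k₂ θ) - c₀| ≤ C * (r.1 ^ 2 + r.2 ^ 2) ∧
          |κ r (Whitham.phase k₁ k₂ θ) - κ₀| ≤ C * (r.1 ^ 2 + r.2 ^ 2) ∧
          |T r (Whitham.phase k₁ k₂ θ) - T₀| ≤ C * (r.1 ^ 2 + r.2 ^ 2)) := by
  obtain ⟨τ, M, ρ₀, hτ, hρ₀, U, Q, hQ, hQnd⟩ :=
    Whitham.exists_reduced_branch hk₁ hk hcop hsb hδ
  obtain ⟨Z, hZ⟩ := Whitham.exists_zygmund_syn (by linarith : 0 ≤ s) k₁ k₂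
  have hk₁0 : 0 < k₁ := by omega
  have hk₂0 : 0 < k₂ := by omega
  have hM : 0 ≤ M := (norm_nonneg _).trans (hQ 0 (by simpa using hρ₀)).2.2.1
  -- This is the constant of `norm_wave_le`, so the wave has norm at most `K ‖ρ‖`.
  let K : ℝ := 2 * ‖Z‖ * M
  have hK : 0 ≤ K := by positivity
  -- The three bounds keep `y` in the domain of the branch, meet the smallness `3‖ρ‖ ≤ 1` required
  -- by the Chebyshev estimates, and make the norm of the wave less than `δ`.
  let η : ℝ := min (min ρ₀ (1 / 3)) (δ / (K + 1))
  have hη : 0 < η := lt_min (lt_min hρ₀ (by norm_num)) (by positivity)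
  -- The linear coefficients of the weighted series are `τ / 2` rather than `1 / 2`; dividing the
  -- amplitudes by `τ` makes the linear part equal to `bimodal`.
  let ρ : ℝ × ℝ → ℝ × ℝ := fun r => τ⁻¹ • r
  let φ : ℝ × ℝ → ℝ × ℝ := Whitham.scaled k₁ k₂
  let Y : ℝ × ℝ → ℝ × ℝ → ℝ × ℝ × ℝ := fun r θ =>
    Whitham.redVar (ρ r) (k₂ * (φ θ).1 - k₁ * (φ θ).2)
  let V : ℝ × ℝ → ℝ × ℝ → Whitham.Zygmund s := fun r θ =>
    Whitham.wave Z (U (Q (Y r θ))) (ρ r) (φ θ)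
  -- The family is defined on `Θ` through an arbitrary choice of representatives. By `hY` and `hV`
  -- the choice is immaterial, so analyticity can be checked on `ℝ²`.
  let rep : Whitham.Phases k₁ k₂ → ℝ × ℝ :=
    Function.surjInv (Whitham.phase_surjective k₁ k₂)
  have hrep : ∀ θ, Whitham.phase k₁ k₂ (rep θ) = θ :=
    Function.surjInv_eq (Whitham.phase_surjective k₁ k₂)
  have hY : ∀ r θ, Y r (rep (Whitham.phase k₁ k₂ θ)) = Y r θ := fun r θ =>
    (Whitham.polar_of_phase_eq hk₁0 hk₂0 (hrep _) (ρ r)).2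
  have hV : ∀ r θ, V r (rep (Whitham.phase k₁ k₂ θ)) = V r θ := fun r θ => by
    simp only [V, Whitham.wave]
    rw [hY, (Whitham.polar_of_phase_eq hk₁0 hk₂0 (hrep _) (2 • ρ r)).1]
  have hρr : ∀ r, ‖ρ r‖ = τ⁻¹ * ‖r‖ := fun r => by
    rw [norm_smul, Real.norm_eq_abs, abs_of_pos (inv_pos.2 hτ)]
  have hsmall : ∀ r ∈ Whitham.amplitudes (τ * η), ‖ρ r‖ < η := by
    rintro r ⟨h1, h2⟩
    rw [hρr, inv_mul_lt_iff₀ hτ]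
    refine (max_lt ?_ ?_ : max ‖r.1‖ ‖r.2‖ < τ * η)
    · rw [Real.norm_eq_abs, abs_of_nonneg h1.1]
      exact h1.2
    · rw [Real.norm_eq_abs, abs_of_nonneg h2.1]
      exact h2.2
  have hρY : ∀ r θ, ‖Y r θ‖ ≤ ‖ρ r‖ := fun r θ => Whitham.norm_redVar_le _ _
  have hYlt : ∀ r ∈ Whitham.amplitudes (τ * η), ∀ θ, ‖Y r θ‖ < ρ₀ := fun r hr θ =>
    ((hρY r θ).trans_lt (hsmall r hr)).trans_le ((min_le_left _ _).trans (min_le_left _ _))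
  have h3 : ∀ r ∈ Whitham.amplitudes (τ * η), 3 * ‖ρ r‖ ≤ 1 := fun r hr => by
    have h4 : η ≤ 1 / 3 := (min_le_left _ _).trans (min_le_right _ _)
    linarith [hsmall r hr]
  have h2 : ∀ r ∈ Whitham.amplitudes (τ * η), 2 * ‖ρ r‖ < 1 := fun r hr => by
    have h4 : η ≤ 1 / 3 := (min_le_left _ _).trans (min_le_right _ _)
    linarith [hsmall r hr]
  have hsq : ∀ r : ℝ × ℝ, ‖r‖ ^ 2 ≤ r.1 ^ 2 + r.2 ^ 2 := by
    intro r
    rcases max_choice ‖r.1‖ ‖r.2‖ with h | h <;> rw [Prod.norm_def, h, Real.norm_eq_abs, sq_abs]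
    · exact le_add_of_nonneg_right (sq_nonneg _)
    · exact le_add_of_nonneg_left (sq_nonneg _)
  have hcomp : ∀ p q : ℝ × ℝ × ℝ, |p.1 - q.1| ≤ ‖p - q‖ ∧ |p.2.1 - q.2.1| ≤ ‖p - q‖ ∧
      |p.2.2 - q.2.2| ≤ ‖p - q‖ := fun p q =>
    ⟨norm_fst_le (p - q), (norm_fst_le (p - q).2).trans (norm_snd_le (p - q)),
      (norm_snd_le (p - q).2).trans (norm_snd_le (p - q))⟩
  have hell : ∀ p : ℝ × ℝ × ℝ, Whitham.ell k₁ k₂ p.1 p.2.1 p.2.2 k₁ = 0 ∧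
      Whitham.ell k₁ k₂ p.1 p.2.1 p.2.2 k₂ = 0 := fun p => by
    constructor <;> simp [Whitham.ell]
  have hsplit : ∀ r ∈ Whitham.amplitudes (τ * η), ∀ (θ : ℝ × ℝ) (x : ℝ), (V r θ).eval x =
      Whitham.bimodal k₁ k₂ r θ x +
        (Whitham.waveRem Z (U (Q (Y r θ))) (ρ r) (φ θ)).eval x := by
    intro r hr θ x
    rw [Whitham.wave_eval_eq hZ (hQ _ (hYlt r hr θ)).1.profile (h2 r hr).le]
    congr 1
    simp only [ρ, φ, Whitham.scaled, Whitham.bimodal, Prod.smul_fst, Prod.smul_snd, smul_eq_mul,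
      mul_inv_cancel_left₀ hτ.ne', mul_add, add_comm]
  refine ⟨τ * η, mul_pos hτ hη, fun r θ => V r (rep θ), fun r θ => (Q (Y r (rep θ))).1,
    fun r θ => (Q (Y r (rep θ))).2.1, fun r θ => (Q (Y r (rep θ))).2.2, ?_, ?_, ?_, ?_⟩
  · intro r hr θ
    obtain ⟨hsol, -, hUM, hd⟩ := hQ _ (hYlt r hr (rep θ))
    obtain ⟨d1, d2, d3⟩ := hcomp (Q (Y r (rep θ))) (c₀, κ₀, T₀)
    refine ⟨hsol.c_pos, hsol.κ_pos, hsol.T_mem,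
      Whitham.isSolution_wave hZ hk₁ hk hcop hsol (h3 r hr), ?_, d1.trans_lt hd, d2.trans_lt hd,
      d3.trans_lt hd⟩
    refine (Whitham.norm_wave_le hsol.profile (h2 r hr).le _).trans_lt ?_
    have h5 : ‖ρ r‖ ≤ δ / (K + 1) := (hsmall r hr).le.trans (min_le_right _ _)
    calc ‖Z‖ * (‖U (Q (Y r (rep θ)))‖ * (2 * ‖ρ r‖)) ≤ ‖Z‖ * (M * (2 * (δ / (K + 1)))) := by
          gcongr
      _ = K * δ / (K + 1) := by
          simp only [K]
          ring
      _ < δ := by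
          rw [div_lt_iff₀ (by positivity)]
          linarith
  · intro r hr θ k hkk
    have hprof := (hQ _ (hYlt r hr θ)).1.profile
    have hl : Whitham.ell k₁ k₂ (Q (Y r θ)).1 (Q (Y r θ)).2.1 (Q (Y r θ)).2.2 k = 0 := by
      rcases hkk with rfl | rfl
      exacts [(hell _).1, (hell _).2]
    have h5 := Whitham.integral_eq_zero_of_coeff
      (Whitham.coeff_waveRem (Z := Z) hZ hprof (h2 r hr).le (φ θ) hl)
    simp only [hV, hsplit r hr θ, add_sub_cancel_left]
    exact h5
  · intro r hr θ
    obtain ⟨hl1, hl2⟩ := hell (Q (Y r θ))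
    simp only [hV, Whitham.IsAsymmetric]
    rw [Whitham.isSymmetric_wave_iff hZ hk₁0 hk (hQ _ (hYlt r hr θ)).1.profile (h2 r hr).le _ hl1
      hl2, ← not_iff_not, not_not, ← Whitham.exists_sin_iff hk₁0 hk₂0 hcop r θ]
    simp only [ρ, φ, Whitham.scaled, Prod.smul_fst, Prod.smul_snd, smul_eq_mul, mul_assoc,
      mul_eq_zero, inv_eq_zero, hτ.ne', false_or]
  · intro hnd
    obtain ⟨hQa, C₀, hC₀⟩ := hQnd hnd
    simp only [hV, hY]
    have hρa : ∀ p : (ℝ × ℝ) × (ℝ × ℝ),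
        AnalyticAt ℝ (fun p : (ℝ × ℝ) × (ℝ × ℝ) => ρ p.1) p := fun p =>
      analyticAt_const.fun_smul analyticAt_fst
    have hφa : ∀ p : (ℝ × ℝ) × (ℝ × ℝ),
        AnalyticAt ℝ (fun p : (ℝ × ℝ) × (ℝ × ℝ) => φ p.2) p := fun p => by
      refine AnalyticAt.prod ?_ ?_ <;> fun_prop
    have hYa : ∀ p : (ℝ × ℝ) × (ℝ × ℝ),
        AnalyticAt ℝ (fun p : (ℝ × ℝ) × (ℝ × ℝ) => Y p.1 p.2) p := by
      intro p
      have a1 : AnalyticAt ℝ (fun p : (ℝ × ℝ) × (ℝ × ℝ) => (ρ p.1).1) p :=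
        AnalyticAt.fun_comp (f := fun p : (ℝ × ℝ) × (ℝ × ℝ) => ρ p.1) analyticAt_fst (hρa p)
      have a2 : AnalyticAt ℝ (fun p : (ℝ × ℝ) × (ℝ × ℝ) => (ρ p.1).2) p :=
        AnalyticAt.fun_comp (f := fun p : (ℝ × ℝ) × (ℝ × ℝ) => ρ p.1) analyticAt_snd (hρa p)
      have a3 : AnalyticAt ℝ (fun p : (ℝ × ℝ) × (ℝ × ℝ) => (φ p.2).1) p :=
        AnalyticAt.fun_comp (f := fun p : (ℝ × ℝ) × (ℝ × ℝ) => φ p.2) analyticAt_fst (hφa p)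
      have a4 : AnalyticAt ℝ (fun p : (ℝ × ℝ) × (ℝ × ℝ) => (φ p.2).2) p :=
        AnalyticAt.fun_comp (f := fun p : (ℝ × ℝ) × (ℝ × ℝ) => φ p.2) analyticAt_snd (hφa p)
      have a5 : AnalyticAt ℝ (fun p : (ℝ × ℝ) × (ℝ × ℝ) =>
          Real.cos (k₂ * (φ p.2).1 - k₁ * (φ p.2).2)) p :=
        AnalyticAt.fun_comp (g := Real.cos)
          (f := fun p : (ℝ × ℝ) × (ℝ × ℝ) => k₂ * (φ p.2).1 - k₁ * (φ p.2).2)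
          Real.analyticAt_cos ((analyticAt_const.mul a3).sub (analyticAt_const.mul a4))
      exact a1.prod (a2.prod (a1.mul a5))
    have hPa : ∀ p ∈ Whitham.amplitudes (τ * η) ×ˢ (Set.univ : Set (ℝ × ℝ)),
        AnalyticAt ℝ (fun p : (ℝ × ℝ) × (ℝ × ℝ) => Q (Y p.1 p.2)) p := fun p hp =>
      AnalyticAt.fun_comp (f := fun p : (ℝ × ℝ) × (ℝ × ℝ) => Y p.1 p.2)
        (hQa _ (hYlt p.1 hp.1 p.2)) (hYa p)
    have hP2a : ∀ p ∈ Whitham.amplitudes (τ * η) ×ˢ (Set.univ : Set (ℝ × ℝ)),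
        AnalyticAt ℝ (fun p : (ℝ × ℝ) × (ℝ × ℝ) => (Q (Y p.1 p.2)).2) p := fun p hp =>
      AnalyticAt.fun_comp (f := fun p : (ℝ × ℝ) × (ℝ × ℝ) => Q (Y p.1 p.2)) analyticAt_snd
        (hPa p hp)
    refine ⟨fun p hp => ?_, fun p hp => ?_, fun p hp => ?_, fun p hp => ?_,
      |C₀| * τ⁻¹ ^ 2 + ‖Z‖ * (M * (4 * τ⁻¹ ^ 2)), fun r hr θ => ?_⟩
    · exact (Whitham.analyticAt_wave Z (AnalyticAt.fun_comp
        (f := fun p : (ℝ × ℝ) × (ℝ × ℝ) => Q (Y p.1 p.2)) (hQ _ (hYlt p.1 hp.1 p.2)).2.1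
        (hPa p hp)) (hρa p) (hφa p) (h2 p.1 hp.1)).analyticWithinAt
    · exact (AnalyticAt.fun_comp (f := fun p : (ℝ × ℝ) × (ℝ × ℝ) => Q (Y p.1 p.2))
        analyticAt_fst (hPa p hp)).analyticWithinAt
    · exact (AnalyticAt.fun_comp (f := fun p : (ℝ × ℝ) × (ℝ × ℝ) => (Q (Y p.1 p.2)).2)
        analyticAt_fst (hP2a p hp)).analyticWithinAt
    · exact (AnalyticAt.fun_comp (f := fun p : (ℝ × ℝ) × (ℝ × ℝ) => (Q (Y p.1 p.2)).2)
        analyticAt_snd (hP2a p hp)).analyticWithinAt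
    · obtain ⟨d1, d2, d3⟩ := hcomp (Q (Y r θ)) (c₀, κ₀, T₀)
      have b1 : ‖Q (Y r θ) - (c₀, κ₀, T₀)‖ ≤
          (|C₀| * τ⁻¹ ^ 2 + ‖Z‖ * (M * (4 * τ⁻¹ ^ 2))) * (r.1 ^ 2 + r.2 ^ 2) := by
        calc ‖Q (Y r θ) - (c₀, κ₀, T₀)‖ ≤ C₀ * ‖Y r θ‖ ^ 2 := hC₀ _ (hYlt r hr θ)
          _ ≤ |C₀| * ‖ρ r‖ ^ 2 := by
            gcongr
            · exact le_abs_self C₀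
            · exact hρY r θ
          _ = (|C₀| * τ⁻¹ ^ 2) * ‖r‖ ^ 2 := by
            rw [hρr]
            ring
          _ ≤ _ := by
            gcongr
            · exact le_add_of_nonneg_right (by positivity)
            · exact hsq r
      refine ⟨⟨_, hsplit r hr θ, ?_⟩, d1.trans b1, d2.trans b1, d3.trans b1⟩
      calc _ ≤ ‖Z‖ * (‖U (Q (Y r θ))‖ * (2 * ‖ρ r‖) ^ 2) := Whitham.norm_waveRem_le (h2 r hr).le _
        _ ≤ ‖Z‖ * (M * (2 * ‖ρ r‖) ^ 2) := by
          gcongr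
          exact (hQ _ (hYlt r hr θ)).2.2.1
        _ = (‖Z‖ * (M * (4 * τ⁻¹ ^ 2))) * ‖r‖ ^ 2 := by
          rw [hρr]
          ring
        _ ≤ _ := by
          gcongr
          · exact le_add_of_nonneg_left (by positivity)
          · exact hsq r
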